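/- **Notation.** Let $\omega=e^{2\pi i/3}$, $\epsilon=e^{4\pi i/9}$, $\rho=e^{2\pi i/9}$, $\sigma=\rho(1+2\omega)$, $\phi=e^{i\pi/4}$; a star denotes complex conjugation. Define the following elements of $SU(3)$: $$C=\mathrm{diag}(1,\omega,\omega^2),\quad D=\mathrm{diag}(\epsilon,\epsilon,\epsilon\omega),\quad E=\begin{pmatrix}0&1&0\\0&0&1\\1&0&0\end{pmatrix},\quad B=\begin{pmatrix}0&0&-1\\0&-1&0\\-1&0&0\end{pmatrix},$$ $$V=\frac1{\sqrt3\,i}\begin{pmatrix}1&1&1\\1&\omega&\omega^2\\1&\omega^2&\omega\end{pmatrix},\quad X=\frac1{\sqrt3\,i}\begin{pmatrix}1&1&\omega^2\\1&\omega&\omega\\\omega&1&\omega\end{pmatrix}.$$ Let $\mathbb Z_3=\langle\omega\mathbb 1\rangle$, $\Delta(27)=\langle C,E\rangle$, $\Delta(54)=\langle C,E,B\rangle$, $\Sigma(72\times3)=\langle C,E,V,X\rangle$, $G=\Sigma(216\times3)=\langle C,E,V,D\rangle$ be the generated subgroups of $SU(3)$, and $\Sigma(216)=G/\mathbb Z_3$.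 Let $T'=\langle a,b\mid a^4=a^2b^{-3}=(ab)^3=e\rangle$, $s=a$, $t=ab$. Let $$U_a=i\begin{pmatrix}0&1\\1&0\end{pmatrix},\quad U_b=\frac1{\sqrt2}\begin{pmatrix}\phi&\phi\\-\phi^*&\phi^*\end{pmatrix},\quad U_t=U_aU_b,\quad R_a=\mathrm{diag}(1,-1,-1),\quad R_b=E.$$ Representations are finite-dimensional and complex; an irrep is an irreducible representation; $p$ runs over $0,1,2$. **1. Classes of $\Sigma(216\times3)$.** $|G|=648$, and $G$ has exactly 24 conjugacy classes $C_1,\dots,C_{24}$, the classes of, in this order, $$\mathbb 1,\ \omega\mathbb 1,\ \omega^2\mathbb 1,\ C,\ V^2,\ \omega V^2,\ \omega^2V^2,\ V,\ \omega V,\ \omega^2V,\ ED,\ ED^2,$$ $$D,\ \omega D,\ \omega^2D,\ D^2,\ \omega D^2,\ \omega^2D^2,\ V^2D,\ \omega V^2D,\ \omega^2V^2D,\ VD^2,\ \omega VD^2,\ \omega^2VD^2.$$ Their numbers of elements are $1,1,1,24,9,9,9,54,54,54,72,72,12,12,12,12,12,12,36,36,36,36,36,36$, and the orders of their elements are $1,3,3,3,2,6,6,4,12,12,3,3,9,9,9,9,9,9,18,18,18,18,18,18$.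 The classes $C_4$ and $C_5$ are the conjugacy classes of $C$ and of $V^2$ in $\Sigma(72\times3)$, and $C_8$ is the union of the classes of $V$, $X$ and $\omega^2VX$ in $\Sigma(72\times3)$. **2. Classes of $\Sigma(216)$.** $|\Sigma(216)|=216$, and $\Sigma(216)$ has exactly 10 conjugacy classes $\widetilde C_1,\dots,\widetilde C_{10}$, the classes of the images of $\mathbb 1, C, V^2, V, ED, ED^2, D, D^2, V^2D, VD^2$. Their numbers of elements are $1,8,9,54,24,24,12,12,36,36$ and the orders of their elements $1,3,2,4,3,3,3,3,6,6$. Under $G\to\Sigma(216)$ the classes $C_1,C_2,C_3$ map to $\widetilde C_1$; $C_4$ to $\widetilde C_2$; $C_5,C_6,C_7$ to $\widetilde C_3$; $C_8,C_9,C_{10}$ to $\widetilde C_4$; $C_{11}$ to $\widetilde C_5$; $C_{12}$ to $\widetilde C_6$; $C_{13},C_{14},C_{15}$ to $\widetilde C_7$; $C_{16},C_{17},C_{18}$ to $\widetilde C_8$; $C_{19},C_{20},C_{21}$ to $\widetilde C_9$; $C_{22},C_{23},C_{24}$ to $\widetilde C_{10}$. **3. Irreps of $\Sigma(216\times3)$.**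 Up to equivalence $G$ has exactly 24 irreps: three of dimension 1, three of dimension 2, seven of dimension 3, six of dimension 6, three of dimension 8 and two of dimension 9, denoted $\mathbf 1^{(p)},\mathbf 2^{(p)},\mathbf 3^{(a)},\mathbf 3^{(p)},(\mathbf 3^{(p)})^*,\mathbf 6^{(p)},(\mathbf 6^{(p)})^*,\mathbf 8^{(p)},\mathbf 9,\mathbf 9^*$. Their characters on $C_1,\dots,C_{12}$ are $$\begin{array}{l|rrrrrrrrrrrr} & C_{1} & C_{2} & C_{3} & C_{4} & C_{5} & C_{6} & C_{7} & C_{8} & C_{9} & C_{10} & C_{11} & C_{12} \\ \hline \mathbf 1^{(0)} & 1 & 1 & 1 & 1 & 1 & 1 & 1 & 1 & 1 & 1 & 1 & 1 \\ \mathbf 1^{(1)} & 1 & 1 & 1 & 1 & 1 & 1 & 1 & 1 & 1 & 1 & \omega & \omega^2 \\ \mathbf 1^{(2)} & 1 & 1 & 1 & 1 & 1 & 1 & 1 & 1 & 1 & 1 & \omega^2 & \omega \\ \mathbf 2^{(0)} & 2 & 2 & 2 & 2 & -2 & -2 & -2 & 0 & 0 & 0 & -1 & -1 \\ \mathbf 2^{(1)}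 & 2 & 2 & 2 & 2 & -2 & -2 & -2 & 0 & 0 & 0 & -\omega & -\omega^2 \\ \mathbf 2^{(2)} & 2 & 2 & 2 & 2 & -2 & -2 & -2 & 0 & 0 & 0 & -\omega^2 & -\omega \\ \mathbf 3^{(a)} & 3 & 3 & 3 & 3 & 3 & 3 & 3 & -1 & -1 & -1 & 0 & 0 \\ \mathbf 3^{(0)} & 3 & 3\omega & 3\omega^2 & 0 & -1 & -\omega & -\omega^2 & 1 & \omega & \omega^2 & 0 & 0 \\ \mathbf 3^{(1)} & 3 & 3\omega & 3\omega^2 & 0 & -1 & -\omega & -\omega^2 & 1 & \omega & \omega^2 & 0 & 0 \\ \mathbf 3^{(2)} & 3 & 3\omega & 3\omega^2 & 0 & -1 & -\omega & -\omega^2 & 1 & \omega & \omega^2 & 0 & 0 \\ (\mathbf 3^{(0)})^* & 3 & 3\omega^2 & 3\omega & 0 & -1 & -\omega^2 & -\omega & 1 & \omega^2 & \omega & 0 & 0 \\ (\mathbf 3^{(1)})^* & 3 & 3\omega^2 & 3\omega & 0 & -1 & -\omega^2 & -\omega & 1 & \omega^2 & \omega & 0 & 0 \\ (\mathbf 3^{(2)})^*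 & 3 & 3\omega^2 & 3\omega & 0 & -1 & -\omega^2 & -\omega & 1 & \omega^2 & \omega & 0 & 0 \\ \mathbf 6^{(0)} & 6 & 6\omega & 6\omega^2 & 0 & 2 & 2\omega & 2\omega^2 & 0 & 0 & 0 & 0 & 0 \\ \mathbf 6^{(1)} & 6 & 6\omega & 6\omega^2 & 0 & 2 & 2\omega & 2\omega^2 & 0 & 0 & 0 & 0 & 0 \\ \mathbf 6^{(2)} & 6 & 6\omega & 6\omega^2 & 0 & 2 & 2\omega & 2\omega^2 & 0 & 0 & 0 & 0 & 0 \\ (\mathbf 6^{(0)})^* & 6 & 6\omega^2 & 6\omega & 0 & 2 & 2\omega^2 & 2\omega & 0 & 0 & 0 & 0 & 0 \\ (\mathbf 6^{(1)})^* & 6 & 6\omega^2 & 6\omega & 0 & 2 & 2\omega^2 & 2\omega & 0 & 0 & 0 & 0 & 0 \\ (\mathbf 6^{(2)})^* & 6 & 6\omega^2 & 6\omega & 0 & 2 & 2\omega^2 & 2\omega & 0 & 0 & 0 & 0 & 0 \\ \mathbf 8^{(0)} & 8 & 8 & 8 & -1 & 0 & 0 & 0 & 0 & 0 & 0 & -1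 & -1 \\ \mathbf 8^{(1)} & 8 & 8 & 8 & -1 & 0 & 0 & 0 & 0 & 0 & 0 & -\omega & -\omega^2 \\ \mathbf 8^{(2)} & 8 & 8 & 8 & -1 & 0 & 0 & 0 & 0 & 0 & 0 & -\omega^2 & -\omega \\ \mathbf 9 & 9 & 9\omega & 9\omega^2 & 0 & -3 & -3\omega & -3\omega^2 & -1 & -\omega & -\omega^2 & 0 & 0 \\ \mathbf 9^* & 9 & 9\omega^2 & 9\omega & 0 & -3 & -3\omega^2 & -3\omega & -1 & -\omega^2 & -\omega & 0 & 0 \end{array}$$ and on $C_{13},\dots,C_{24}$ $$\begin{array}{l|rrrrrrrrrrrr} & C_{13} & C_{14} & C_{15} & C_{16} & C_{17} & C_{18} & C_{19} & C_{20} & C_{21} & C_{22} & C_{23} & C_{24} \\ \hline \mathbf 1^{(0)} & 1 & 1 & 1 & 1 & 1 & 1 & 1 & 1 & 1 & 1 & 1 & 1 \\ \mathbf 1^{(1)} & \omega & \omega & \omega & \omega^2 & \omega^2 & \omega^2 & \omega & \omega & \omega & \omega^2 & \omega^2 & \omega^2 \\ \mathbf 1^{(2)} & \omega^2 & \omega^2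 & \omega^2 & \omega & \omega & \omega & \omega^2 & \omega^2 & \omega^2 & \omega & \omega & \omega \\ \mathbf 2^{(0)} & -1 & -1 & -1 & -1 & -1 & -1 & 1 & 1 & 1 & 1 & 1 & 1 \\ \mathbf 2^{(1)} & -\omega & -\omega & -\omega & -\omega^2 & -\omega^2 & -\omega^2 & \omega & \omega & \omega & \omega^2 & \omega^2 & \omega^2 \\ \mathbf 2^{(2)} & -\omega^2 & -\omega^2 & -\omega^2 & -\omega & -\omega & -\omega & \omega^2 & \omega^2 & \omega^2 & \omega & \omega & \omega \\ \mathbf 3^{(a)} & 0 & 0 & 0 & 0 & 0 & 0 & 0 & 0 & 0 & 0 & 0 & 0 \\ \mathbf 3^{(0)} & \omega^2\sigma^* & \sigma^* & \omega\sigma^* & \sigma & \omega\sigma & \omega^2\sigma & -\omega\rho^* & -\omega^2\rho^* & -\rho^* & -\omega^2\rho & -\rho & -\omega\rho \\ \mathbf 3^{(1)} & \sigma^* & \omega\sigma^* & \omega^2\sigma^* & \omega^2\sigma & \sigma & \omega\sigma & -\omega^2\rho^* & -\rho^* & -\omega\rho^* & -\omega\rho & -\omega^2\rho & -\rho \\ \mathbf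 3^{(2)} & \omega\sigma^* & \omega^2\sigma^* & \sigma^* & \omega\sigma & \omega^2\sigma & \sigma & -\rho^* & -\omega\rho^* & -\omega^2\rho^* & -\rho & -\omega\rho & -\omega^2\rho \\ (\mathbf 3^{(0)})^* & \omega\sigma & \sigma & \omega^2\sigma & \sigma^* & \omega^2\sigma^* & \omega\sigma^* & -\omega^2\rho & -\omega\rho & -\rho & -\omega\rho^* & -\rho^* & -\omega^2\rho^* \\ (\mathbf 3^{(1)})^* & \sigma & \omega^2\sigma & \omega\sigma & \omega\sigma^* & \sigma^* & \omega^2\sigma^* & -\omega\rho & -\rho & -\omega^2\rho & -\omega^2\rho^* & -\omega\rho^* & -\rho^* \\ (\mathbf 3^{(2)})^* & \omega^2\sigma & \omega\sigma & \sigma & \omega^2\sigma^* & \omega\sigma^* & \sigma^* & -\rho & -\omega^2\rho & -\omega\rho & -\rho^* & -\omega^2\rho^* & -\omega\rho^* \\ \mathbf 6^{(0)} & -\omega\sigma^* & -\omega^2\sigma^* & -\sigma^* & -\omega\sigma & -\omega^2\sigma & -\sigma & -\rho^* & -\omega\rho^* & -\omega^2\rho^* & -\rho & -\omega\rho & -\omega^2\rho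 \\ \mathbf 6^{(1)} & -\omega^2\sigma^* & -\sigma^* & -\omega\sigma^* & -\sigma & -\omega\sigma & -\omega^2\sigma & -\omega\rho^* & -\omega^2\rho^* & -\rho^* & -\omega^2\rho & -\rho & -\omega\rho \\ \mathbf 6^{(2)} & -\sigma^* & -\omega\sigma^* & -\omega^2\sigma^* & -\omega^2\sigma & -\sigma & -\omega\sigma & -\omega^2\rho^* & -\rho^* & -\omega\rho^* & -\omega\rho & -\omega^2\rho & -\rho \\ (\mathbf 6^{(0)})^* & -\omega^2\sigma & -\omega\sigma & -\sigma & -\omega^2\sigma^* & -\omega\sigma^* & -\sigma^* & -\rho & -\omega^2\rho & -\omega\rho & -\rho^* & -\omega^2\rho^* & -\omega\rho^* \\ (\mathbf 6^{(1)})^* & -\omega\sigma & -\sigma & -\omega^2\sigma & -\sigma^* & -\omega^2\sigma^* & -\omega\sigma^* & -\omega^2\rho & -\omega\rho & -\rho & -\omega\rho^* & -\rho^* & -\omega^2\rho^* \\ (\mathbf 6^{(2)})^* & -\sigma & -\omega^2\sigma & -\omega\sigma & -\omega\sigma^* & -\sigma^* & -\omega^2\sigma^* & -\omega\rho & -\rho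 & -\omega^2\rho & -\omega^2\rho^* & -\omega\rho^* & -\rho^* \\ \mathbf 8^{(0)} & 2 & 2 & 2 & 2 & 2 & 2 & 0 & 0 & 0 & 0 & 0 & 0 \\ \mathbf 8^{(1)} & 2\omega & 2\omega & 2\omega & 2\omega^2 & 2\omega^2 & 2\omega^2 & 0 & 0 & 0 & 0 & 0 & 0 \\ \mathbf 8^{(2)} & 2\omega^2 & 2\omega^2 & 2\omega^2 & 2\omega & 2\omega & 2\omega & 0 & 0 & 0 & 0 & 0 & 0 \\ \mathbf 9 & 0 & 0 & 0 & 0 & 0 & 0 & 0 & 0 & 0 & 0 & 0 & 0 \\ \mathbf 9^* & 0 & 0 & 0 & 0 & 0 & 0 & 0 & 0 & 0 & 0 & 0 & 0 \end{array}$$ **4. Construction.** These irreps can be chosen as follows. * $\Sigma(72\times3)$ is a normal subgroup of $G$, and there is an isomorphism $G/\Sigma(72\times3)\cong\mathbb Z_3$ that maps the coset of $D$ to the standard generator; $\mathbf 1^{(p)}$ is the pull-back of the irrep of $\mathbb Z_3$ that maps this generator to $\omega^p$. * $\Delta(27)$ is a normal subgroup of $G$, and there is an isomorphism $G/\Delta(27)\cong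 T'$ that maps the coset of $V$ to $s$ and the coset of $D$ to $t$; $\mathbf 2^{(p)}$ is the pull-back of a representation of $T'$ with $s\mapsto U_a$, $t\mapsto\omega^pU_t$. * $\Delta(54)$ is a normal subgroup of $G$ and $G/\Delta(54)\cong A_4$; $\mathbf 3^{(a)}$ is the pull-back of a representation of $A_4$ that maps the image of $V$ to $R_a$ and the image of $D$ to $R_aR_b$. * $\mathbf 3^{(0)}$ is the defining representation of $G$, $\mathbf 3^{(p)}\cong\mathbf 1^{(p)}\otimes\mathbf 3^{(0)}$, and $(\mathbf 3^{(p)})^*$ is the complex conjugate of $\mathbf 3^{(p)}$. * $\mathbf 3^{(0)}\otimes\mathbf 3^{(0)}\cong(\mathbf 3^{(0)})^*\oplus(\mathbf 6^{(0)})^*$, $\mathbf 6^{(p)}\cong\mathbf 1^{(p)}\otimes\mathbf 6^{(0)}$, and $(\mathbf 6^{(p)})^*$ is the complex conjugate of $\mathbf 6^{(p)}$. * $\mathbf 3^{(0)}\otimes(\mathbf 3^{(0)})^*\cong\mathbf 1^{(0)}\oplus\mathbf 8^{(0)}$ and $\mathbf 8^{(p)}\cong\mathbf 1^{(p)}\otimes\mathbf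 8^{(0)}$. * $\mathbf 9\cong\mathbf 3^{(0)}\otimes\mathbf 3^{(a)}$, and $\mathbf 9^*\cong(\mathbf 3^{(0)})^*\otimes\mathbf 3^{(a)}$ is the complex conjugate of $\mathbf 9$. **5. Irreps of $\Sigma(216)$.** The irreps $\mathbf 1^{(p)},\mathbf 2^{(p)},\mathbf 3^{(a)},\mathbf 8^{(p)}$ of $G$ factor through $\Sigma(216)$, and the ten representations of $\Sigma(216)$ so obtained are all its irreps, each once, up to equivalence. Their characters are $$\begin{array}{l|rrrrrrrrrr} & \widetilde C_{1} & \widetilde C_{2} & \widetilde C_{3} & \widetilde C_{4} & \widetilde C_{5} & \widetilde C_{6} & \widetilde C_{7} & \widetilde C_{8} & \widetilde C_{9} & \widetilde C_{10} \\ \hline \mathbf 1^{(0)} & 1 & 1 & 1 & 1 & 1 & 1 & 1 & 1 & 1 & 1 \\ \mathbf 1^{(1)} & 1 & 1 & 1 & 1 & \omega & \omega^2 & \omega & \omega^2 & \omega & \omega^2 \\ \mathbf 1^{(2)} & 1 & 1 & 1 & 1 & \omega^2 & \omega & \omega^2 & \omega & \omega^2 & \omega \\ \mathbf 2^{(0)}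 & 2 & 2 & -2 & 0 & -1 & -1 & -1 & -1 & 1 & 1 \\ \mathbf 2^{(1)} & 2 & 2 & -2 & 0 & -\omega & -\omega^2 & -\omega & -\omega^2 & \omega & \omega^2 \\ \mathbf 2^{(2)} & 2 & 2 & -2 & 0 & -\omega^2 & -\omega & -\omega^2 & -\omega & \omega^2 & \omega \\ \mathbf 3^{(a)} & 3 & 3 & 3 & -1 & 0 & 0 & 0 & 0 & 0 & 0 \\ \mathbf 8^{(0)} & 8 & -1 & 0 & 0 & -1 & -1 & 2 & 2 & 0 & 0 \\ \mathbf 8^{(1)} & 8 & -1 & 0 & 0 & -\omega & -\omega^2 & 2\omega & 2\omega^2 & 0 & 0 \\ \mathbf 8^{(2)} & 8 & -1 & 0 & 0 & -\omega^2 & -\omega & 2\omega^2 & 2\omega & 0 & 0 \end{array}$$ -/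

import Mathlib

universe u

namespace Hessian

/-! ### The constants and the generating matrices -/

/-- `ω = e^{2πi/3}`. -/
noncomputable def ω : ℂ := Complex.exp (2 * Real.pi * Complex.I / 3)

/-- `ε = e^{4πi/9}`. -/
noncomputable def ε : ℂ := Complex.exp (4 * Real.pi * Complex.I / 9)

/-- `ρ = e^{2πi/9}`. -/
noncomputable def ρ : ℂ := Complex.exp (2 * Real.pi * Complex.I / 9)

/-- `σ = ρ (1 + 2ω)`. -/
noncomputable def σ : ℂ := ρ * (1 + 2 * ω)

/-- The complex conjugate of `ρ`. -/
noncomputable def ρc : ℂ := starRingEnd ℂ ρ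

/-- The complex conjugate of `σ`. -/
noncomputable def σc : ℂ := starRingEnd ℂ σ

/-- `φ = e^{iπ/4}`. -/
noncomputable def phi : ℂ := Complex.exp (Complex.I * Real.pi / 4)

/-- The scalar matrix `ω 𝟙`. -/
noncomputable def matZ : Matrix (Fin 3) (Fin 3) ℂ := !![ω, 0, 0; 0, ω, 0; 0, 0, ω]

noncomputable def matB : Matrix (Fin 3) (Fin 3) ℂ := !![0, 0, -1; 0, -1, 0; -1, 0, 0]

noncomputable def matC : Matrix (Fin 3) (Fin 3) ℂ := !![1, 0, 0; 0, ω, 0; 0, 0, ω ^ 2]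

noncomputable def matD : Matrix (Fin 3) (Fin 3) ℂ := !![ε, 0, 0; 0, ε, 0; 0, 0, ε * ω]

noncomputable def matE : Matrix (Fin 3) (Fin 3) ℂ := !![0, 1, 0; 0, 0, 1; 1, 0, 0]

noncomputable def matV : Matrix (Fin 3) (Fin 3) ℂ :=
  (1 / ((Real.sqrt 3 : ℂ) * Complex.I)) • !![1, 1, 1; 1, ω, ω ^ 2; 1, ω ^ 2, ω]

noncomputable def matX : Matrix (Fin 3) (Fin 3) ℂ :=
  (1 / ((Real.sqrt 3 : ℂ) * Complex.I)) • !![1, 1, ω ^ 2; 1, ω, ω; ω, 1, ω]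

/-! ### Membership of the generators in `SU(3)` -/

theorem ω_pow : ω ^ 3 = 1 := by
  rw [ω, ← Complex.exp_nat_mul, Complex.exp_eq_one_iff]
  exact ⟨1, by push_cast; ring⟩

theorem ω_ne : ω ≠ 1 := by
  intro h
  rw [ω, Complex.exp_eq_one_iff] at h
  obtain ⟨n, hn⟩ := h
  have h1 : (2 * Real.pi * Complex.I : ℂ) * (1 - 3 * n) = 0 := by linear_combination 3 * hn
  rcases mul_eq_zero.1 h1 with h2 | h2
  · exact Complex.two_pi_I_ne_zero h2
  · have h3 : (1 - 3 * n : ℤ) = 0 := by exact_mod_cast h2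
    omega

theorem ω_sum : 1 + ω + ω ^ 2 = 0 := by
  have h : (ω - 1) * (1 + ω + ω ^ 2) = 0 := by linear_combination ω_pow
  exact (mul_eq_zero.1 h).resolve_left (sub_ne_zero.2 ω_ne)

theorem star_ω : (starRingEnd ℂ) ω = ω ^ 2 := by
  have h : (starRingEnd ℂ) ω * ω = 1 := by
    rw [ω, ← Complex.exp_conj, ← Complex.exp_add, Complex.exp_eq_one_iff]
    refine ⟨0, ?_⟩
    simp only [map_div₀, map_mul, Complex.conj_ofReal, Complex.conj_I, map_ofNat]
    push_cast
    ring
  linear_combination ω ^ 2 * h - (starRingEnd ℂ) ω * ω_pow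

theorem ε_pow : ε ^ 3 = ω ^ 2 := by
  rw [ε, ω, ← Complex.exp_nat_mul, ← Complex.exp_nat_mul]
  congr 1
  push_cast
  ring

theorem star_ε : ε * (starRingEnd ℂ) ε = 1 := by
  rw [ε, ← Complex.exp_conj, ← Complex.exp_add, Complex.exp_eq_one_iff]
  refine ⟨0, ?_⟩
  simp only [map_div₀, map_mul, Complex.conj_ofReal, Complex.conj_I, map_ofNat]
  push_cast
  ring

theorem star_scale : (1 / ((Real.sqrt 3 : ℂ) * Complex.I)) *
    (starRingEnd ℂ) (1 / ((Real.sqrt 3 : ℂ) * Complex.I)) = 1 / 3 := by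
  have h : (Real.sqrt 3 : ℂ) ^ 2 = 3 := by
    rw [← Complex.ofReal_pow, Real.sq_sqrt (by norm_num)]
    norm_num
  rw [map_div₀, map_mul, Complex.conj_ofReal, Complex.conj_I, map_one, div_mul_div_comm]
  congr 1
  · ring
  · linear_combination h - (Real.sqrt 3 : ℂ) ^ 2 * Complex.I_sq

theorem ω_eq : ω = -1 / 2 + (Real.sqrt 3 : ℂ) / 2 * Complex.I := by
  have h : (2 * Real.pi * Complex.I / 3 : ℂ) = ((Real.pi - Real.pi / 3 : ℝ) : ℂ) * Complex.I := by
    push_cast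
    ring
  rw [ω, h, Complex.exp_mul_I, ← Complex.ofReal_cos, ← Complex.ofReal_sin, Real.cos_pi_sub,
    Real.sin_pi_sub, Real.cos_pi_div_three, Real.sin_pi_div_three]
  push_cast
  ring

theorem scale_pow : (1 / ((Real.sqrt 3 : ℂ) * Complex.I)) ^ 3 * (3 * (ω ^ 2 - ω)) = 1 := by
  have h : (Real.sqrt 3 : ℂ) ^ 2 = 3 := by
    rw [← Complex.ofReal_pow, Real.sq_sqrt (by norm_num)]
    norm_num
  have h0 : (Real.sqrt 3 : ℂ) ≠ 0 := by
    intro h0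
    rw [h0] at h
    norm_num at h
  have h1 : ω ^ 2 - ω = -((Real.sqrt 3 : ℂ) * Complex.I) := by
    linear_combination ω_sum - 2 * ω_eq
  have h2 : ((Real.sqrt 3 : ℂ) * Complex.I) ^ 3 ≠ 0 :=
    pow_ne_zero 3 (mul_ne_zero h0 Complex.I_ne_zero)
  rw [h1, one_div, inv_pow, inv_mul_eq_one₀ h2]
  linear_combination (Real.sqrt 3 : ℂ) * Complex.I ^ 3 * h + 3 * (Real.sqrt 3 : ℂ) * Complex.I * Complex.I_sq

theorem matZ_mem : matZ ∈ Matrix.specialUnitaryGroup (Fin 3) ℂ := by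
  rw [Matrix.mem_specialUnitaryGroup_iff, Matrix.mem_unitaryGroup_iff]
  constructor
  · ext i j
    fin_cases i <;> fin_cases j <;>
      simp [matZ, Matrix.mul_apply, Fin.sum_univ_three, Matrix.star_apply, star_ω] <;>
      linear_combination ω_pow
  · simp [matZ, Matrix.det_fin_three]
    linear_combination ω_pow

theorem matB_mem : matB ∈ Matrix.specialUnitaryGroup (Fin 3) ℂ := by
  rw [Matrix.mem_specialUnitaryGroup_iff, Matrix.mem_unitaryGroup_iff]
  constructor
  · ext i j
    fin_cases i <;> fin_cases j <;>
      simp [matB, Matrix.mul_apply, Fin.sum_univ_three, Matrix.star_apply]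
  · simp [matB, Matrix.det_fin_three]

theorem matC_mem : matC ∈ Matrix.specialUnitaryGroup (Fin 3) ℂ := by
  rw [Matrix.mem_specialUnitaryGroup_iff, Matrix.mem_unitaryGroup_iff]
  constructor
  · ext i j
    fin_cases i <;> fin_cases j <;>
      simp [matC, Matrix.mul_apply, Fin.sum_univ_three, Matrix.star_apply, star_ω]
    · linear_combination ω_pow
    · linear_combination (ω ^ 3 + 1) * ω_pow
  · simp [matC, Matrix.det_fin_three]
    linear_combination ω_pow

theorem matD_mem : matD ∈ Matrix.specialUnitaryGroup (Fin 3) ℂ := by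
  rw [Matrix.mem_specialUnitaryGroup_iff, Matrix.mem_unitaryGroup_iff]
  constructor
  · ext i j
    fin_cases i <;> fin_cases j <;>
      simp [matD, Matrix.mul_apply, Fin.sum_univ_three, Matrix.star_apply, star_ω]
    · linear_combination star_ε
    · linear_combination star_ε
    · linear_combination ω ^ 3 * star_ε + ω_pow
  · simp [matD, Matrix.det_fin_three]
    linear_combination ω * ε_pow + ω_pow

theorem matE_mem : matE ∈ Matrix.specialUnitaryGroup (Fin 3) ℂ := by
  rw [Matrix.mem_specialUnitaryGroup_iff, Matrix.mem_unitaryGroup_iff]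
  constructor
  · ext i j
    fin_cases i <;> fin_cases j <;>
      simp [matE, Matrix.mul_apply, Fin.sum_univ_three, Matrix.star_apply]
  · simp [matE, Matrix.det_fin_three]

theorem matV_mem : matV ∈ Matrix.specialUnitaryGroup (Fin 3) ℂ := by
  rw [Matrix.mem_specialUnitaryGroup_iff, Matrix.mem_unitaryGroup_iff]
  have hs := star_scale
  have hp := scale_pow
  rw [matV]
  set c : ℂ := 1 / ((Real.sqrt 3 : ℂ) * Complex.I) with hc
  constructor
  · rw [star_smul, Matrix.smul_mul, Matrix.mul_smul, smul_smul]
    rw [show c * star c = 1 / 3 from hs]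
    clear hs hp hc
    have h1 := ω_pow
    have h2 := ω_sum
    ext i j
    simp only [Matrix.smul_apply, Matrix.mul_apply, Fin.sum_univ_three, Matrix.star_apply]
    fin_cases i <;> fin_cases j <;> simp [star_ω] <;> grind
  · rw [Matrix.det_smul]
    simp only [Fintype.card_fin]
    rw [← hp]
    congr 1
    simp [Matrix.det_fin_three]
    grind [ω_pow, ω_sum]

theorem matX_mem : matX ∈ Matrix.specialUnitaryGroup (Fin 3) ℂ := by
  rw [Matrix.mem_specialUnitaryGroup_iff, Matrix.mem_unitaryGroup_iff]
  have hs := star_scale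
  have hp := scale_pow
  rw [matX]
  set c : ℂ := 1 / ((Real.sqrt 3 : ℂ) * Complex.I) with hc
  constructor
  · rw [star_smul, Matrix.smul_mul, Matrix.mul_smul, smul_smul]
    rw [show c * star c = 1 / 3 from hs]
    clear hs hp hc
    have h1 := ω_pow
    have h2 := ω_sum
    ext i j
    simp only [Matrix.smul_apply, Matrix.mul_apply, Fin.sum_univ_three, Matrix.star_apply]
    fin_cases i <;> fin_cases j <;> simp [star_ω] <;> grind
  · rw [Matrix.det_smul]
    simp only [Fintype.card_fin]
    rw [← hp]
    congr 1
    simp [Matrix.det_fin_three]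
    grind [ω_pow, ω_sum]

/-! ### The groups -/

/-- The group `SU(3)`. -/
abbrev SU3 : Type := Matrix.specialUnitaryGroup (Fin 3) ℂ

noncomputable def suZ : SU3 := ⟨matZ, matZ_mem⟩
noncomputable def suB : SU3 := ⟨matB, matB_mem⟩
noncomputable def suC : SU3 := ⟨matC, matC_mem⟩
noncomputable def suD : SU3 := ⟨matD, matD_mem⟩
noncomputable def suE : SU3 := ⟨matE, matE_mem⟩
noncomputable def suV : SU3 := ⟨matV, matV_mem⟩
noncomputable def suX : SU3 := ⟨matX, matX_mem⟩

/-- The group `ℤ₃ = ⟨⟨ω𝟙⟩⟩`. -/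
noncomputable def Z3 : Subgroup SU3 := Subgroup.closure {suZ}

/-- The group `Δ(27) = ⟨⟨C, E⟩⟩`. -/
noncomputable def Delta27 : Subgroup SU3 := Subgroup.closure {suC, suE}

/-- The group `Δ(54) = ⟨⟨C, E, B⟩⟩`. -/
noncomputable def Delta54 : Subgroup SU3 := Subgroup.closure {suC, suE, suB}

/-- The group `Σ(72×3) = ⟨⟨C, E, V, X⟩⟩`. -/
noncomputable def Sigma72x3 : Subgroup SU3 := Subgroup.closure {suC, suE, suV, suX}

/-- The group `Σ(216×3) = ⟨⟨C, E, V, D⟩⟩`. -/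
noncomputable def Sigma216x3 : Subgroup SU3 := Subgroup.closure {suC, suE, suV, suD}

theorem suZ_eq : suZ = suD ^ 6 := by
  have h3 : matD ^ 3 = !![ω ^ 2, 0, 0; 0, ω ^ 2, 0; 0, 0, ω ^ 2] := by
    have h1 := ω_pow
    have h2 := ε_pow
    ext i j
    fin_cases i <;> fin_cases j <;>
      simp [matD, pow_succ, Matrix.mul_apply, Fin.sum_univ_three] <;> grind
  have h6 : matZ = (matD ^ 3) ^ 2 := by
    have h1 := ω_pow
    rw [h3]
    ext i j
    fin_cases i <;> fin_cases j <;>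
      simp [matZ, pow_two, Matrix.mul_apply, Fin.sum_univ_three] <;> grind
  apply Subtype.ext
  rw [← pow_mul] at h6
  exact h6

theorem suZ_comm (g : SU3) : g * suZ = suZ * g := by
  apply Subtype.ext
  change g.1 * matZ = matZ * g.1
  ext i j
  fin_cases j <;> fin_cases i <;>
    simp [matZ, Matrix.mul_apply, Fin.sum_univ_three, mul_comm]

/-- The elements `C`, `E`, `V`, `D`, `ω𝟙` of the group `Σ(216×3)`. -/
noncomputable def gC : Sigma216x3 := ⟨suC, Subgroup.subset_closure (by simp)⟩
noncomputable def gE : Sigma216x3 := ⟨suE, Subgroup.subset_closure (by simp)⟩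
noncomputable def gV : Sigma216x3 := ⟨suV, Subgroup.subset_closure (by simp)⟩
noncomputable def gD : Sigma216x3 := ⟨suD, Subgroup.subset_closure (by simp)⟩
noncomputable def gZ : Sigma216x3 :=
  ⟨suZ, suZ_eq ▸ Subgroup.pow_mem _ (Subgroup.subset_closure (by simp)) 6⟩

instance : (Z3.subgroupOf Sigma216x3).Normal := by
  have hc : Z3 ≤ Subgroup.center SU3 := by
    rw [Z3, Subgroup.closure_le, Set.singleton_subset_iff]
    exact Subgroup.mem_center_iff.2 suZ_comm
  constructor
  intro n hn g
  have h1 : (g : SU3) * n = n * g := Subgroup.mem_center_iff.1 (hc hn) g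
  have h2 : g * n = n * g := Subtype.ext h1
  rwa [h2, mul_inv_cancel_right]

/-- The group `Σ(216) = Σ(216×3)/ℤ₃`. -/
abbrev Sigma216 : Type := Sigma216x3 ⧸ Z3.subgroupOf Sigma216x3

/-- The group `T'`, presented by generators `a`, `b` and relations `a⁴ = a²b⁻³ = (ab)³ = e`. -/
abbrev TPrime : Type :=
  PresentedGroup
    ({(FreeGroup.of 0) ^ 4, (FreeGroup.of 0) ^ 2 * ((FreeGroup.of 1) ^ 3)⁻¹,
      (FreeGroup.of 0 * FreeGroup.of 1) ^ 3} : Set (FreeGroup (Fin 2)))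

/-- The generator `s = a` of `T'`. -/
def tS : TPrime := PresentedGroup.of 0

/-- The generator `t = ab` of `T'`. -/
def tT : TPrime := PresentedGroup.of 0 * PresentedGroup.of 1

/-! ### Conjugacy classes -/

/-- The set of all `h g h⁻¹` with `h` in the subgroup `H`. -/
def conjOrbit (H : Subgroup SU3) (g : SU3) : Set SU3 := {x | ∃ h ∈ H, x = h * g * h⁻¹}

/-- Representatives of the classes `C₁'', …, C₂₄''` of `Σ(216×3)`. -/
noncomputable def classRep : Fin 24 → Sigma216x3 :=
  ![1, gZ, gZ ^ 2, gC, gV ^ 2, gZ * gV ^ 2, gZ ^ 2 * gV ^ 2, gV, gZ * gV, gZ ^ 2 * gV,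
    gE * gD, gE * gD ^ 2, gD, gZ * gD, gZ ^ 2 * gD, gD ^ 2, gZ * gD ^ 2, gZ ^ 2 * gD ^ 2,
    gV ^ 2 * gD, gZ * (gV ^ 2 * gD), gZ ^ 2 * (gV ^ 2 * gD),
    gV * gD ^ 2, gZ * (gV * gD ^ 2), gZ ^ 2 * (gV * gD ^ 2)]

/-- The number of elements of each class. -/
def classSize : Fin 24 → ℕ :=
  ![1, 1, 1, 24, 9, 9, 9, 54, 54, 54, 72, 72, 12, 12, 12, 12, 12, 12, 36, 36, 36, 36, 36, 36]

/-- The order of the elements of each class. -/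
def classOrder : Fin 24 → ℕ :=
  ![1, 3, 3, 3, 2, 6, 6, 4, 12, 12, 3, 3, 9, 9, 9, 9, 9, 9, 18, 18, 18, 18, 18, 18]

/-- Representatives of the ten classes of `Σ(216)`. -/
noncomputable def classRep216 : Fin 10 → Sigma216 := fun k =>
  QuotientGroup.mk
    ((![1, gC, gV ^ 2, gV, gE * gD, gE * gD ^ 2, gD, gD ^ 2, gV ^ 2 * gD, gV * gD ^ 2] :
      Fin 10 → Sigma216x3) k)

def classSize216 : Fin 10 → ℕ := ![1, 8, 9, 54, 24, 24, 12, 12, 36, 36]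

def classOrder216 : Fin 10 → ℕ := ![1, 3, 2, 4, 3, 3, 3, 3, 6, 6]

/-- The class of `Σ(216)` into which each class of `Σ(216×3)` is mapped. -/
def collapse : Fin 24 → Fin 10 :=
  ![0, 0, 0, 1, 2, 2, 2, 3, 3, 3, 4, 5, 6, 6, 6, 7, 7, 7, 8, 8, 8, 9, 9, 9]

/-! ### Representations -/

/-- Complex matrix representations of dimension `n`. -/
abbrev MatRep (G : Type*) [Group G] (n : ℕ) : Type _ := G →* Matrix (Fin n) (Fin n) ℂ

/-- A matrix representation as a representation on `ℂⁿ`. -/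
noncomputable def toRep {G : Type*} [Group G] {n : ℕ} (M : MatRep G n) :
    Representation ℂ G (Fin n → ℂ) where
  toFun g := Matrix.toLin' (M g)
  map_one' := by rw [map_one, Matrix.toLin'_one]; rfl
  map_mul' g h := by rw [map_mul, Matrix.toLin'_mul]; rfl

/-- The complex conjugate of a matrix representation. -/
noncomputable def conjRep {G : Type*} [Group G] {n : ℕ} (M : MatRep G n) : MatRep G n where
  toFun g := (M g).map (starRingEnd ℂ)
  map_one' := by rw [map_one, Matrix.map_one _ (map_zero _) (map_one _)]
  map_mul' g h := by rw [map_mul, Matrix.map_mul]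

/-- The character of a matrix representation. -/
noncomputable def character {G : Type*} [Group G] {n : ℕ} (M : MatRep G n) (g : G) : ℂ :=
  (M g).trace

/-- The family `R` consists of pairwise inequivalent irreducible representations of `G`, and each
finite-dimensional irreducible complex representation of `G` is equivalent to a member of it. -/
def IsIrrepList {ι G : Type} [Group G] {d : ι → ℕ} (R : ∀ i, MatRep G (d i)) : Prop :=
  (∀ i, (toRep (R i)).IsIrreducible) ∧
  (∀ i j, Nonempty ((toRep (R i)).Equiv (toRep (R j))) → i = j) ∧
  ∀ (W : Type u) [AddCommGroup W] [Module ℂ W] [FiniteDimensional ℂ W]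
    (τ : Representation ℂ G W), τ.IsIrreducible → ∃ i, Nonempty (τ.Equiv (toRep (R i)))

/-- The defining representation of `Σ(216×3)`. -/
noncomputable def definingRep : MatRep Sigma216x3 3 :=
  (Matrix.specialUnitaryGroup (Fin 3) ℂ).subtype.comp Sigma216x3.subtype

noncomputable def matUa : Matrix (Fin 2) (Fin 2) ℂ := Complex.I • !![0, 1; 1, 0]

noncomputable def matUb : Matrix (Fin 2) (Fin 2) ℂ :=
  (1 / (Real.sqrt 2 : ℂ)) • !![phi, phi; -starRingEnd ℂ phi, starRingEnd ℂ phi]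

noncomputable def matUt : Matrix (Fin 2) (Fin 2) ℂ := matUa * matUb

noncomputable def matRa : Matrix (Fin 3) (Fin 3) ℂ := !![1, 0, 0; 0, -1, 0; 0, 0, -1]

noncomputable def matRb : Matrix (Fin 3) (Fin 3) ℂ := matE

/-! ### The character tables -/

/-- The names `1⁽ᵖ⁾`, `2⁽ᵖ⁾`, `3⁽ᵃ⁾`, `3⁽ᵖ⁾`, `(3⁽ᵖ⁾)*`, `6⁽ᵖ⁾`, `(6⁽ᵖ⁾)*`, `8⁽ᵖ⁾`, `9`, `9*` of the
irreps of `Σ(216×3)`. -/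
inductive Irrep : Type
  | one (p : Fin 3)
  | two (p : Fin 3)
  | threeA
  | three (p : Fin 3)
  | threeBar (p : Fin 3)
  | six (p : Fin 3)
  | sixBar (p : Fin 3)
  | eight (p : Fin 3)
  | nine
  | nineBar

/-- The dimension of each irrep. -/
def Irrep.dim : Irrep → ℕ
  | .one _ => 1
  | .two _ => 2
  | .threeA => 3
  | .three _ => 3
  | .threeBar _ => 3
  | .six _ => 6
  | .sixBar _ => 6
  | .eight _ => 8
  | .nine => 9
  | .nineBar => 9

/-- The characters of `1⁽ᵖ⁾` for `p = 0, 1, 2`. -/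
noncomputable def rowOne : Fin 3 → Fin 24 → ℂ :=
  ![![1, 1, 1, 1, 1, 1, 1, 1, 1, 1, 1, 1,
       1, 1, 1, 1, 1, 1, 1, 1, 1, 1, 1, 1],
    ![1, 1, 1, 1, 1, 1, 1, 1, 1, 1, ω, ω ^ 2,
       ω, ω, ω, ω ^ 2, ω ^ 2, ω ^ 2, ω, ω, ω, ω ^ 2, ω ^ 2, ω ^ 2],
    ![1, 1, 1, 1, 1, 1, 1, 1, 1, 1, ω ^ 2, ω,
       ω ^ 2, ω ^ 2, ω ^ 2, ω, ω, ω, ω ^ 2, ω ^ 2, ω ^ 2, ω, ω, ω]]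

/-- The characters of `2⁽ᵖ⁾` for `p = 0, 1, 2`. -/
noncomputable def rowTwo : Fin 3 → Fin 24 → ℂ :=
  ![![2, 2, 2, 2, -2, -2, -2, 0, 0, 0, -1, -1,
       -1, -1, -1, -1, -1, -1, 1, 1, 1, 1, 1, 1],
    ![2, 2, 2, 2, -2, -2, -2, 0, 0, 0, -ω, -ω ^ 2,
       -ω, -ω, -ω, -ω ^ 2, -ω ^ 2, -ω ^ 2, ω, ω, ω, ω ^ 2, ω ^ 2, ω ^ 2],
    ![2, 2, 2, 2, -2, -2, -2, 0, 0, 0, -ω ^ 2, -ω,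
       -ω ^ 2, -ω ^ 2, -ω ^ 2, -ω, -ω, -ω, ω ^ 2, ω ^ 2, ω ^ 2, ω, ω, ω]]

/-- The characters of `3⁽ᵃ⁾`. -/
noncomputable def rowThreeA : Fin 24 → ℂ :=
  ![3, 3, 3, 3, 3, 3, 3, -1, -1, -1, 0, 0,
    0, 0, 0, 0, 0, 0, 0, 0, 0, 0, 0, 0]

/-- The characters of `3⁽ᵖ⁾` for `p = 0, 1, 2`. -/
noncomputable def rowThree : Fin 3 → Fin 24 → ℂ :=
  ![![3, 3 * ω, 3 * ω ^ 2, 0, -1, -ω, -ω ^ 2, 1, ω, ω ^ 2, 0, 0,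
       ω ^ 2 * σc, σc, ω * σc, σ, ω * σ, ω ^ 2 * σ, -ω * ρc, -ω ^ 2 * ρc, -ρc, -ω ^ 2 * ρ, -ρ, -ω * ρ],
    ![3, 3 * ω, 3 * ω ^ 2, 0, -1, -ω, -ω ^ 2, 1, ω, ω ^ 2, 0, 0,
       σc, ω * σc, ω ^ 2 * σc, ω ^ 2 * σ, σ, ω * σ, -ω ^ 2 * ρc, -ρc, -ω * ρc, -ω * ρ, -ω ^ 2 * ρ, -ρ],
    ![3, 3 * ω, 3 * ω ^ 2, 0, -1, -ω, -ω ^ 2, 1, ω, ω ^ 2, 0, 0,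
       ω * σc, ω ^ 2 * σc, σc, ω * σ, ω ^ 2 * σ, σ, -ρc, -ω * ρc, -ω ^ 2 * ρc, -ρ, -ω * ρ, -ω ^ 2 * ρ]]

/-- The characters of `(3⁽ᵖ⁾)*` for `p = 0, 1, 2`. -/
noncomputable def rowThreeBar : Fin 3 → Fin 24 → ℂ :=
  ![![3, 3 * ω ^ 2, 3 * ω, 0, -1, -ω ^ 2, -ω, 1, ω ^ 2, ω, 0, 0,
       ω * σ, σ, ω ^ 2 * σ, σc, ω ^ 2 * σc, ω * σc, -ω ^ 2 * ρ, -ω * ρ, -ρ, -ω * ρc, -ρc, -ω ^ 2 * ρc],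
    ![3, 3 * ω ^ 2, 3 * ω, 0, -1, -ω ^ 2, -ω, 1, ω ^ 2, ω, 0, 0,
       σ, ω ^ 2 * σ, ω * σ, ω * σc, σc, ω ^ 2 * σc, -ω * ρ, -ρ, -ω ^ 2 * ρ, -ω ^ 2 * ρc, -ω * ρc, -ρc],
    ![3, 3 * ω ^ 2, 3 * ω, 0, -1, -ω ^ 2, -ω, 1, ω ^ 2, ω, 0, 0,
       ω ^ 2 * σ, ω * σ, σ, ω ^ 2 * σc, ω * σc, σc, -ρ, -ω ^ 2 * ρ, -ω * ρ, -ρc, -ω ^ 2 * ρc, -ω * ρc]]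

/-- The characters of `6⁽ᵖ⁾` for `p = 0, 1, 2`. -/
noncomputable def rowSix : Fin 3 → Fin 24 → ℂ :=
  ![![6, 6 * ω, 6 * ω ^ 2, 0, 2, 2 * ω, 2 * ω ^ 2, 0, 0, 0, 0, 0,
       -ω * σc, -ω ^ 2 * σc, -σc, -ω * σ, -ω ^ 2 * σ, -σ, -ρc, -ω * ρc, -ω ^ 2 * ρc, -ρ, -ω * ρ, -ω ^ 2 * ρ],
    ![6, 6 * ω, 6 * ω ^ 2, 0, 2, 2 * ω, 2 * ω ^ 2, 0, 0, 0, 0, 0,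
       -ω ^ 2 * σc, -σc, -ω * σc, -σ, -ω * σ, -ω ^ 2 * σ, -ω * ρc, -ω ^ 2 * ρc, -ρc, -ω ^ 2 * ρ, -ρ, -ω * ρ],
    ![6, 6 * ω, 6 * ω ^ 2, 0, 2, 2 * ω, 2 * ω ^ 2, 0, 0, 0, 0, 0,
       -σc, -ω * σc, -ω ^ 2 * σc, -ω ^ 2 * σ, -σ, -ω * σ, -ω ^ 2 * ρc, -ρc, -ω * ρc, -ω * ρ, -ω ^ 2 * ρ, -ρ]]

/-- The characters of `(6⁽ᵖ⁾)*` for `p = 0, 1, 2`. -/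
noncomputable def rowSixBar : Fin 3 → Fin 24 → ℂ :=
  ![![6, 6 * ω ^ 2, 6 * ω, 0, 2, 2 * ω ^ 2, 2 * ω, 0, 0, 0, 0, 0,
       -ω ^ 2 * σ, -ω * σ, -σ, -ω ^ 2 * σc, -ω * σc, -σc, -ρ, -ω ^ 2 * ρ, -ω * ρ, -ρc, -ω ^ 2 * ρc, -ω * ρc],
    ![6, 6 * ω ^ 2, 6 * ω, 0, 2, 2 * ω ^ 2, 2 * ω, 0, 0, 0, 0, 0,
       -ω * σ, -σ, -ω ^ 2 * σ, -σc, -ω ^ 2 * σc, -ω * σc, -ω ^ 2 * ρ, -ω * ρ, -ρ, -ω * ρc, -ρc, -ω ^ 2 * ρc],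
    ![6, 6 * ω ^ 2, 6 * ω, 0, 2, 2 * ω ^ 2, 2 * ω, 0, 0, 0, 0, 0,
       -σ, -ω ^ 2 * σ, -ω * σ, -ω * σc, -σc, -ω ^ 2 * σc, -ω * ρ, -ρ, -ω ^ 2 * ρ, -ω ^ 2 * ρc, -ω * ρc, -ρc]]

/-- The characters of `8⁽ᵖ⁾` for `p = 0, 1, 2`. -/
noncomputable def rowEight : Fin 3 → Fin 24 → ℂ :=
  ![![8, 8, 8, -1, 0, 0, 0, 0, 0, 0, -1, -1,
       2, 2, 2, 2, 2, 2, 0, 0, 0, 0, 0, 0],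
    ![8, 8, 8, -1, 0, 0, 0, 0, 0, 0, -ω, -ω ^ 2,
       2 * ω, 2 * ω, 2 * ω, 2 * ω ^ 2, 2 * ω ^ 2, 2 * ω ^ 2, 0, 0, 0, 0, 0, 0],
    ![8, 8, 8, -1, 0, 0, 0, 0, 0, 0, -ω ^ 2, -ω,
       2 * ω ^ 2, 2 * ω ^ 2, 2 * ω ^ 2, 2 * ω, 2 * ω, 2 * ω, 0, 0, 0, 0, 0, 0]]

/-- The characters of `9`. -/
noncomputable def rowNine : Fin 24 → ℂ :=
  ![9, 9 * ω, 9 * ω ^ 2, 0, -3, -3 * ω, -3 * ω ^ 2, -1, -ω, -ω ^ 2, 0, 0,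
    0, 0, 0, 0, 0, 0, 0, 0, 0, 0, 0, 0]

/-- The characters of `9*`. -/
noncomputable def rowNineBar : Fin 24 → ℂ :=
  ![9, 9 * ω ^ 2, 9 * ω, 0, -3, -3 * ω ^ 2, -3 * ω, -1, -ω ^ 2, -ω, 0, 0,
    0, 0, 0, 0, 0, 0, 0, 0, 0, 0, 0, 0]

/-- The character table of `Σ(216×3)`; the columns are the classes of the elements `classRep`. -/
noncomputable def charTable : Irrep → Fin 24 → ℂ
  | .one p => rowOne p
  | .two p => rowTwo p
  | .threeA => rowThreeA
  | .three p => rowThree p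
  | .threeBar p => rowThreeBar p
  | .six p => rowSix p
  | .sixBar p => rowSixBar p
  | .eight p => rowEight p
  | .nine => rowNine
  | .nineBar => rowNineBar

/-- The irreps of `Σ(216×3)` that are irreps of `Σ(216)`. -/
def irrep216 : Fin 10 → Irrep :=
  ![.one 0, .one 1, .one 2, .two 0, .two 1, .two 2, .threeA, .eight 0, .eight 1, .eight 2]

/-- The character table of `Σ(216)`, with the rows in the order of `irrep216`. -/
noncomputable def charTable216 : Fin 10 → Fin 10 → ℂ :=
  ![![1, 1, 1, 1, 1, 1, 1, 1, 1, 1],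
    ![1, 1, 1, 1, ω, ω ^ 2, ω, ω ^ 2, ω, ω ^ 2],
    ![1, 1, 1, 1, ω ^ 2, ω, ω ^ 2, ω, ω ^ 2, ω],
    ![2, 2, -2, 0, -1, -1, -1, -1, 1, 1],
    ![2, 2, -2, 0, -ω, -ω ^ 2, -ω, -ω ^ 2, ω, ω ^ 2],
    ![2, 2, -2, 0, -ω ^ 2, -ω, -ω ^ 2, -ω, ω ^ 2, ω],
    ![3, 3, 3, -1, 0, 0, 0, 0, 0, 0],
    ![8, -1, 0, 0, -1, -1, 2, 2, 0, 0],
    ![8, -1, 0, 0, -ω, -ω ^ 2, 2 * ω, 2 * ω ^ 2, 0, 0],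
    ![8, -1, 0, 0, -ω ^ 2, -ω, 2 * ω ^ 2, 2 * ω, 0, 0]]

end Hessian

open Hessian

namespace Hessian

/-! ### Character theory of finite groups over the complex numbers. -/

section CharacterTheory

open Representation Module

variable {G V W U : Type*} [Group G] [Fintype G]
  [AddCommGroup V] [Module ℂ V] [FiniteDimensional ℂ V]
  [AddCommGroup W] [Module ℂ W] [FiniteDimensional ℂ W]
  [AddCommGroup U] [Module ℂ U] [FiniteDimensional ℂ U]

/-! Everything about the group is reduced to arithmetic with exponents. Let `d = E² D E`, a
conjugate of `D` that commutes with `V²`, and `Y = d V d⁻¹`. Every element of `Σ(216×3)` is uniquely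
`C^a E^b V^s Y^t d^j` with `a, b` mod 3, `s` mod 4, `t` mod 2, `j` mod 9, which gives 3·3·4·2·9 =
648 elements. Here `C, E` generate a Heisenberg group of order 27 with centre generated by `d^6 =
ω𝟙`, while `V, Y` generate a quaternion group normalized by `d`. The relations in `HessRel` suffice
to multiply such words (`HessRel.gWord_mul`). Distinct words are distinct elements as soon as `d^6 ≠
1` (`HessRel.gWord_injective`), because words in `V, Y, d` modulo `d³` act on the Heisenberg group
modulo its centre as the 24 elements of SL(2,3). Orders of elements, centralizers and conjugacy
relations thereby become finite checks.

Any pair satisfying `TetraRel` with `d³ = 1` defines a homomorphism that is trivial on `C` and `E`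
(`tetraHom`). This one construction yields the maps onto `ℤ₃`, `A₄` and `T'`; their kernels are
`Σ(72×3)`, `Δ(54)` and `Δ(27)`.

The degree in `ℤ₃` together with the trace of the defining representation separates the 24 proposed
class representatives (`eq_of_rowThree_eq`). Orbit-stabilizer gives the class sizes, and these add
up to 648, so no class is missing.

All irreps are written down as matrices: pull-backs from the quotients, the defining representation,
the conjugate of its symmetric square, its action on traceless matrices, a Kronecker product, and
twists and conjugates of these. In SU(3) one has `tr A² = (tr A)² - 2 conj (tr A)`
(`trace_mul_self`), so the character of the symmetric square needs only the defining character.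
Irreducibility is the norm criterion `isIrreducible_of_sum_char`. Completeness does not count
classes: the sum of the characters weighted by their dimensions is the regular character, and no
irrep is orthogonal to that (`exists_equiv_of_sum_smul_char`). The tensor product decompositions are
read off from characters.

For `Σ(216)`, the ten irreps trivial on `ω𝟙` descend, and a sum over the quotient is a third of the
corresponding sum over `Σ(216×3)` (`sum_proj`), so the same criteria apply. -/

theorem sum_char_mul_char (ρ : Representation ℂ G V) (σ : Representation ℂ G W) :
    ∑ g : G, σ.character g * ρ.character g⁻¹ =
      Nat.card G * finrank ℂ (IntertwiningMap ρ σ) := by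
  have h0 : (Nat.card G : ℂ) ≠ 0 := by simp
  have := invertibleOfNonzero h0
  rw [← card_inv_mul_sum_char_mul_char_eq_finrank, mul_inv_cancel_left₀ h0]

/-- The hypothesis says that the endomorphism algebra is one-dimensional, hence consists of scalars.
By Maschke every subrepresentation has an equivariant projection onto it; being a scalar, its range
is zero or everything. -/
theorem isIrreducible_of_sum_char (ρ : Representation ℂ G V)
    (h : ∑ g : G, ρ.character g * ρ.character g⁻¹ = Nat.card G) : ρ.IsIrreducible := by
  have h0 : (Nat.card G : ℂ) ≠ 0 := by simp
  rw [sum_char_mul_char, mul_eq_left₀ h0] at h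
  have h1 : finrank ℂ (IntertwiningMap ρ ρ) = 1 := by exact_mod_cast h
  have hne : NeZero (Nat.card G : ℂ) := ⟨h0⟩
  have hone : (IntertwiningMap.id ρ) ≠ 0 := by
    intro h2
    have : ∀ f : IntertwiningMap ρ ρ, f = 0 := by
      intro f
      ext v
      have h3 : IntertwiningMap.id ρ v = 0 := by rw [h2]; rfl
      have h4 : v = 0 := h3
      simp [h4]
    have : Subsingleton (IntertwiningMap ρ ρ) := ⟨fun a b => by rw [this a, this b]⟩
    rw [finrank_zero_of_subsingleton] at h1
    omega
  have hsc := (finrank_eq_one_iff_of_nonzero' _ hone).1 h1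
  have hnt : Nontrivial V := by
    by_contra hV
    rw [not_nontrivial_iff_subsingleton] at hV
    exact hone (by ext v; exact Subsingleton.elim _ _)
  rw [irreducible_iff_isSimpleModule_asModule, isSimpleModule_iff]
  have hnt' : Nontrivial ρ.asModule := hnt
  refine { exists_pair_ne := ⟨⊥, ⊤, bot_ne_top⟩, eq_bot_or_eq_top := fun p => ?_ }
  obtain ⟨q, hq⟩ := exists_isCompl p
  -- The projection onto `p` along an invariant complement, as an endomorphism of the whole module.
  let e : Module.End (MonoidAlgebra ℂ G) ρ.asModule := p.subtype ∘ₗ p.projectionOnto q hq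
  obtain ⟨c, hc⟩ := hsc ((IntertwiningMap.equivLinearMapAsModule ρ ρ).symm e)
  have hc' : ∀ v : ρ.asModule, e v = (c • (v : V) : V) := fun v => by
    have : (IntertwiningMap.equivLinearMapAsModule ρ ρ).symm e v = c • (v : V) := by rw [← hc]; rfl
    exact this
  by_cases hc0 : c = 0
  · left
    rw [eq_bot_iff]
    intro v hv
    have h2 : e v = v := congrArg Subtype.val (Submodule.projectionOnto_apply_left hq ⟨v, hv⟩)
    have h3 := hc' v
    rw [h2, hc0, zero_smul] at h3
    exact h3
  · right
    rw [eq_top_iff]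
    intro v _
    have h2 : (v : V) = e (c⁻¹ • (v : V) : V) := by
      rw [hc', smul_smul, mul_inv_cancel₀ hc0, one_smul]
    have h3 : v = e (c⁻¹ • (v : V) : V) := h2
    rw [h3]
    exact Submodule.coe_mem _

theorem exists_ne_zero_of_sum_char_ne_zero (ρ : Representation ℂ G V) (σ : Representation ℂ G W)
    (h : ∑ g : G, σ.character g * ρ.character g⁻¹ ≠ 0) : ∃ f : IntertwiningMap ρ σ, f ≠ 0 := by
  rw [sum_char_mul_char] at h
  by_contra! hf
  have : Subsingleton (IntertwiningMap ρ σ) := ⟨fun a b => by rw [hf a, hf b]⟩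
  exact h (by rw [finrank_zero_of_subsingleton]; simp)

theorem sum_char_irreducible (ρ : Representation ℂ G V) [ρ.IsIrreducible] :
    ∑ g : G, ρ.character g * ρ.character g⁻¹ = Nat.card G := by
  rw [sum_char_mul_char, IsIrreducible.finrank_intertwiningMap_self]
  simp

theorem sum_char_inequivalent (ρ : Representation ℂ G V) (σ : Representation ℂ G W)
    [ρ.IsIrreducible] [σ.IsIrreducible] (h : ¬ Nonempty (ρ.Equiv σ)) :
    ∑ g : G, σ.character g * ρ.character g⁻¹ = 0 := by
  have : IsEmpty (ρ.Equiv σ) := not_nonempty_iff.1 h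
  rw [sum_char_mul_char, finrank_zero_of_subsingleton]
  simp

/-- Equal characters give a nonzero intertwiner out of the irreducible `ρ`. It is injective by
Schur, and the dimensions agree because they are the characters at 1. -/
theorem nonempty_equiv_of_char_eq (τ : Representation ℂ G W) (ρ : Representation ℂ G V)
    [ρ.IsIrreducible] (h : τ.character = ρ.character) : Nonempty (τ.Equiv ρ) := by
  obtain ⟨f, hf⟩ := exists_ne_zero_of_sum_char_ne_zero ρ τ (by
    rw [h, sum_char_irreducible]
    simp)
  have hi := (IsIrreducible.injective_or_eq_zero f).resolve_right hf
  have hd : finrank ℂ V = finrank ℂ W := by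
    have := congrFun h 1
    rw [char_one, char_one] at this
    exact_mod_cast this.symm
  have hb : Function.Bijective f :=
    ⟨hi, (LinearMap.injective_iff_surjective_of_finrank_eq_finrank (f := f.toLinearMap) hd).1 hi⟩
  exact ⟨(f.ofBijective hb).symm⟩

/-- Both constituents embed in `τ`. Their images meet trivially since they are inequivalent
irreducibles, so the sum of the embeddings is injective, and a dimension count finishes. -/
theorem nonempty_equiv_prod_of_char_eq (τ : Representation ℂ G U) (ρ : Representation ℂ G V)
    (σ : Representation ℂ G W) [ρ.IsIrreducible] [σ.IsIrreducible] (hne : ¬ Nonempty (ρ.Equiv σ))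
    (h : τ.character = ρ.character + σ.character) : Nonempty (τ.Equiv (ρ.prod σ)) := by
  have hne' : ¬ Nonempty (σ.Equiv ρ) := fun ⟨e⟩ => hne ⟨e.symm⟩
  obtain ⟨f, hf⟩ := exists_ne_zero_of_sum_char_ne_zero ρ τ (by
    simp only [h, Pi.add_apply, add_mul, Finset.sum_add_distrib]
    rw [sum_char_irreducible, sum_char_inequivalent _ _ hne]
    simp)
  obtain ⟨k, hk⟩ := exists_ne_zero_of_sum_char_ne_zero σ τ (by
    simp only [h, Pi.add_apply, add_mul, Finset.sum_add_distrib]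
    rw [sum_char_irreducible, sum_char_inequivalent _ _ hne']
    simp)
  have hfi := (IsIrreducible.injective_or_eq_zero f).resolve_right hf
  have hki := (IsIrreducible.injective_or_eq_zero k).resolve_right hk
  -- The part of `ρ` whose image lies in the image of `σ`; it is zero or all of `ρ`.
  let N : Subrepresentation ρ :=
    { toSubmodule := (LinearMap.range k.toLinearMap).comap f.toLinearMap
      apply_mem_toSubmodule := by
        rintro g v ⟨y, hy⟩
        refine ⟨σ g y, ?_⟩
        have hy' : k y = f v := hy
        change k (σ g y) = f (ρ g v)
        rw [k.isIntertwining, f.isIntertwining, hy'] }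
  have hN : ∀ x, x ∈ N ↔ ∃ y, k y = f x := fun x => Iff.rfl
  have hbot : N = ⊥ := by
    refine (eq_bot_or_eq_top N).resolve_right fun htop => ?_
    have hall : ∀ x, ∃ y, k y = f x := fun x => (hN x).1 (htop ▸ trivial)
    choose y hy using hall
    -- If `f` maps into the range of the injective `k`, then `k⁻¹ ∘ f` is a nonzero intertwiner
    -- between inequivalent irreps.
    let e : IntertwiningMap ρ σ :=
      { toFun := y
        map_add' := fun a b => hki (by rw [map_add, hy, hy, hy, map_add])
        map_smul' := fun c a => hki (by rw [map_smul, hy, hy, map_smul]; rfl)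
        isIntertwining' := fun g => by
          ext v
          refine hki ?_
          change k (y (ρ g v)) = k (σ g (y v))
          rw [hy, f.isIntertwining, k.isIntertwining, hy] }
    have he : e ≠ 0 := by
      intro h0
      apply hf
      ext v
      change f v = 0
      have h1 : y v = 0 := congrArg (fun e : IntertwiningMap ρ σ => e v) h0
      rw [← hy, h1, map_zero]
    exact hne ⟨e.ofBijective ((IsIrreducible.bijective_or_eq_zero e).resolve_right he)⟩
  let c : IntertwiningMap (ρ.prod σ) τ :=
    f.comp (IntertwiningMap.fst ℂ ρ σ) + k.comp (IntertwiningMap.snd ℂ ρ σ)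
  have hc : ∀ v : V × W, c v = f v.1 + k v.2 := fun v => rfl
  have hci : Function.Injective c := by
    refine (injective_iff_map_eq_zero c.toLinearMap).2 fun v hv => ?_
    have h1 : f v.1 + k v.2 = 0 := hv
    have h2 : v.1 ∈ N := (hN _).2 ⟨-v.2, by rw [map_neg]; exact (eq_neg_of_add_eq_zero_left h1).symm⟩
    rw [hbot] at h2
    have h3 : v.1 = 0 := h2
    rw [h3, map_zero, zero_add] at h1
    exact Prod.ext h3 (hki (by rw [h1]; exact (map_zero k).symm))
  have hd : finrank ℂ (V × W) = finrank ℂ U := by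
    have := congrFun h 1
    rw [Pi.add_apply, char_one, char_one, char_one] at this
    rw [finrank_prod]
    exact_mod_cast this.symm
  have hb : Function.Bijective c :=
    ⟨hci, (LinearMap.injective_iff_surjective_of_finrank_eq_finrank (f := c.toLinearMap) hd).1 hci⟩
  exact ⟨(c.ofBijective hb).symm⟩

/-- The hypothesis says that a linear combination of the listed characters is the regular character.
An irrep equivalent to none of them would be orthogonal to it, but pairing with the regular
character gives the order of the group times the dimension. -/
theorem exists_equiv_of_sum_smul_char {ι : Type*} [Fintype ι] [DecidableEq G] {d : ι → ℕ}
    (R : ∀ i, MatRep G (d i)) [∀ i, (toRep (R i)).IsIrreducible] (m : ι → ℂ)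
    (h : ∀ g, ∑ i, m i * (toRep (R i)).character g = if g = 1 then (Nat.card G : ℂ) else 0)
    (τ : Representation ℂ G W) [τ.IsIrreducible] : ∃ i, Nonempty (τ.Equiv (toRep (R i))) := by
  by_contra! hne
  have h1 : ∀ i, ∑ g : G, (toRep (R i)).character g * τ.character g⁻¹ = 0 := fun i =>
    sum_char_inequivalent _ _ (not_nonempty_iff.2 (hne i))
  have h2 : ∑ g : G, (∑ i, m i * (toRep (R i)).character g) * τ.character g⁻¹ = 0 := by
    simp only [Finset.sum_mul, mul_assoc]
    rw [Finset.sum_comm]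
    simp only [← Finset.mul_sum, h1, mul_zero, Finset.sum_const_zero]
  simp only [h, ite_mul, zero_mul, Finset.sum_ite_eq', Finset.mem_univ, if_true, inv_one,
    char_one] at h2
  have h3 : finrank ℂ W = 0 := by simpa using h2
  have h4 : Subsingleton W := finrank_zero_iff.1 h3
  have h5 : (⊥ : Subrepresentation τ) = ⊤ :=
    SetLike.ext fun v => by
      rw [Subsingleton.elim v 0]
      exact ⟨fun _ => trivial, fun _ => rfl⟩
  exact bot_ne_top h5

end CharacterTheory

theorem char_toRep {G : Type*} [Group G] {n : ℕ} (M : MatRep G n) (g : G) :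
    (toRep M).character g = character M g := by
  simp [Representation.character, character, toRep]

/-! ### Normal forms of words in a group given by relations. -/

section Words

variable {H : Type*} [Group H]

theorem pow_fin_add {n : ℕ} [NeZero n] {x : H} (h : x ^ n = 1) (a b : Fin n) :
    x ^ ((a + b : Fin n) : ℕ) = x ^ (a : ℕ) * x ^ (b : ℕ) := by
  rw [Fin.val_add, ← pow_eq_pow_mod _ h, pow_add]

theorem pow_fin_mul {n : ℕ} [NeZero n] {x : H} (h : x ^ n = 1) (a b : Fin n) :
    x ^ ((a * b : Fin n) : ℕ) = x ^ ((a : ℕ) * (b : ℕ)) := by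
  rw [Fin.val_mul, ← pow_eq_pow_mod _ h]

theorem semiconjBy_pow_iterate {α : Type*} {w : α → H} {g : H} {f : α → α}
    (h : ∀ x, SemiconjBy g (w x) (w (f x))) (n : ℕ) (x : α) :
    SemiconjBy (g ^ n) (w x) (w (f^[n] x)) := by
  induction n generalizing x with
  | zero => simp
  | succ n ih =>
    rw [pow_succ, Function.iterate_succ_apply]
    exact (ih (f x)).mul_left (h x)

/-! ### Words in the quaternion group and in the group generated by `V` and `d` -/

/-- The exponents `(s, t)` of a word `V ^ s * Y ^ t` in a quaternion group. -/
abbrev QIdx : Type := Fin 4 × Fin 2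

/-- The exponents `(s, t, j)` of a word `V ^ s * Y ^ t * d ^ j`, where `Y = d V d⁻¹`. -/
abbrev NIdx : Type := QIdx × Fin 9

/-- Moving `Y` past `V ^ s'` inverts it, that is, multiplies the exponent by 3 mod 4. The final 2 is
the carry `Y² = V²` when both exponents of `Y` are 1. -/
def qMul : QIdx → QIdx → QIdx := fun (s, t) (s', t') =>
  (s + (if t = 0 then s' else 3 * s') + (if t = 0 then 0 else if t' = 0 then 0 else 2), t + t')

/-- Conjugation by `d` sends `V` to `Y`, with index `(0, 1)`, and `Y` to `V³ Y`, with index `(3,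
1)`; the iterates are powers of these words. -/
def qConj : QIdx → QIdx := fun (s, t) =>
  qMul ((fun x => qMul (0, 1) x)^[(s : ℕ)] (0, 0)) ((fun x => qMul (3, 1) x)^[(t : ℕ)] (0, 0))

/-- Semidirect multiplication; conjugation by `d` has order 3 on the quaternion words, so only `j`
mod 3 acts. -/
def nMul : NIdx → NIdx → NIdx := fun (q, j) (q', j') => (qMul q (qConj^[(j : ℕ) % 3] q'), j + j')

/-- The defining relations of the group of order 72 generated by `V` and `d`. -/
structure TetraRel (V d : H) : Prop where
  V_pow : V ^ 4 = 1
  d_pow : d ^ 9 = 1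
  d_V_sq : d * V ^ 2 = V ^ 2 * d
  Y_V : d * V * d⁻¹ * V = V ^ 3 * (d * V * d⁻¹)
  d_Y : d * (d * V * d⁻¹) * d⁻¹ = V ^ 3 * (d * V * d⁻¹)

def qWord (V d : H) (q : QIdx) : H := V ^ (q.1 : ℕ) * (d * V * d⁻¹) ^ (q.2 : ℕ)

def nWord (V d : H) (n : NIdx) : H := qWord V d n.1 * d ^ (n.2 : ℕ)

namespace TetraRel

variable {V d : H} (h : TetraRel V d)
include h

theorem Y_sq : (d * V * d⁻¹) ^ 2 = V ^ 2 := by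
  rw [conj_pow, h.d_V_sq, mul_inv_cancel_right]

theorem qWord_mul (x y : QIdx) : qWord V d (qMul x y) = qWord V d x * qWord V d y := by
  obtain ⟨s, t⟩ := x
  obtain ⟨s', t'⟩ := y
  have hY := h.Y_sq
  have hs : SemiconjBy (d * V * d⁻¹) V (V ^ 3) := h.Y_V
  simp only [qWord, qMul]
  generalize d * V * d⁻¹ = Y at hY hs
  have h1 : Y * V ^ (s' : ℕ) = V ^ ((3 * s' : Fin 4) : ℕ) * Y := by
    rw [pow_fin_mul h.V_pow, pow_mul]
    exact hs.pow_right s'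
  have h2 : V ^ ((2 : Fin 4) : ℕ) = Y ^ 2 := hY.symm
  rcases Fin.exists_fin_two.1 ⟨t, rfl⟩ with rfl | rfl <;>
    rcases Fin.exists_fin_two.1 ⟨t', rfl⟩ with rfl | rfl
  · simp [pow_fin_add h.V_pow]
  · simp [pow_fin_add h.V_pow, mul_assoc]
  · simp only [Fin.isValue, one_ne_zero, if_false, if_true, add_zero, Fin.val_one, pow_one,
      Fin.val_zero, pow_zero, mul_one, pow_fin_add h.V_pow]
    -- Here `t = 1` and `t' = 0`: the only move is that of `Y` across `V ^ s'`.
    rw [mul_assoc, mul_assoc, h1]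
  · have h3 : ((1 + 1 : Fin 2) : ℕ) = 0 := rfl
    simp only [Fin.isValue, one_ne_zero, if_false, Fin.val_one, pow_one, h3, pow_zero, mul_one,
      pow_fin_add h.V_pow, h2, pow_two]
    rw [mul_assoc _ Y, ← mul_assoc Y, h1]
    simp only [mul_assoc]

theorem qWord_iterate (x : QIdx) (n : ℕ) :
    qWord V d ((fun y => qMul x y)^[n] (0, 0)) = qWord V d x ^ n := by
  induction n with
  | zero => simp [qWord]
  | succ n ih => rw [Function.iterate_succ_apply', h.qWord_mul, ih, pow_succ']

theorem semiconjBy_qWord (x : QIdx) : SemiconjBy d (qWord V d x) (qWord V d (qConj x)) := by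
  obtain ⟨s, t⟩ := x
  simp only [qConj]
  rw [h.qWord_mul, h.qWord_iterate, h.qWord_iterate]
  refine SemiconjBy.mul_right (SemiconjBy.pow_right ?_ _) (SemiconjBy.pow_right ?_ _)
  · simp [SemiconjBy, qWord]
  · have := h.d_Y
    rw [mul_inv_eq_iff_eq_mul] at this
    simpa [SemiconjBy, qWord] using this

theorem semiconjBy_pow_qWord (n : ℕ) (x : QIdx) :
    SemiconjBy (d ^ n) (qWord V d x) (qWord V d (qConj^[n % 3] x)) := by
  -- Checked on the eight quaternion words; it justifies the reduction mod 3 in `nMul`.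
  have h3 : qConj^[3] = id := by
    funext x
    revert x
    decide +kernel
  have h1 := semiconjBy_pow_iterate h.semiconjBy_qWord n x
  rwa [← Nat.mod_add_div n 3, Function.iterate_add_apply, Function.iterate_mul, h3,
    Function.iterate_id, id, Nat.mod_add_div] at h1

theorem nWord_mul (x y : NIdx) : nWord V d (nMul x y) = nWord V d x * nWord V d y := by
  obtain ⟨q, j⟩ := x
  obtain ⟨q', j'⟩ := y
  simp only [nWord, nMul]
  rw [h.qWord_mul, pow_fin_add h.d_pow, mul_assoc, mul_assoc, ← mul_assoc _ (d ^ (j : ℕ)),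
    ← (h.semiconjBy_pow_qWord j q').eq]
  simp only [mul_assoc]

end TetraRel

/-! ### Words in `C`, `E` and the central element -/

/-- The exponents `(a, b, k)` of a word `C ^ a * E ^ b * z ^ k`. -/
abbrev HIdx : Type := Fin 3 × Fin 3 × Fin 3

/-- The term `b * a'` is the cost of moving `E ^ b` past `C ^ a'`, from `E C = z C E`. -/
def hMul : HIdx → HIdx → HIdx := fun (a, b, k) (a', b', k') => (a + a', b + b', k + k' + b * a')

/-- From `C ↦ E` and `E ↦ C²`: the image `E^a C^(2b)` is reordered at the cost of `z^(2ab)`. -/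
def hConjV : HIdx → HIdx := fun (a, b, k) => (2 * b, a, k + 2 * a * b)

/-- From `C ↦ C` and `E ↦ z C² E`, since `(z C² E)^b = C^(2b) E^b z^(b²)`. -/
def hConjd : HIdx → HIdx := fun (a, b, k) => (a + 2 * b, b, k + b * b)

/-- Conjugation by `d V d⁻¹`, where conjugation by `d⁻¹` is the square of conjugation by `d`. -/
def hConjY : HIdx → HIdx := fun x => hConjd (hConjV (hConjd (hConjd x)))

def hConj : NIdx → HIdx → HIdx := fun ((s, t), j) x =>
  hConjV^[(s : ℕ)] (hConjY^[(t : ℕ)] (hConjd^[(j : ℕ) % 3] x))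

/-- The exponents of a word `C ^ a * E ^ b * V ^ s * Y ^ t * d ^ j`. -/
abbrev GIdx : Type := Fin 3 × Fin 3 × NIdx

/-- The second Heisenberg factor is conjugated across `n`. The index has no separate slot for the
centre: a central factor `z^k₂` is rewritten as `d^(6 k₂)` and absorbed in the last component. -/
def gMul : GIdx → GIdx → GIdx := fun (a, b, n) (a', b', n') =>
  match hMul (a, b, 0) (hConj n (a', b', 0)) with
  | (a₂, b₂, k₂) => (a₂, b₂, nMul ((0, 0), ⟨6 * (k₂ : ℕ) % 9, Nat.mod_lt _ (by norm_num)⟩) (nMul n n'))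

/-- The relations of the group of order 648 generated by `C`, `E`, `V` and `d`. -/
structure HessRel (C E V d : H) : Prop extends TetraRel V d where
  C_pow : C ^ 3 = 1
  E_pow : E ^ 3 = 1
  z_C : Commute (d ^ 6) C
  z_E : Commute (d ^ 6) E
  z_V : Commute (d ^ 6) V
  E_C : E * C = d ^ 6 * C * E
  V_C : SemiconjBy V C E
  V_E : SemiconjBy V E (C ^ 2)
  d_C : SemiconjBy d C C
  d_E : SemiconjBy d E (d ^ 6 * C ^ 2 * E)

def hWord (C E d : H) (x : HIdx) : H := C ^ (x.1 : ℕ) * E ^ (x.2.1 : ℕ) * (d ^ 6) ^ (x.2.2 : ℕ)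

def gWord (C E V d : H) (x : GIdx) : H :=
  C ^ (x.1 : ℕ) * E ^ (x.2.1 : ℕ) * nWord V d x.2.2

namespace HessRel

variable {C E V d : H} (h : HessRel C E V d)
include h

theorem z_pow : (d ^ 6) ^ 3 = 1 := by
  rw [← pow_mul, show 6 * 3 = 9 * 2 from rfl, pow_mul, h.d_pow, one_pow]

/-- The commutator `d^6` of `E` and `C` is central among these letters, so each of the `b * a`
transpositions contributes one factor. -/
theorem E_pow_C_pow (b a : ℕ) : E ^ b * C ^ a = C ^ a * E ^ b * (d ^ 6) ^ (b * a) := by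
  have h1 : SemiconjBy E C (C * d ^ 6) := by rw [SemiconjBy, h.E_C, h.z_C.eq]
  have h2 : ∀ a : ℕ, E * C ^ a = C ^ a * E * (d ^ 6) ^ a := fun a => by
    have := (h1.pow_right a).eq
    rw [h.z_C.symm.mul_pow] at this
    rw [this, mul_assoc, mul_assoc, (h.z_E.pow_left a).eq]
  induction b with
  | zero => simp
  | succ b ih =>
    rw [pow_succ', mul_assoc, ih, ← mul_assoc, ← mul_assoc, h2, Nat.succ_mul, pow_add]
    rw [mul_assoc _ ((d ^ 6) ^ a), ((h.z_E.pow_pow a b)).eq, ← mul_assoc, mul_assoc _ E,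
      mul_assoc _ ((d ^ 6) ^ a), (Commute.refl (d ^ 6)).pow_pow a (b * a)]

theorem hWord_mul (x y : HIdx) : hWord C E d (hMul x y) = hWord C E d x * hWord C E d y := by
  obtain ⟨a, b, k⟩ := x
  obtain ⟨a', b', k'⟩ := y
  simp only [hWord, hMul, pow_fin_add h.C_pow, pow_fin_add h.E_pow, pow_fin_add h.z_pow,
    pow_fin_mul h.z_pow]
  have h1 := h.E_pow_C_pow b a'
  have h2 : ∀ m n : ℕ, (d ^ 6) ^ m * C ^ n = C ^ n * (d ^ 6) ^ m := fun m n => h.z_C.pow_pow m n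
  have h3 : ∀ m n : ℕ, (d ^ 6) ^ m * E ^ n = E ^ n * (d ^ 6) ^ m := fun m n => h.z_E.pow_pow m n
  have h4 : ∀ m n : ℕ, (d ^ 6) ^ m * (d ^ 6) ^ n = (d ^ 6) ^ n * (d ^ 6) ^ m :=
    fun m n => (Commute.refl (d ^ 6)).pow_pow m n
  generalize d ^ 6 = z at *
  calc _ = C ^ (a : ℕ) * (C ^ (a' : ℕ) * E ^ (b : ℕ)) * (E ^ (b' : ℕ) *
        (z ^ (k : ℕ) * z ^ (k' : ℕ) * z ^ ((b : ℕ) * a'))) := by simp only [mul_assoc]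
    _ = C ^ (a : ℕ) * (C ^ (a' : ℕ) * E ^ (b : ℕ) * z ^ ((b : ℕ) * a')) * (E ^ (b' : ℕ) *
        (z ^ (k : ℕ) * z ^ (k' : ℕ))) := by
      rw [← pow_add z k, h4, ← mul_assoc (E ^ (b' : ℕ)) (z ^ _), ← h3, pow_add]
      simp only [mul_assoc]
    _ = _ := by
      rw [← h1, ← mul_assoc _ (z ^ (k : ℕ)), ← h3]
      have h5 := h2 k a'
      have h6 := h3 k b
      calc _ = C ^ (a : ℕ) * E ^ (b : ℕ) * (C ^ (a' : ℕ) * z ^ (k : ℕ)) * (E ^ (b' : ℕ) *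
            z ^ (k' : ℕ)) := by simp only [mul_assoc]
        _ = _ := by rw [← h5]; simp only [mul_assoc]

theorem hWord_iterate (x : HIdx) (n : ℕ) :
    hWord C E d ((fun y => hMul x y)^[n] (0, 0, 0)) = hWord C E d x ^ n := by
  induction n with
  | zero => simp [hWord]
  | succ n ih => rw [Function.iterate_succ_apply', h.hWord_mul, ih, pow_succ']

/-- A conjugation that fixes the centre is determined by the images `u`, `v` of `C`, `E`. The
hypothesis `hf` says that the closed formula `f` agrees with the product computed from `u` and `v`,
which is decidable. -/
theorem semiconjBy_hWord {g : H} (u v : HIdx) (hC : SemiconjBy g C (hWord C E d u))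
    (hE : SemiconjBy g E (hWord C E d v)) (hz : Commute g (d ^ 6)) {f : HIdx → HIdx}
    (hf : ∀ x : HIdx, f x = hMul ((fun y => hMul u y)^[(x.1 : ℕ)] (0, 0, 0))
      (hMul ((fun y => hMul v y)^[(x.2.1 : ℕ)] (0, 0, 0)) (0, 0, x.2.2))) (x : HIdx) :
    SemiconjBy g (hWord C E d x) (hWord C E d (f x)) := by
  rw [hf, h.hWord_mul, h.hWord_mul, h.hWord_iterate, h.hWord_iterate, ← mul_assoc]
  refine ((hC.pow_right _).mul_right (hE.pow_right _)).mul_right ?_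
  have : hWord C E d (0, 0, x.2.2) = (d ^ 6) ^ (x.2.2 : ℕ) := by simp [hWord]
  rw [this]
  exact SemiconjBy.pow_right hz _

theorem semiconjBy_V (x : HIdx) : SemiconjBy V (hWord C E d x) (hWord C E d (hConjV x)) := by
  refine h.semiconjBy_hWord (0, 1, 0) (2, 0, 0) ?_ ?_ h.z_V.symm ?_ x
  · simpa [hWord] using h.V_C
  · simpa [hWord] using h.V_E
  · decide +kernel

theorem semiconjBy_d (x : HIdx) : SemiconjBy d (hWord C E d x) (hWord C E d (hConjd x)) := by
  refine h.semiconjBy_hWord (1, 0, 0) (2, 1, 1) ?_ ?_ ((Commute.refl d).pow_right 6) ?_ x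
  · simpa [hWord] using h.d_C
  · have h1 : hWord C E d (2, 1, 1) = d ^ 6 * C ^ 2 * E := by
      simp only [hWord, Fin.val_one, Fin.val_two, pow_one]
      rw [mul_assoc, ← h.z_E.eq, ← mul_assoc, ← (h.z_C.pow_right 2).eq]
    rw [h1]
    exact h.d_E
  · decide +kernel

/-- The cube of `hConjd` is the identity, so its square is its inverse. -/
theorem semiconjBy_d_inv (x : HIdx) :
    SemiconjBy d⁻¹ (hWord C E d x) (hWord C E d (hConjd (hConjd x))) := by
  have h1 := h.semiconjBy_d (hConjd (hConjd x))
  have h2 : ∀ x, hConjd (hConjd (hConjd x)) = x := by decide +kernel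
  rw [h2] at h1
  exact h1.inv_symm_left

theorem semiconjBy_Y (x : HIdx) :
    SemiconjBy (d * V * d⁻¹) (hWord C E d x) (hWord C E d (hConjY x)) :=
  ((h.semiconjBy_d _).mul_left (h.semiconjBy_V _)).mul_left (h.semiconjBy_d_inv x)

theorem semiconjBy_nWord (n : NIdx) (x : HIdx) :
    SemiconjBy (nWord V d n) (hWord C E d x) (hWord C E d (hConj n x)) := by
  obtain ⟨⟨s, t⟩, j⟩ := n
  have h3 : hConjd^[3] = id := by
    funext x
    revert x
    decide +kernel
  have h1 : SemiconjBy (d ^ (j : ℕ)) (hWord C E d x) (hWord C E d (hConjd^[(j : ℕ) % 3] x)) := by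
    have h1 := semiconjBy_pow_iterate h.semiconjBy_d j x
    rwa [← Nat.mod_add_div (j : ℕ) 3, Function.iterate_add_apply, Function.iterate_mul, h3,
      Function.iterate_id, id, Nat.mod_add_div] at h1
  exact ((semiconjBy_pow_iterate h.semiconjBy_V s _).mul_left
    (semiconjBy_pow_iterate h.semiconjBy_Y t _)).mul_left h1

/-- Valid in every group satisfying the relations, and without knowing that `gMul` is associative:
the group law of `H` does that work. -/
theorem gWord_mul (x y : GIdx) : gWord C E V d (gMul x y) = gWord C E V d x * gWord C E V d y := by
  obtain ⟨a, b, n⟩ := x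
  obtain ⟨a', b', n'⟩ := y
  have h0 : ∀ a b : Fin 3, C ^ (a : ℕ) * E ^ (b : ℕ) = hWord C E d (a, b, 0) := fun a b => by
    simp [hWord]
  have h1 : ∀ k : Fin 3, nWord V d ((0, 0), ⟨6 * (k : ℕ) % 9, Nat.mod_lt _ (by norm_num)⟩) =
      (d ^ 6) ^ (k : ℕ) := fun k => by
    simp [nWord, qWord, ← pow_mul, ← pow_eq_pow_mod _ h.d_pow]
  simp only [gWord, gMul]
  rw [h.nWord_mul, h.nWord_mul, h1, h0 a b, h0 a' b',
    mul_assoc (hWord C E d (a, b, 0)) (nWord V d n), ← mul_assoc (nWord V d n) (hWord C E d _),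
    (h.semiconjBy_nWord n (a', b', 0)).eq, ← mul_assoc, ← mul_assoc, ← mul_assoc,
    ← mul_assoc (hWord C E d (a, b, 0)), ← h.hWord_mul]
  rfl

end HessRel
end Words

/-! ### The relations between the generating matrices -/

/-- The scalar `1 / (√3 i)`. -/
noncomputable def κ : ℂ := 1 / ((Real.sqrt 3 : ℂ) * Complex.I)

theorem κ_sq : κ ^ 2 * 3 = -1 := by
  have h : (Real.sqrt 3 : ℂ) ^ 2 = 3 := by
    rw [← Complex.ofReal_pow, Real.sq_sqrt (by norm_num)]
    norm_num
  rw [κ, div_pow, mul_pow, Complex.I_sq, h]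
  norm_num

/-- Since `√3 i = 1 + 2ω` and its square is `-3`, the scalar `κ` lies in `ℚ(ω)`. Matrix identities
in `V` thus reduce to polynomial identities in roots of unity. -/
theorem κ_eq : 3 * κ = -(1 + 2 * ω) := by
  have h : (Real.sqrt 3 : ℂ) ^ 2 = 3 := by
    rw [← Complex.ofReal_pow, Real.sq_sqrt (by norm_num)]
    norm_num
  have h0 : (Real.sqrt 3 : ℂ) ≠ 0 := by
    intro h0
    rw [h0] at h
    norm_num at h
  have h1 : 1 + 2 * ω = (Real.sqrt 3 : ℂ) * Complex.I := by linear_combination 2 * ω_eq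
  have h2 : (Real.sqrt 3 : ℂ) * Complex.I ≠ 0 := mul_ne_zero h0 Complex.I_ne_zero
  rw [h1, κ, mul_one_div, div_eq_iff h2]
  linear_combination Complex.I ^ 2 * h + 3 * Complex.I_sq

theorem matV_eq : matV = κ • !![1, 1, 1; 1, ω, ω ^ 2; 1, ω ^ 2, ω] := rfl

theorem matX_eq : matX = κ • !![1, 1, ω ^ 2; 1, ω, ω; ω, 1, ω] := rfl

/-- The conjugate `E² D E` of `D`, which commutes with `V²`. -/
noncomputable def sud : SU3 := suE ^ 2 * suD * suE

noncomputable def matd : Matrix (Fin 3) (Fin 3) ℂ := !![ε * ω, 0, 0; 0, ε, 0; 0, 0, ε]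

noncomputable def matY : Matrix (Fin 3) (Fin 3) ℂ :=
  κ • !![1, ω, ω; ω ^ 2, ω, ω ^ 2; ω ^ 2, ω ^ 2, ω]

theorem coe_sud : (sud : Matrix (Fin 3) (Fin 3) ℂ) = matd := by
  change matE ^ 2 * matD * matE = matd
  ext i j
  fin_cases i <;> fin_cases j <;>
    simp [matE, matD, matd, pow_two, Matrix.mul_apply, Fin.sum_univ_three]

theorem suE_pow : suE ^ 3 = 1 := by
  apply Subtype.ext
  change matE ^ 3 = 1
  ext i j
  fin_cases i <;> fin_cases j <;>
    simp [matE, pow_succ, Matrix.mul_apply, Fin.sum_univ_three]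

theorem suC_pow : suC ^ 3 = 1 := by
  apply Subtype.ext
  change matC ^ 3 = 1
  have h := ω_pow
  ext i j
  fin_cases i <;> fin_cases j <;>
    simp [matC, pow_succ, Matrix.mul_apply, Fin.sum_univ_three] <;> grind

theorem sud_eq : sud = suE⁻¹ * suD * suE := by
  have : suE⁻¹ = suE ^ 2 := by
    rw [inv_eq_iff_mul_eq_one, ← pow_succ', suE_pow]
  rw [this, sud]

theorem sud_pow_six : sud ^ 6 = suZ := by
  have h := conj_pow (a := suE⁻¹) (b := suD) (i := 6)
  rw [inv_inv] at h
  rw [sud_eq, h, ← suZ_eq, suZ_comm, inv_mul_cancel_right]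

theorem matV_sq : matV ^ 2 = !![-1, 0, 0; 0, 0, -1; 0, -1, 0] := by
  have h1 := ω_pow
  have h2 := ω_sum
  have h3 := κ_sq
  rw [matV_eq]
  ext i j
  fin_cases i <;> fin_cases j <;>
    simp [pow_two, Matrix.mul_apply, Fin.sum_univ_three] <;> grind

theorem matV_cube : matV ^ 3 = -(κ • !![1, 1, 1; 1, ω ^ 2, ω; 1, ω, ω ^ 2]) := by
  rw [pow_succ, matV_sq, matV_eq]
  ext i j
  fin_cases i <;> fin_cases j <;>
    simp [Matrix.mul_apply, Fin.sum_univ_three]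

theorem suV_pow : suV ^ 4 = 1 := by
  apply Subtype.ext
  change matV ^ 4 = 1
  rw [show 4 = 2 * 2 from rfl, pow_mul, matV_sq]
  ext i j
  fin_cases i <;> fin_cases j <;>
    simp [pow_two, Matrix.mul_apply, Fin.sum_univ_three]

theorem coe_suY : ((sud * suV * sud⁻¹ : SU3) : Matrix (Fin 3) (Fin 3) ℂ) = matY := by
  have h : matd * matV = matY * matd := by
    have h1 := ω_pow
    rw [matV_eq]
    ext i j
    fin_cases i <;> fin_cases j <;>
      simp [matd, matY, Matrix.mul_apply, Fin.sum_univ_three] <;> grind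
  have h2 : (sud * sud⁻¹).1 = 1 := by rw [mul_inv_cancel]; rfl
  change sud.1 * matV * (sud⁻¹).1 = matY
  change sud.1 * (sud⁻¹).1 = 1 at h2
  rw [coe_sud] at *
  rw [h, mul_assoc, h2, mul_one]

theorem tetraRel_su : TetraRel suV sud where
  V_pow := suV_pow
  d_pow := by
    apply Subtype.ext
    change sud.1 ^ 9 = 1
    have h1 := ω_pow
    have h2 := ε_pow
    have h3 : matd ^ 3 = !![ω ^ 2, 0, 0; 0, ω ^ 2, 0; 0, 0, ω ^ 2] := by
      ext i j
      fin_cases i <;> fin_cases j <;>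
        simp [matd, pow_succ, Matrix.mul_apply, Fin.sum_univ_three] <;> grind
    rw [coe_sud, show 9 = 3 * 3 from rfl, pow_mul, h3]
    ext i j
    fin_cases i <;> fin_cases j <;>
      simp [pow_succ, Matrix.mul_apply, Fin.sum_univ_three] <;> grind
  d_V_sq := by
    apply Subtype.ext
    change sud.1 * matV ^ 2 = matV ^ 2 * sud.1
    rw [coe_sud, matV_sq]
    ext i j
    fin_cases i <;> fin_cases j <;> simp [matd, Matrix.mul_apply, Fin.sum_univ_three]
  Y_V := by
    apply Subtype.ext
    change (sud * suV * sud⁻¹).1 * matV = matV ^ 3 * (sud * suV * sud⁻¹).1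
    have h1 := ω_pow
    have h2 := ω_sum
    rw [coe_suY, matV_cube, matV_eq]
    ext i j
    fin_cases i <;> fin_cases j <;>
      simp [matY, Matrix.mul_apply, Fin.sum_univ_three] <;> grind
  d_Y := by
    rw [mul_inv_eq_iff_eq_mul]
    apply Subtype.ext
    change sud.1 * (sud * suV * sud⁻¹).1 = matV ^ 3 * (sud * suV * sud⁻¹).1 * sud.1
    have h1 := ω_pow
    have h2 := ω_sum
    have h3 := κ_sq
    have h4 := κ_eq
    rw [coe_suY, matV_cube, coe_sud]
    ext i j
    fin_cases i <;> fin_cases j <;>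
      simp [matY, matd, Matrix.mul_apply, Fin.sum_univ_three] <;> grind

/-- These matrix identities are the input that turns multiplication in `Σ(216×3)` into
multiplication of exponents. -/
theorem hessRel_su : HessRel suC suE suV sud where
  toTetraRel := tetraRel_su
  C_pow := suC_pow
  E_pow := suE_pow
  z_C := by rw [sud_pow_six]; exact (suZ_comm _).symm
  z_E := by rw [sud_pow_six]; exact (suZ_comm _).symm
  z_V := by rw [sud_pow_six]; exact (suZ_comm _).symm
  E_C := by
    rw [sud_pow_six]
    apply Subtype.ext
    change matE * matC = matZ * matC * matE
    have h1 := ω_pow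
    ext i j
    fin_cases i <;> fin_cases j <;>
      simp [matE, matC, matZ, Matrix.mul_apply, Fin.sum_univ_three] <;> grind
  V_C := by
    apply Subtype.ext
    change matV * matC = matE * matV
    rw [matV_eq]
    have h1 := ω_pow
    ext i j
    fin_cases i <;> fin_cases j <;>
      simp [matE, matC, Matrix.mul_apply, Fin.sum_univ_three] <;> grind
  V_E := by
    apply Subtype.ext
    change matV * matE = matC ^ 2 * matV
    rw [matV_eq]
    have h1 := ω_pow
    ext i j
    fin_cases i <;> fin_cases j <;>
      simp [matE, matC, pow_two, Matrix.mul_apply, Fin.sum_univ_three] <;> grind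
  d_C := by
    apply Subtype.ext
    change sud.1 * matC = matC * sud.1
    rw [coe_sud]
    ext i j
    fin_cases i <;> fin_cases j <;>
      simp [matd, matC, Matrix.mul_apply, Fin.sum_univ_three, mul_comm]
  d_E := by
    rw [sud_pow_six]
    apply Subtype.ext
    change sud.1 * matE = matZ * matC ^ 2 * matE * sud.1
    rw [coe_sud]
    have h1 := ω_pow
    ext i j
    fin_cases i <;> fin_cases j <;>
      simp [matd, matE, matZ, matC, pow_two, Matrix.mul_apply, Fin.sum_univ_three] <;> grind

/-! ### Inverses of words and their action modulo the centre. -/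

def qInv (q : QIdx) : QIdx := qMul (qMul q q) q

/-- `(q d^j)⁻¹ = d^(-j) q⁻¹`, and `q⁻¹ = q³` in the quaternion group. -/
def nInv : NIdx → NIdx := fun (q, j) => nMul ((0, 0), -j) (qInv q, 0)

def gOne : GIdx := (0, 0, (0, 0), 0)

def gInv : GIdx → GIdx := fun (a, b, n) =>
  gMul (0, 0, nInv n) (gMul (0, -b, (0, 0), 0) (-a, 0, (0, 0), 0))

theorem gMul_gInv : ∀ x : GIdx, gMul x (gInv x) = gOne := by decide +kernel

/-- The action of a word on the images of `C` and `E` modulo the centre. -/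
def nAct (n : NIdx) : (Fin 3 × Fin 3) × (Fin 3 × Fin 3) :=
  (((hConj n (1, 0, 0)).1, (hConj n (1, 0, 0)).2.1),
    ((hConj n (0, 1, 0)).1, (hConj n (0, 1, 0)).2.1))

/-! ### Faithfulness of the parametrization -/

namespace HessRel

variable {H : Type*} [Group H] {C E V d : H} (h : HessRel C E V d) (hz : d ^ 6 ≠ 1)
include h hz

theorem z_pow_injective : Function.Injective fun k : Fin 3 => (d ^ 6) ^ (k : ℕ) := by
  have h1 : orderOf (d ^ 6) = 3 := orderOf_eq_prime h.z_pow hz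
  intro k l hkl
  have h2 := pow_inj_mod.1 hkl
  rw [h1, Nat.mod_eq_of_lt k.2, Nat.mod_eq_of_lt l.2] at h2
  exact Fin.ext h2

/-- Commuting a word with `E` produces `z^a`, and commuting it with `C` produces `z^b`. As `z` has
order exactly 3, this recovers `a` and `b`, and then `k` by cancellation. -/
theorem hWord_injective : Function.Injective (hWord C E d) := by
  have hE : ∀ x : HIdx, E * hWord C E d x = (d ^ 6) ^ (x.1 : ℕ) * (hWord C E d x * E) := by
    intro x
    have h1 : E = hWord C E d (0, 1, 0) := by simp [hWord]
    have h2 : (d ^ 6) ^ (x.1 : ℕ) = hWord C E d (0, 0, x.1) := by simp [hWord]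
    have h3 : hWord C E d (0, 1, 0) * hWord C E d x =
        hWord C E d (0, 0, x.1) * (hWord C E d x * hWord C E d (0, 1, 0)) := by
      rw [← h.hWord_mul, ← h.hWord_mul, ← h.hWord_mul]
      congr 1
      clear h1 h2
      revert x
      decide +kernel
    rwa [← h1, ← h2] at h3
  have hC : ∀ x : HIdx, hWord C E d x * C = (d ^ 6) ^ (x.2.1 : ℕ) * (C * hWord C E d x) := by
    intro x
    have h1 : C = hWord C E d (1, 0, 0) := by simp [hWord]
    have h2 : (d ^ 6) ^ (x.2.1 : ℕ) = hWord C E d (0, 0, x.2.1) := by simp [hWord]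
    have h3 : hWord C E d x * hWord C E d (1, 0, 0) =
        hWord C E d (0, 0, x.2.1) * (hWord C E d (1, 0, 0) * hWord C E d x) := by
      rw [← h.hWord_mul, ← h.hWord_mul, ← h.hWord_mul]
      congr 1
      clear h1 h2
      revert x
      decide +kernel
    rwa [← h1, ← h2] at h3
  intro x y hxy
  have ha : x.1 = y.1 := by
    have h1 := hE x
    rw [hxy, hE y] at h1
    exact (h.z_pow_injective hz (mul_right_cancel h1)).symm
  have hb : x.2.1 = y.2.1 := by
    have h1 := hC x
    rw [hxy, hC y] at h1
    exact (h.z_pow_injective hz (mul_right_cancel h1)).symm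
  have hk : x.2.2 = y.2.2 := by
    simp only [hWord, ha, hb] at hxy
    exact h.z_pow_injective hz (mul_left_cancel hxy)
  exact Prod.ext ha (Prod.ext hb hk)

/-- Equal words conjugate the Heisenberg group identically. Modulo its centre this determines the
quaternion part and `j` mod 3. Cancelling these leaves Heisenberg words whose central exponent still
records `j / 3`, and `hWord_injective` applies. -/
theorem gWord_injective : Function.Injective (gWord C E V d) := by
  -- Conjugation by `C^a E^b` multiplies `C^u E^v` by the central factor `z^(bu - av)`, the
  -- symplectic form.
  have hconj : ∀ x : GIdx, ∀ y : HIdx, SemiconjBy (gWord C E V d x) (hWord C E d y)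
      (hWord C E d ((hConj x.2.2 y).1, (hConj x.2.2 y).2.1, (hConj x.2.2 y).2.2 +
        (x.2.1 * (hConj x.2.2 y).1 - x.1 * (hConj x.2.2 y).2.1))) := by
    rintro ⟨a, b, n⟩ y
    refine SemiconjBy.mul_left ?_ (h.semiconjBy_nWord n y)
    have h1 : C ^ (a : ℕ) * E ^ (b : ℕ) = hWord C E d (a, b, 0) := by simp [hWord]
    rw [SemiconjBy, h1, ← h.hWord_mul, ← h.hWord_mul]
    congr 1
    generalize hConj n y = w
    obtain ⟨u, v, k⟩ := w
    simp only [hMul, Prod.mk.injEq]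
    refine ⟨add_comm _ _, add_comm _ _, ?_⟩
    clear h1
    revert a b u v k
    decide +kernel
  -- The inverse of 2 mod 3 is 2: `6 * 2 * (j / 3)` is congruent to `3 * (j / 3)` mod 9, so `d³ =
  -- z²`.
  have hd : ∀ j : Fin 9, d ^ (j : ℕ) = d ^ ((j : ℕ) % 3) * (d ^ 6) ^ (2 * ((j : ℕ) / 3)) := by
    intro j
    rw [← pow_mul, ← pow_add, pow_eq_pow_mod (_ + _) h.d_pow]
    congr 1
    revert j
    decide +kernel
  -- The 8·3 words act on the plane over the field with three elements by 24 different maps; the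
  -- images of the two basis vectors suffice to tell them apart.
  have hact : ∀ (q q' : QIdx) (j j' : Fin 9),
      nAct (q, j) = nAct (q', j') → q = q' ∧ (j : ℕ) % 3 = (j' : ℕ) % 3 := by
    have key : ∀ (q q' : QIdx) (j j' : Fin 3), nAct (q, ⟨j, by omega⟩) =
        nAct (q', ⟨j', by omega⟩) → q = q' ∧ j = j' := by decide +kernel
    have hm : ∀ (q : QIdx) (j : Fin 9), nAct (q, j) = nAct (q, ⟨(j : ℕ) % 3, by omega⟩) := by
      intro q j
      simp [nAct, hConj]
    intro q q' j j' h1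
    rw [hm q, hm q'] at h1
    obtain ⟨h5, h6⟩ := key q q' ⟨j % 3, by omega⟩ ⟨j' % 3, by omega⟩ h1
    exact ⟨h5, congrArg Fin.val h6⟩
  intro x y hxy
  have huniq : ∀ {g u v w : H}, SemiconjBy g u v → SemiconjBy g u w → v = w := by
    intro g u v w h1 h2
    exact mul_right_cancel (h1.eq.symm.trans h2.eq)
  have hr : ∀ w, _ := fun w => h.hWord_injective hz (huniq (hconj x w) (hxy ▸ hconj y w))
  obtain ⟨a, b, q, j⟩ := x
  obtain ⟨a', b', q', j'⟩ := y
  have hfst : ∀ w, ((hConj (q, j) w).1, (hConj (q, j) w).2.1) =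
      ((hConj (q', j') w).1, (hConj (q', j') w).2.1) := fun w => by
    have h1 := congrArg (fun v : HIdx => (v.1, v.2.1)) (hr w)
    exact h1
  obtain ⟨rfl, hj⟩ := hact q q' j j' (Prod.ext (hfst (1, 0, 0)) (hfst (0, 1, 0)))
  have hw : ∀ (a b : Fin 3) (j : Fin 9), gWord C E V d (a, b, q, j) =
      hWord C E d (a, b, ⟨2 * ((j : ℕ) / 3) % 3, Nat.mod_lt _ (by norm_num)⟩) *
        (qWord V d q * d ^ ((j : ℕ) % 3)) := by
    intro a b j
    have hc : ∀ m : ℕ, Commute ((d ^ 6) ^ m) (qWord V d q * d ^ ((j : ℕ) % 3)) := fun m => by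
      have hdd : Commute (d ^ 6) d := (Commute.refl d).pow_left 6
      refine Commute.pow_left ?_ m
      refine ((h.z_V.pow_right _).mul_right (Commute.pow_right ?_ _)).mul_right (hdd.pow_right _)
      exact (hdd.mul_right h.z_V).mul_right hdd.inv_right
    simp only [gWord, nWord, hWord]
    rw [hd j, ← pow_eq_pow_mod _ h.z_pow, mul_assoc _ ((d ^ 6) ^ _), (hc _).eq]
    simp only [mul_assoc]
  rw [hw, hw, hj] at hxy
  have h1 := h.hWord_injective hz (mul_right_cancel hxy)
  simp only [Prod.mk.injEq, Fin.mk.injEq] at h1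
  obtain ⟨rfl, rfl, h2⟩ := h1
  have h3 : j = j' := by ext; omega
  rw [h3]

end HessRel

/-! ### The parametrization of `Σ(216×3)` -/

theorem suZ_ne_one : suZ ≠ 1 := by
  intro h
  have h1 : matZ = 1 := congrArg Subtype.val h
  have h2 := congrFun (congrFun h1 0) 0
  simp [matZ] at h2
  exact ω_ne h2

/-- The element of `SU(3)` with the exponents `x`. -/
noncomputable def su (x : GIdx) : SU3 := gWord suC suE suV sud x

theorem su_mul (x y : GIdx) : su x * su y = su (gMul x y) := (hessRel_su.gWord_mul x y).symm

theorem su_one : su gOne = 1 := by simp [su, gOne, gWord, nWord, qWord]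

theorem su_injective : Function.Injective su :=
  hessRel_su.gWord_injective (by rw [sud_pow_six]; exact suZ_ne_one)

theorem su_inv (x : GIdx) : (su x)⁻¹ = su (gInv x) := by
  rw [inv_eq_iff_mul_eq_one, su_mul, gMul_gInv, su_one]

def iC : GIdx := (1, 0, (0, 0), 0)
def iE : GIdx := (0, 1, (0, 0), 0)
def iV : GIdx := (0, 0, (1, 0), 0)
def idd : GIdx := (0, 0, (0, 0), 1)
def iZ : GIdx := (0, 0, (0, 0), 6)
-- The definition `d = E² D E` solved for `D`, using `E³ = 1`.
def iD : GIdx := gMul iE (gMul idd (gMul iE iE))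

theorem suC_eq : suC = su iC := by simp [su, iC, gWord, nWord, qWord]
theorem suE_eq : suE = su iE := by simp [su, iE, gWord, nWord, qWord]
theorem suV_eq : suV = su iV := by simp [su, iV, gWord, nWord, qWord]
theorem sud_eq_su : sud = su idd := by simp [su, idd, gWord, nWord, qWord]
theorem suZ_eq_su : suZ = su iZ := by
  rw [← sud_pow_six]
  simp [su, iZ, gWord, nWord, qWord]
theorem suD_eq : suD = su iD := by
  rw [iD, ← su_mul, ← su_mul, ← su_mul, ← sud_eq_su, ← suE_eq, sud]
  have h := suE_pow
  calc suD = suE ^ 3 * suD * suE ^ 3 := by rw [h, one_mul, mul_one]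
    _ = _ := by simp only [pow_succ, pow_zero, one_mul, mul_assoc]

theorem suC_mem : suC ∈ Sigma216x3 := Subgroup.subset_closure (by simp)
theorem suE_mem : suE ∈ Sigma216x3 := Subgroup.subset_closure (by simp)
theorem suV_mem : suV ∈ Sigma216x3 := Subgroup.subset_closure (by simp)
theorem suD_mem : suD ∈ Sigma216x3 := Subgroup.subset_closure (by simp)

theorem sud_mem : sud ∈ Sigma216x3 :=
  mul_mem (mul_mem (pow_mem suE_mem 2) suD_mem) suE_mem

theorem su_mem (x : GIdx) : su x ∈ Sigma216x3 :=
  mul_mem (mul_mem (pow_mem suC_mem _) (pow_mem suE_mem _)) (mul_mem (mul_mem (pow_mem suV_mem _)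
    (pow_mem (mul_mem (mul_mem sud_mem suV_mem) (inv_mem sud_mem)) _)) (pow_mem sud_mem _))

/-- The subgroup of the elements with exponents satisfying `p`. -/
noncomputable def suSubgroup (p : GIdx → Prop) (h1 : p gOne)
    (hm : ∀ x y, p x → p y → p (gMul x y)) (hi : ∀ x, p x → p (gInv x)) : Subgroup SU3 where
  carrier := su '' {x | p x}
  one_mem' := ⟨gOne, h1, su_one⟩
  mul_mem' := by
    rintro _ _ ⟨x, hx, rfl⟩ ⟨y, hy, rfl⟩
    exact ⟨_, hm x y hx hy, (su_mul x y).symm⟩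
  inv_mem' := by
    rintro _ ⟨x, hx, rfl⟩
    exact ⟨_, hi x hx, (su_inv x).symm⟩

/-- The words form a subgroup, since products and inverses of words are words, and this subgroup
contains the four generators. -/
theorem exists_su {g : SU3} (hg : g ∈ Sigma216x3) : ∃ x, su x = g := by
  have : Sigma216x3 ≤ suSubgroup (fun _ => True) trivial (fun _ _ _ _ => trivial)
      (fun _ _ => trivial) := by
    rw [Sigma216x3, Subgroup.closure_le]
    rintro g (rfl | rfl | rfl | rfl)
    · exact ⟨_, trivial, suC_eq.symm⟩
    · exact ⟨_, trivial, suE_eq.symm⟩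
    · exact ⟨_, trivial, suV_eq.symm⟩
    · exact ⟨_, trivial, suD_eq.symm⟩
  obtain ⟨x, -, hx⟩ := this hg
  exact ⟨x, hx⟩

/-- The parametrization of `Σ(216×3)` by exponents. -/
noncomputable def gEquiv : GIdx ≃ Sigma216x3 :=
  Equiv.ofBijective (fun x => ⟨su x, su_mem x⟩)
    ⟨fun _ _ h => su_injective (congrArg Subtype.val h), fun ⟨_, hg⟩ => by
      obtain ⟨x, rfl⟩ := exists_su hg
      exact ⟨x, rfl⟩⟩

theorem gEquiv_mul (x y : GIdx) : gEquiv x * gEquiv y = gEquiv (gMul x y) :=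
  Subtype.ext (su_mul x y)

theorem gEquiv_one : gEquiv gOne = 1 := Subtype.ext su_one

theorem gC_eq : gC = gEquiv iC := Subtype.ext suC_eq
theorem gE_eq : gE = gEquiv iE := Subtype.ext suE_eq
theorem gV_eq : gV = gEquiv iV := Subtype.ext suV_eq
theorem gD_eq : gD = gEquiv iD := Subtype.ext suD_eq
theorem gZ_eq : gZ = gEquiv iZ := Subtype.ext suZ_eq_su

noncomputable instance : Fintype Sigma216x3 := Fintype.ofEquiv _ gEquiv

theorem card_Sigma216x3 : Nat.card Sigma216x3 = 648 := by
  rw [← Nat.card_congr gEquiv]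
  simp

/-! ### Homomorphisms that are trivial on `Δ(27)` -/

section TetraHom

variable {H : Type*} [Group H] {V d : H}

/-- The homomorphism with `C, E ↦ 1`, `V ↦ V` and `D ↦ d`. -/
noncomputable def tetraHom (h : TetraRel V d) (h3 : d ^ 3 = 1) : Sigma216x3 →* H where
  toFun g := nWord V d (gEquiv.symm g).2.2
  map_one' := by
    rw [← gEquiv_one, Equiv.symm_apply_apply]
    simp [gOne, nWord, qWord]
  map_mul' g g' := by
    obtain ⟨⟨a, b, n⟩, rfl⟩ := gEquiv.surjective g
    obtain ⟨⟨a', b', n'⟩, rfl⟩ := gEquiv.surjective g'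
    -- The central correction in `gMul` is a power of `d^6`, which is trivial when `d³ = 1`; only
    -- `nMul` remains.
    have h1 : ∀ k : Fin 3, nWord V d ((0, 0), ⟨6 * (k : ℕ) % 9, Nat.mod_lt _ (by norm_num)⟩) =
        1 := fun k => by
      simp [nWord, qWord, ← pow_eq_pow_mod _ h.d_pow]
      rw [show 6 * (k : ℕ) = 3 * (2 * k) by ring, pow_mul, h3, one_pow]
    rw [gEquiv_mul]
    simp only [Equiv.symm_apply_apply, gMul]
    rw [h.nWord_mul, h1, one_mul, h.nWord_mul]

variable (h : TetraRel V d) (h3 : d ^ 3 = 1)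

theorem tetraHom_gEquiv (x : GIdx) : tetraHom h h3 (gEquiv x) = nWord V d x.2.2 := by
  simp [tetraHom]

theorem tetraHom_C : tetraHom h h3 gC = 1 := by
  rw [gC_eq, tetraHom_gEquiv]; simp [iC, nWord, qWord]

theorem tetraHom_E : tetraHom h h3 gE = 1 := by
  rw [gE_eq, tetraHom_gEquiv]; simp [iE, nWord, qWord]

theorem tetraHom_V : tetraHom h h3 gV = V := by
  rw [gV_eq, tetraHom_gEquiv]; simp [iV, nWord, qWord]

theorem tetraHom_D : tetraHom h h3 gD = d := by
  -- Modulo `C` and `E` the matrix `D` is `d^4`, and `d^4 = d` because `d³ = 1`.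
  have h1 : iD.2.2 = ((0, 0), 4) := by decide +kernel
  have h2 : d ^ 4 = d ^ 3 * d := pow_succ d 3
  rw [gD_eq, tetraHom_gEquiv, h1]
  simp [nWord, qWord, h2, h3]

theorem gZ_eq_pow : gZ = gD ^ 6 := Subtype.ext suZ_eq

theorem tetraHom_Z : tetraHom h h3 gZ = 1 := by
  rw [gZ_eq_pow, map_pow, tetraHom_D, show 6 = 3 * 2 from rfl, pow_mul, h3, one_pow]

end TetraHom

theorem hom_ext {M : Type*} [Monoid M] {f f' : Sigma216x3 →* M} (hC : f gC = f' gC)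
    (hE : f gE = f' gE) (hV : f gV = f' gV) (hD : f gD = f' gD) : f = f' := by
  have key : ∀ g (hg : g ∈ Sigma216x3), f ⟨g, hg⟩ = f' ⟨g, hg⟩ := by
    intro g hg
    induction hg using Subgroup.closure_induction with
    | mem g hg =>
      rcases hg with rfl | rfl | rfl | rfl
      exacts [hC, hE, hV, hD]
    | one => exact (map_one f).trans (map_one f').symm
    | mul g g' hg hg' ih ih' =>
      exact (map_mul f ⟨g, hg⟩ ⟨g', hg'⟩).trans ((congrArg₂ (· * ·) ih ih').trans
        (map_mul f' ⟨g, hg⟩ ⟨g', hg'⟩).symm)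
    | inv g hg ih =>
      let x : Sigma216x3 := ⟨g, hg⟩
      have hx : f x = f' x := ih
      change f x⁻¹ = f' x⁻¹
      -- The target is only a monoid, so this is uniqueness of two-sided inverses.
      calc f x⁻¹ = f x⁻¹ * (f' x * f' x⁻¹) := by rw [← map_mul, mul_inv_cancel, map_one, mul_one]
        _ = f' x⁻¹ := by rw [← hx, ← mul_assoc, ← map_mul, inv_mul_cancel, map_one, one_mul]
  exact MonoidHom.ext fun x => key x.1 x.2

theorem tetraRel_deg : TetraRel (1 : Multiplicative (ZMod 3)) (Multiplicative.ofAdd 1) where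
  V_pow := by decide
  d_pow := by decide
  d_V_sq := by decide
  Y_V := by decide
  d_Y := by decide

/-- The homomorphism onto `ℤ₃` with kernel `Σ(72×3)`. -/
noncomputable def degHom : Sigma216x3 →* Multiplicative (ZMod 3) :=
  tetraHom tetraRel_deg (by decide)

/-! ### The ninth roots of unity -/

theorem ω_eq_ρ : ω = ρ ^ 3 := by
  rw [ω, ρ, ← Complex.exp_nat_mul]
  congr 1
  push_cast
  ring

theorem ε_eq_ρ : ε = ρ ^ 2 := by
  rw [ε, ρ, ← Complex.exp_nat_mul]
  congr 1
  push_cast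
  ring

theorem ρ_sum : 1 + ρ ^ 3 + ρ ^ 6 = 0 := by
  have h := ω_sum
  rw [ω_eq_ρ] at h
  linear_combination h

theorem ρ_pow : ρ ^ 9 = 1 := by linear_combination (ρ ^ 3 - 1) * ρ_sum

theorem ρc_eq : ρc = ρ ^ 8 := by
  have h : ρc * ρ = 1 := by
    rw [ρc, ρ, ← Complex.exp_conj, ← Complex.exp_add, Complex.exp_eq_one_iff]
    refine ⟨0, ?_⟩
    simp only [map_div₀, map_mul, Complex.conj_ofReal, Complex.conj_I, map_ofNat]
    push_cast
    ring
  linear_combination ρ ^ 8 * h - ρc * ρ_pow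

theorem star_ρ : (starRingEnd ℂ) ρ = ρ ^ 8 := ρc_eq

theorem σ_eq : σ = ρ * (1 + 2 * ρ ^ 3) := by rw [σ, ω_eq_ρ]

theorem σc_eq : σc = ρ ^ 8 * (1 + 2 * ρ ^ 6) := by
  rw [σc, σ, map_mul, map_add, map_mul, star_ρ, star_ω, ω_eq_ρ,
    map_one, map_ofNat]
  ring

/-! ### The characters of the defining representation -/

theorem char_defining_def (g : Sigma216x3) :
    character definingRep g = (g : SU3).1 0 0 + (g : SU3).1 1 1 + (g : SU3).1 2 2 :=
  Matrix.trace_fin_three _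

theorem char_defining_Z (g : Sigma216x3) :
    character definingRep (gZ * g) = ω * character definingRep g := by
  have h : ((gZ * g : Sigma216x3) : SU3).1 = matZ * (g : SU3).1 := rfl
  rw [char_defining_def, char_defining_def, h]
  simp [matZ, Matrix.mul_apply, Fin.sum_univ_three]
  ring

theorem char_defining_Z_sq (g : Sigma216x3) :
    character definingRep (gZ ^ 2 * g) = ω ^ 2 * character definingRep g := by
  rw [pow_two, mul_assoc, char_defining_Z, char_defining_Z]
  ring

theorem char_defining_one : character definingRep 1 = 3 := by
  simp [character]

theorem char_defining_C : character definingRep gC = 0 := by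
  have h : ((gC : Sigma216x3) : SU3).1 = matC := rfl
  rw [char_defining_def, h]
  simpa [matC] using ω_sum

theorem char_defining_V : character definingRep gV = 1 := by
  have h : ((gV : Sigma216x3) : SU3).1 = matV := rfl
  rw [char_defining_def, h, matV_eq]
  simp
  linear_combination -κ_sq + κ * κ_eq

theorem char_defining_V_sq : character definingRep (gV ^ 2) = -1 := by
  have h : ((gV ^ 2 : Sigma216x3) : SU3).1 = matV ^ 2 := rfl
  rw [char_defining_def, h, matV_sq]
  simp

theorem matD_sq : matD ^ 2 = !![ε ^ 2, 0, 0; 0, ε ^ 2, 0; 0, 0, ε ^ 2 * ω ^ 2] := by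
  ext i j
  fin_cases i <;> fin_cases j <;>
    simp [matD, pow_two, Matrix.mul_apply, Fin.sum_univ_three]
  ring

theorem char_defining_ED : character definingRep (gE * gD) = 0 := by
  have h : ((gE * gD : Sigma216x3) : SU3).1 = matE * matD := rfl
  rw [char_defining_def, h]
  simp [matE, matD, Matrix.mul_apply, Fin.sum_univ_three]

theorem char_defining_ED_sq : character definingRep (gE * gD ^ 2) = 0 := by
  have h : ((gE * gD ^ 2 : Sigma216x3) : SU3).1 = matE * matD ^ 2 := rfl
  rw [char_defining_def, h, matD_sq]
  simp [matE, Matrix.mul_apply, Fin.sum_univ_three]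

theorem char_defining_D : character definingRep gD = ω ^ 2 * σc := by
  have h : ((gD : Sigma216x3) : SU3).1 = matD := rfl
  rw [char_defining_def, h, σc_eq]
  simp [matD]
  rw [ω_eq_ρ, ε_eq_ρ]
  linear_combination (-ρ ^ 5 - 2 * ρ ^ 2 * (ρ ^ 9 + 1)) * ρ_pow

theorem char_defining_D_sq : character definingRep (gD ^ 2) = σ := by
  have h : ((gD ^ 2 : Sigma216x3) : SU3).1 = matD ^ 2 := rfl
  rw [char_defining_def, h, matD_sq, σ_eq]
  simp
  rw [ω_eq_ρ, ε_eq_ρ]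
  linear_combination ρ * ρ_pow

theorem char_defining_VVD : character definingRep (gV ^ 2 * gD) = -ω * ρc := by
  have h : ((gV ^ 2 * gD : Sigma216x3) : SU3).1 = matV ^ 2 * matD := rfl
  rw [char_defining_def, h, matV_sq, ρc_eq]
  simp [matD, Matrix.mul_apply, Fin.sum_univ_three]
  rw [ω_eq_ρ, ε_eq_ρ]
  linear_combination -ρ ^ 2 * ρ_pow

theorem char_defining_VDD : character definingRep (gV * gD ^ 2) = -ω ^ 2 * ρ := by
  have h : ((gV * gD ^ 2 : Sigma216x3) : SU3).1 = matV * matD ^ 2 := rfl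
  have h1 := κ_eq
  have h2 := ρ_sum
  rw [char_defining_def, h, matD_sq, matV_eq]
  simp [Matrix.mul_apply, Fin.sum_univ_three]
  rw [ω_eq_ρ] at *
  rw [ε_eq_ρ]
  grind

/-- Ten traces are computed from the matrices; the other classes are central multiples, which scale
the trace by `ω` or `ω²`. -/
theorem char_defining (j : Fin 24) : character definingRep (classRep j) = rowThree 0 j := by
  have hz := char_defining_Z
  have hz2 := char_defining_Z_sq
  have hw := ω_pow
  fin_cases j
  · exact char_defining_one
  · have := hz 1
    rw [char_defining_one, mul_one] at this
    exact this.trans (mul_comm _ _)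
  · have := hz2 1
    rw [char_defining_one, mul_one] at this
    exact this.trans (mul_comm _ _)
  · exact char_defining_C
  · exact char_defining_V_sq
  · exact (hz _).trans (by rw [char_defining_V_sq, mul_neg_one]; rfl)
  · exact (hz2 _).trans (by rw [char_defining_V_sq, mul_neg_one]; rfl)
  · exact char_defining_V
  · exact (hz _).trans (by rw [char_defining_V, mul_one]; rfl)
  · exact (hz2 _).trans (by rw [char_defining_V, mul_one]; rfl)
  · exact char_defining_ED
  · exact char_defining_ED_sq
  · exact char_defining_D
  · refine (hz _).trans ?_
    rw [char_defining_D]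
    change _ = σc
    linear_combination σc * hw
  · refine (hz2 _).trans ?_
    rw [char_defining_D]
    change _ = ω * σc
    linear_combination ω * σc * hw
  · exact char_defining_D_sq
  · exact (hz _).trans (by rw [char_defining_D_sq]; rfl)
  · exact (hz2 _).trans (by rw [char_defining_D_sq]; rfl)
  · exact char_defining_VVD
  · refine (hz _).trans ?_
    rw [char_defining_VVD]
    change _ = -ω ^ 2 * ρc
    ring
  · refine (hz2 _).trans ?_
    rw [char_defining_VVD]
    change _ = -ρc
    linear_combination -ρc * hw
  · exact char_defining_VDD
  · refine (hz _).trans ?_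
    rw [char_defining_VDD]
    change _ = -ρ
    linear_combination -ρ * hw
  · refine (hz2 _).trans ?_
    rw [char_defining_VDD]
    change _ = -ω * ρ
    linear_combination -ω * ρ * hw

/-! ### The conjugacy classes of `Σ(216×3)` -/

theorem degHom_C : degHom gC = 1 := tetraHom_C _ _
theorem degHom_E : degHom gE = 1 := tetraHom_E _ _
theorem degHom_V : degHom gV = 1 := tetraHom_V _ _
theorem degHom_D : degHom gD = Multiplicative.ofAdd 1 := tetraHom_D _ _
theorem degHom_Z : degHom gZ = 1 := tetraHom_Z _ _

def classDeg : Fin 24 → ZMod 3 :=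
  ![0, 0, 0, 0, 0, 0, 0, 0, 0, 0, 1, 2, 1, 1, 1, 2, 2, 2, 1, 1, 1, 2, 2, 2]

theorem degHom_classRep (k : Fin 24) : degHom (classRep k) = Multiplicative.ofAdd (classDeg k) := by
  fin_cases k <;>
    simp only [classRep, classDeg, map_mul, map_pow, degHom_C, degHom_E, degHom_V, degHom_D, degHom_Z,
      map_one, Fin.reduceFinMk, Matrix.cons_val, Fin.zero_eta, Fin.mk_one, Matrix.cons_val_zero,
      Matrix.cons_val_one, one_pow, one_mul, ← ofAdd_nsmul, ofAdd_zero] <;> rfl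

/-- The character of the defining representation on each class, as an element `a + b ω` of `ℤ[ω]`
times `1`, `ρ⁻¹` or `ρ`. -/
def classVal : Fin 24 → ℤ × ℤ :=
  ![(3, 0), (0, 3), (-3, -3), (0, 0), (-1, 0), (0, -1), (1, 1), (1, 0), (0, 1), (-1, -1), (0, 0),
    (0, 0), (-1, 1), (-1, -2), (2, 1), (1, 2), (-2, -1), (1, -1), (0, -1), (1, 1), (-1, 0), (1, 1),
    (-1, 0), (0, -1)]

theorem rowThree_zero (k : Fin 24) :
    rowThree 0 k = (![1, ρc, ρ] : Fin 3 → ℂ) (classDeg k) *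
      ((classVal k).1 + (classVal k).2 * ω) := by
  have h := ω_sum
  have h1 : σ = ρ * (1 + 2 * ω) := rfl
  have h2 : σc = ρc * (1 + 2 * ω ^ 2) := by
    rw [σc, σ, map_mul, map_add, map_mul, star_ω, map_one, map_ofNat, ρc]
  have h3 := ω_pow
  fin_cases k <;> simp [rowThree, classDeg, classVal, h1, h2] <;> grind

/-- Subtracting the conjugate equation isolates the coefficient of `ω - ω²`, which is nonzero. -/
theorem int_add_mul_ω_injective {x y : ℤ × ℤ} (h : (x.1 : ℂ) + x.2 * ω = y.1 + y.2 * ω) :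
    x = y := by
  have h1 := congrArg (starRingEnd ℂ) h
  simp only [map_add, map_mul, star_ω, map_intCast] at h1
  have h2 : ((x.2 : ℂ) - y.2) * (ω * (1 - ω)) = 0 := by linear_combination h - h1
  have h3 : ω ≠ 0 := fun h0 => by
    have := ω_pow
    rw [h0] at this
    norm_num at this
  have h4 : (x.2 : ℂ) - y.2 = 0 :=
    (mul_eq_zero.1 h2).resolve_right (mul_ne_zero h3 (sub_ne_zero.2 ω_ne.symm))
  have h5 : (x.1 : ℂ) - y.1 = 0 := by linear_combination h - ω * h4
  exact Prod.ext (by exact_mod_cast sub_eq_zero.1 h5) (by exact_mod_cast sub_eq_zero.1 h4)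

theorem ρ_ne_zero : ρ ≠ 0 := Complex.exp_ne_zero _

theorem ρc_ne_zero : ρc ≠ 0 := by
  rw [ρc_eq]
  exact pow_ne_zero _ ρ_ne_zero

theorem character_conj {G : Type*} [Group G] {n : ℕ} (M : MatRep G n) {g h : G} (hgh : IsConj g h) :
    character M g = character M h := by
  obtain ⟨c, hc⟩ := isConj_iff.1 hgh
  rw [← hc, character, character, map_mul, Matrix.trace_mul_comm, ← map_mul, ← mul_assoc,
    inv_mul_cancel, one_mul]

/-- The degree and the character of the defining representation separate the classes. -/
theorem eq_of_rowThree_eq {k l : Fin 24} (h1 : classDeg k = classDeg l)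
    (h2 : rowThree 0 k = rowThree 0 l) : k = l := by
  rw [rowThree_zero, rowThree_zero, h1] at h2
  have h0 : ∀ i, (![1, ρc, ρ] : Fin 3 → ℂ) i ≠ 0 := by
    intro i
    fin_cases i
    exacts [one_ne_zero, ρc_ne_zero, ρ_ne_zero]
  have h3 := int_add_mul_ω_injective (mul_left_cancel₀ (h0 _) h2)
  have key : ∀ k l : Fin 24, classDeg k = classDeg l → classVal k = classVal l → k = l := by
    decide +kernel
  exact key k l h1 h3

/-- Both `degHom` and the defining character are class functions, and together they take different
values on the 24 representatives. -/
theorem classRep_injective :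
    Function.Injective fun k : Fin 24 => ConjClasses.mk (classRep k) := by
  intro k l hkl
  have hc : IsConj (classRep k) (classRep l) := ConjClasses.mk_eq_mk_iff_isConj.1 hkl
  have h1 : classDeg k = classDeg l := by
    have := isConj_iff_eq.1 (degHom.map_isConj hc)
    rw [degHom_classRep, degHom_classRep] at this
    exact this
  have h2 := character_conj definingRep hc
  rw [char_defining, char_defining] at h2
  exact eq_of_rowThree_eq h1 h2

/-- The exponents of the elements `classRep`. -/
def classIdx : Fin 24 → GIdx :=
  ![gOne, iZ, gMul iZ iZ, iC, gMul iV iV, gMul iZ (gMul iV iV), gMul (gMul iZ iZ) (gMul iV iV), iV,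
    gMul iZ iV, gMul (gMul iZ iZ) iV, gMul iE iD, gMul iE (gMul iD iD), iD, gMul iZ iD,
    gMul (gMul iZ iZ) iD, gMul iD iD, gMul iZ (gMul iD iD), gMul (gMul iZ iZ) (gMul iD iD),
    gMul (gMul iV iV) iD, gMul iZ (gMul (gMul iV iV) iD),
    gMul (gMul iZ iZ) (gMul (gMul iV iV) iD), gMul iV (gMul iD iD),
    gMul iZ (gMul iV (gMul iD iD)), gMul (gMul iZ iZ) (gMul iV (gMul iD iD))]

theorem classRep_eq (k : Fin 24) : classRep k = gEquiv (classIdx k) := by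
  simp only [classRep, pow_two, gC_eq, gE_eq, gV_eq, gD_eq, gZ_eq, gEquiv_mul, ← gEquiv_one]
  fin_cases k <;> rfl

def gPow (x : GIdx) (n : ℕ) : GIdx := (gMul x)^[n] gOne

theorem gEquiv_pow (x : GIdx) (n : ℕ) : gEquiv x ^ n = gEquiv (gPow x n) := by
  induction n with
  | zero => exact gEquiv_one.symm
  | succ n ih => rw [pow_succ', ih, gEquiv_mul, gPow, gPow, Function.iterate_succ_apply']

instance : DecidableEq GIdx := inferInstance

theorem orderOf_classRep (k : Fin 24) : orderOf (classRep k) = classOrder k := by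
  have h0 : ∀ k : Fin 24, 0 < classOrder k := by decide +kernel
  have h1 : ∀ k : Fin 24, gPow (classIdx k) (classOrder k) = gOne := by decide +kernel
  have h2 : ∀ k : Fin 24, ∀ m < classOrder k, 0 < m → gPow (classIdx k) m ≠ gOne := by
    decide +kernel
  rw [orderOf_eq_iff (h0 k), classRep_eq, gEquiv_pow, h1]
  refine ⟨gEquiv_one, fun m hm hm0 h => h2 k m hm hm0 ?_⟩
  rw [gEquiv_pow, ← gEquiv_one] at h
  exact gEquiv.injective h

/-- Orbit-stabilizer for conjugation, with the centralizer written as an explicit subtype so that it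
can be counted on exponents. -/
theorem card_commute_mul_card_carrier {G : Type*} [Group G] (g : G) :
    Nat.card {x : G // x * g = g * x} * Nat.card (ConjClasses.mk g).carrier = Nat.card G := by
  have h1 := (MulAction.stabilizer (ConjAct G) g).card_mul_index
  rw [MulAction.index_stabilizer, ConjAct.orbit_eq_carrier_conjClasses,
    ← Subgroup.nat_card_centralizer_nat_card_stabilizer] at h1
  refine Eq.trans (congrArg₂ _ (Nat.card_congr (Equiv.subtypeEquivRight fun x => ?_)) rfl) h1
  rw [Subgroup.mem_centralizer_singleton_iff]

theorem gZ_comm (g : Sigma216x3) : Commute g gZ := Subtype.ext (suZ_comm g)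

/-- The representative from which a class representative differs by a central element. -/
def classBase : Fin 24 → Fin 24 :=
  ![0, 0, 0, 3, 4, 4, 4, 7, 7, 7, 10, 11, 12, 12, 12, 15, 15, 15, 18, 18, 18, 21, 21, 21]

theorem classRep_eq_mul (k : Fin 24) : ∃ i : ℕ, classRep k = gZ ^ i * classRep (classBase k) := by
  refine ⟨(![0, 1, 2, 0, 0, 1, 2, 0, 1, 2, 0, 0, 0, 1, 2, 0, 1, 2, 0, 1, 2, 0, 1, 2] : Fin 24 → ℕ) k,
    ?_⟩
  fin_cases k <;> simp [classRep, classBase]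

theorem card_commute_classRep (k : Fin 24) :
    Nat.card {x // x * classRep k = classRep k * x} * classSize k = 648 := by
  have h1 : ∀ k, Nat.card {x // x * classRep k = classRep k * x} =
      Fintype.card {x // gMul x (classIdx k) = gMul (classIdx k) x} := by
    intro k
    rw [← Nat.card_eq_fintype_card]
    refine (Nat.card_congr (gEquiv.subtypeEquiv fun x => ?_)).symm
    rw [classRep_eq, gEquiv_mul, gEquiv_mul, gEquiv.injective.eq_iff]
  obtain ⟨i, hi⟩ := classRep_eq_mul k
  -- A central factor does not change the centralizer, so only ten centralizers have to be counted.
  have h2 : ∀ x, x * classRep k = classRep k * x ↔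
      x * classRep (classBase k) = classRep (classBase k) * x := by
    intro x
    have hc := ((gZ_comm x).pow_right i).eq
    rw [hi, ← mul_assoc, hc, mul_assoc, mul_assoc, mul_right_inj]
  rw [Nat.card_congr (Equiv.subtypeEquivRight h2), h1]
  have h3 : ∀ k, classSize k = classSize (classBase k) := by decide +kernel
  have h4 : ∀ l ∈ [(0 : Fin 24), 3, 4, 7, 10, 11, 12, 15, 18, 21],
      Fintype.card {x // gMul x (classIdx l) = gMul (classIdx l) x} * classSize l = 648 := by
    decide +kernel
  have h5 : ∀ k, classBase k ∈ [(0 : Fin 24), 3, 4, 7, 10, 11, 12, 15, 18, 21] := by decide +kernel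
  rw [h3, h4 _ (h5 k)]

theorem card_carrier_classRep (k : Fin 24) :
    Nat.card (ConjClasses.mk (classRep k)).carrier = classSize k := by
  have h1 := card_commute_mul_card_carrier (classRep k)
  have h2 := card_commute_classRep k
  rw [card_Sigma216x3, ← h2] at h1
  refine Nat.eq_of_mul_eq_mul_left (Nat.pos_of_ne_zero fun h0 => ?_) h1
  rw [h0] at h2
  omega

theorem sum_classSize : ∑ k, classSize k = 648 := by decide +kernel

/-- The listed classes are disjoint and their sizes add up to 648, so they exhaust the group. -/
theorem sigma_carrier_bijective : Function.Bijective
    (fun x => x.2 : (Σ k : Fin 24, (ConjClasses.mk (classRep k)).carrier) → Sigma216x3) := by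
  rw [Nat.bijective_iff_injective_and_card]
  constructor
  · rintro ⟨k, x, hx⟩ ⟨l, y, hy⟩ hxy
    have h1 : x = y := hxy
    subst h1
    have h2 : k = l := classRep_injective
      ((ConjClasses.mem_carrier_iff_mk_eq.1 hx).symm.trans (ConjClasses.mem_carrier_iff_mk_eq.1 hy))
    subst h2
    rfl
  · rw [Nat.card_sigma, card_Sigma216x3, ← sum_classSize]
    exact Finset.sum_congr rfl fun k _ => card_carrier_classRep k

theorem classRep_surjective :
    Function.Surjective fun k : Fin 24 => ConjClasses.mk (classRep k) := by
  intro c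
  obtain ⟨g, rfl⟩ := ConjClasses.exists_rep c
  obtain ⟨⟨k, x, hx⟩, rfl⟩ := sigma_carrier_bijective.2 g
  exact ⟨k, (ConjClasses.mem_carrier_iff_mk_eq.1 hx).symm⟩

theorem exists_isConj_classRep (g : Sigma216x3) : ∃ k, IsConj (classRep k) g := by
  obtain ⟨k, hk⟩ := classRep_surjective (ConjClasses.mk g)
  exact ⟨k, ConjClasses.mk_eq_mk_iff_isConj.1 hk⟩

theorem sum_eq_sum_classSize (f : Sigma216x3 → ℂ) (hf : ∀ g h, IsConj g h → f g = f h) :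
    ∑ g, f g = ∑ k, (classSize k : ℂ) * f (classRep k) := by
  classical
  rw [← sigma_carrier_bijective.sum_comp, Fintype.sum_sigma]
  refine Finset.sum_congr rfl fun k _ => ?_
  rw [← card_carrier_classRep, Nat.card_eq_fintype_card, ← Finset.card_univ, ← nsmul_eq_mul,
    ← Finset.sum_const]
  refine Finset.sum_congr rfl fun x _ => hf _ _ ?_
  exact ConjClasses.mk_eq_mk_iff_isConj.1 (ConjClasses.mem_carrier_iff_mk_eq.1 x.2)

/-! ### The normal subgroups and their quotients -/

theorem suX_eq : suX = suD * suV * suD⁻¹ := by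
  rw [eq_mul_inv_iff_mul_eq]
  apply Subtype.ext
  change matX * matD = matD * matV
  have h := ω_pow
  rw [matX_eq, matV_eq]
  ext i j
  fin_cases i <;> fin_cases j <;>
    simp [matD, Matrix.mul_apply, Fin.sum_univ_three] <;> grind

theorem suB_eq : suB = suE * suV ^ 2 := by
  apply Subtype.ext
  change matB = matE * matV ^ 2
  rw [matV_sq]
  ext i j
  fin_cases i <;> fin_cases j <;> simp [matB, matE, Matrix.mul_apply, Fin.sum_univ_three]

theorem suX_mem : suX ∈ Sigma216x3 := by
  rw [suX_eq]
  exact mul_mem (mul_mem suD_mem suV_mem) (inv_mem suD_mem)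

theorem suB_mem : suB ∈ Sigma216x3 := by
  rw [suB_eq]
  exact mul_mem suE_mem (pow_mem suV_mem 2)

theorem Delta27_le : Delta27 ≤ Sigma216x3 := by
  rw [Delta27, Subgroup.closure_le]
  rintro g (rfl | rfl)
  exacts [suC_mem, suE_mem]

theorem Delta54_le : Delta54 ≤ Sigma216x3 := by
  rw [Delta54, Subgroup.closure_le]
  rintro g (rfl | rfl | rfl)
  exacts [suC_mem, suE_mem, suB_mem]

theorem Sigma72x3_le : Sigma72x3 ≤ Sigma216x3 := by
  rw [Sigma72x3, Subgroup.closure_le]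
  rintro g (rfl | rfl | rfl | rfl)
  exacts [suC_mem, suE_mem, suV_mem, suX_mem]

/-- `ω𝟙` is the commutator of `E` and `C`. -/
theorem suZ_mem_of_mem {S : Subgroup SU3} (hC : suC ∈ S) (hE : suE ∈ S) : suZ ∈ S := by
  have h := hessRel_su.E_C
  rw [sud_pow_six] at h
  have h1 : suZ = suE * suC * suE⁻¹ * suC⁻¹ := by rw [h]; group
  rw [h1]
  exact mul_mem (mul_mem (mul_mem hE hC) (inv_mem hE)) (inv_mem hC)

theorem sud_pow_mem {S : Subgroup SU3} (hC : suC ∈ S) (hE : suE ∈ S) {j : ℕ} (hj : j % 3 = 0) :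
    sud ^ j ∈ S := by
  obtain ⟨i, rfl⟩ := Nat.dvd_of_mod_eq_zero hj
  -- `suZ ^ 2 = sud ^ 12`, and `sud` has ninth power 1.
  have h1 : sud ^ 3 = suZ ^ 2 := by
    rw [← sud_pow_six, ← pow_mul, pow_eq_pow_mod (6 * 2) tetraRel_su.d_pow]
  rw [pow_mul, h1]
  exact pow_mem (pow_mem (suZ_mem_of_mem hC hE) 2) i

theorem exists_quotient_equiv {H : Type*} [Group H] {S : Subgroup SU3} (f : Sigma216x3 →* H)
    (hf : Function.Surjective f) (hS : S.subgroupOf Sigma216x3 = f.ker) :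
    ∃ (_ : (S.subgroupOf Sigma216x3).Normal) (e : Sigma216x3 ⧸ S.subgroupOf Sigma216x3 ≃* H),
      ∀ g : Sigma216x3, e (QuotientGroup.mk g) = f g := by
  have hn : (S.subgroupOf Sigma216x3).Normal := by rw [hS]; infer_instance
  exact ⟨hn, (QuotientGroup.quotientMulEquivOfEq hS).trans
    (QuotientGroup.quotientKerEquivOfSurjective f hf), fun g => rfl⟩

/-- One inclusion is checked on generators of `S`; the other follows from the normal form of the
elements of the kernel. -/
theorem subgroupOf_eq_ker {H : Type*} [Group H] {S : Subgroup SU3} (f : Sigma216x3 →* H)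
    (hle : S ≤ f.ker.map Sigma216x3.subtype)
    (hge : ∀ x, f (gEquiv x) = 1 → su x ∈ S) : S.subgroupOf Sigma216x3 = f.ker := by
  ext g
  rw [Subgroup.mem_subgroupOf]
  constructor
  · intro hg
    obtain ⟨g', hg', h⟩ := hle hg
    rwa [← Subtype.ext h]
  · intro hg
    obtain ⟨x, rfl⟩ := gEquiv.surjective g
    exact hge x hg

/-! #### The quotient by `Σ(72×3)` -/

theorem degHom_gEquiv (x : GIdx) :
    degHom (gEquiv x) = Multiplicative.ofAdd (x.2.2.2 : ZMod 3) := by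
  rw [degHom, tetraHom_gEquiv]
  have key : ∀ n : NIdx, nWord (1 : Multiplicative (ZMod 3)) (Multiplicative.ofAdd 1) n =
      Multiplicative.ofAdd (n.2 : ZMod 3) := by decide +kernel
  exact key _

/-- `Y` is conjugate to `X = D V D⁻¹` by a power of `C`, which explains why `X` belongs among the
generators of `Σ(72×3)`. -/
theorem suY_mem_Sigma72x3 : sud * suV * sud⁻¹ ∈ Sigma72x3 := by
  have h : sud * suV * sud⁻¹ = suC ^ 2 * suX * (suC ^ 2)⁻¹ := by
    rw [suX_eq, sud_eq_su, suV_eq, suC_eq, suD_eq]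
    simp only [pow_two, su_mul, su_inv]
    congr 1
  have hC : suC ∈ Sigma72x3 := Subgroup.subset_closure (by simp)
  have hX : suX ∈ Sigma72x3 := Subgroup.subset_closure (by simp)
  rw [h]
  exact mul_mem (mul_mem (pow_mem hC 2) hX) (inv_mem (pow_mem hC 2))

theorem su_mem_Sigma72x3 {x : GIdx} (h : (x.2.2.2 : ℕ) % 3 = 0) : su x ∈ Sigma72x3 := by
  have hC : suC ∈ Sigma72x3 := Subgroup.subset_closure (by simp)
  have hE : suE ∈ Sigma72x3 := Subgroup.subset_closure (by simp)
  have hV : suV ∈ Sigma72x3 := Subgroup.subset_closure (by simp)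
  exact mul_mem (mul_mem (pow_mem hC _) (pow_mem hE _)) (mul_mem (mul_mem (pow_mem hV _)
    (pow_mem suY_mem_Sigma72x3 _)) (sud_pow_mem hC hE h))

theorem Sigma72x3_subgroupOf : Sigma72x3.subgroupOf Sigma216x3 = degHom.ker := by
  refine subgroupOf_eq_ker _ ?_ fun x hx => su_mem_Sigma72x3 ?_
  · rw [Sigma72x3, Subgroup.closure_le]
    rintro g (rfl | rfl | rfl | rfl)
    · exact ⟨gC, degHom_C, rfl⟩
    · exact ⟨gE, degHom_E, rfl⟩
    · exact ⟨gV, degHom_V, rfl⟩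
    · refine ⟨gD * gV * gD⁻¹, ?_, suX_eq.symm⟩
      change degHom _ = 1
      rw [map_mul, map_mul, map_inv, degHom_V, mul_one, mul_inv_cancel]
  · rw [degHom_gEquiv] at hx
    have h1 : ((x.2.2.2 : ℕ) : ZMod 3) = 0 := hx
    exact Nat.mod_eq_zero_of_dvd ((ZMod.natCast_eq_zero_iff _ _).1 h1)

theorem degHom_surjective : Function.Surjective degHom := by
  intro y
  refine ⟨gD ^ (Multiplicative.toAdd y).val, ?_⟩
  rw [map_pow, degHom_D, ← ofAdd_nsmul, nsmul_one, ZMod.natCast_zmod_val]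
  rfl

/-! #### The quotient by `Δ(54)` -/

/-- The images of `V` and `D` in `A₄`. -/
def altV : alternatingGroup (Fin 4) :=
  ⟨Equiv.swap 0 1 * Equiv.swap 2 3, by rw [Equiv.Perm.mem_alternatingGroup]; decide⟩

def altD : alternatingGroup (Fin 4) :=
  ⟨Equiv.swap 0 1 * Equiv.swap 1 2, by rw [Equiv.Perm.mem_alternatingGroup]; decide⟩

theorem tetraRel_alt : TetraRel altV altD where
  V_pow := by decide +kernel
  d_pow := by decide +kernel
  d_V_sq := by decide +kernel
  Y_V := by decide +kernel
  d_Y := by decide +kernel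

noncomputable def altHom : Sigma216x3 →* alternatingGroup (Fin 4) :=
  tetraHom tetraRel_alt (by decide +kernel)

theorem altHom_V : altHom gV = altV := tetraHom_V _ _

theorem altHom_gEquiv (x : GIdx) : altHom (gEquiv x) = nWord altV altD x.2.2 := tetraHom_gEquiv _ _ x

theorem altHom_surjective : Function.Surjective altHom := by
  have key : ∀ y, ∃ n, nWord altV altD n = y := by decide +kernel
  intro y
  obtain ⟨n, hn⟩ := key y
  exact ⟨gEquiv (0, 0, n), by rw [altHom_gEquiv, hn]⟩

/-- Words with `t = 0`, `s` even and `3 ∣ j` are products of `C`, `E`, `V²` and scalars, which all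
lie in `Δ(54)` because `B = E V²`. -/
theorem altHom_eq_one (x : GIdx) (h : altHom (gEquiv x) = 1) :
    x.2.2.1.2 = 0 ∧ (x.2.2.1.1 : ℕ) % 2 = 0 ∧ (x.2.2.2 : ℕ) % 3 = 0 := by
  rw [altHom_gEquiv] at h
  have key : ∀ n : NIdx, nWord altV altD n = 1 →
      n.1.2 = 0 ∧ (n.1.1 : ℕ) % 2 = 0 ∧ (n.2 : ℕ) % 3 = 0 := by decide +kernel
  exact key _ h

theorem Delta54_subgroupOf : Delta54.subgroupOf Sigma216x3 = altHom.ker := by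
  have hC : suC ∈ Delta54 := Subgroup.subset_closure (by simp)
  have hE : suE ∈ Delta54 := Subgroup.subset_closure (by simp)
  have hB : suB ∈ Delta54 := Subgroup.subset_closure (by simp)
  refine subgroupOf_eq_ker _ ?_ fun x hx => ?_
  · rw [Delta54, Subgroup.closure_le]
    rintro g (rfl | rfl | rfl)
    · exact ⟨gC, tetraHom_C _ _, rfl⟩
    · exact ⟨gE, tetraHom_E _ _, rfl⟩
    · refine ⟨gE * gV ^ 2, ?_, suB_eq.symm⟩
      change altHom _ = 1
      rw [map_mul, map_pow, altHom_V, show altHom gE = 1 from tetraHom_E _ _]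
      decide +kernel
  · obtain ⟨h1, h2, h3⟩ := altHom_eq_one x hx
    have hV2 : suV ^ 2 ∈ Delta54 := by
      have : suV ^ 2 = suE⁻¹ * suB := by rw [suB_eq, inv_mul_cancel_left]
      rw [this]
      exact mul_mem (inv_mem hE) hB
    obtain ⟨i, hi⟩ := Nat.dvd_of_mod_eq_zero h2
    refine mul_mem (mul_mem (pow_mem hC _) (pow_mem hE _)) (mul_mem (mul_mem ?_ ?_)
      (sud_pow_mem hC hE h3))
    · rw [hi, pow_mul]
      exact pow_mem hV2 i
    · rw [h1]
      exact one_mem _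

/-! #### The quotient by `Δ(27)` -/

/-- With `b = a⁻¹ t`, the element `a² = b³` commutes with `a` and `b`, hence with `t`. Expanding `b³
= a²` and cancelling the central `a²` gives `t a t = a t⁻¹ a`; its inverse gives `t⁻¹ a t⁻¹ = a⁻¹ t
a`. The two quaternion relations then follow by using `t³ = 1`. -/
theorem tetraRel_of_relations {H : Type*} [Group H] {a t : H} (ha : a ^ 4 = 1)
    (hb : (a⁻¹ * t) ^ 3 = a ^ 2) (ht : t ^ 3 = 1) : TetraRel a t := by
  have ha4 : a * a * a * a = 1 := by simpa [pow_succ] using ha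
  have ht3 : t * t * t = 1 := by simpa [pow_succ] using ht
  -- `a ^ 2` is central
  have hc : t * a ^ 2 = a ^ 2 * t := by
    have h1 : Commute (a ^ 2) (a⁻¹ * t) := by rw [← hb]; exact (Commute.refl _).pow_left 3
    have h2 : Commute (a ^ 2) a := (Commute.refl a).pow_left 2
    have h3 := h2.mul_right h1
    rw [mul_inv_cancel_left] at h3
    exact h3.eq.symm
  have hti : t⁻¹ = t ^ 2 := by rw [inv_eq_iff_mul_eq_one, ← pow_succ', ht]
  have h2 : a ^ 2 * a ^ 2 = 1 := by rw [← pow_add, ha]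
  have hai : a⁻¹ = a ^ 2 * a := by rw [inv_eq_iff_mul_eq_one, ← pow_succ, ← pow_succ', ha]
  have hcti : t⁻¹ * a ^ 2 = a ^ 2 * t⁻¹ := by
    rw [inv_mul_eq_iff_eq_mul, ← mul_assoc, hc, mul_inv_cancel_right]
  have hca : a * a ^ 2 = a ^ 2 * a := ((Commute.refl a).pow_right 2).eq
  -- `t⁻¹ a t⁻¹ = a⁻¹ t a`
  have h4 : t * a * t = a * t⁻¹ * a := by
    have h5 : a⁻¹ * t * (a⁻¹ * t) * (a⁻¹ * t) = a ^ 2 := by rw [← hb]; simp [pow_succ]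
    have h6 : t * a⁻¹ * t = a * a ^ 2 * t⁻¹ * a := by
      calc t * a⁻¹ * t = a * (a⁻¹ * t * (a⁻¹ * t) * (a⁻¹ * t)) * t⁻¹ * a := by group
        _ = _ := by rw [h5]
    rw [hai, ← mul_assoc, hc, hca] at h6
    simp only [mul_assoc] at h6 ⊢
    exact mul_left_cancel h6
  have h7 : t⁻¹ * a * t⁻¹ = a⁻¹ * t * a := by
    have h8 : t⁻¹ * a⁻¹ * t⁻¹ = a⁻¹ * t * a⁻¹ := by
      have := congrArg (·⁻¹) h4
      simpa [mul_assoc] using this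
    rw [hai, ← mul_assoc, hcti] at h8
    have h9 : a ^ 2 * (t⁻¹ * a * t⁻¹) = a ^ 2 * (a⁻¹ * t * a) := by
      rw [hai]
      simp only [mul_assoc] at h8 ⊢
      rw [h8, ← mul_assoc t, hc]
      have h10 := hca
      simp only [← mul_assoc] at h10 ⊢
      rw [mul_assoc (a ^ 2) a (a ^ 2), h10, ← mul_assoc]
    exact mul_left_cancel h9
  refine ⟨ha, ?_, hc, ?_, ?_⟩
  · rw [show 9 = 3 * 3 from rfl, pow_mul, ht, one_pow]
  · have h11 : a ^ 3 = a⁻¹ := by rw [hai, ← pow_succ]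
    have htt : t⁻¹ * t⁻¹ = t := by rw [hti, ← pow_add, pow_succ, ht, one_mul]
    have htt' : t * t = t⁻¹ := by rw [hti, pow_two]
    rw [h11]
    refine mul_left_cancel (a := t) ?_
    calc t * (t * a * t⁻¹ * a) = (t * t) * a * t⁻¹ * a := by simp only [mul_assoc]
      _ = a⁻¹ * (t * a ^ 2) := by rw [htt', h7]; simp only [mul_assoc, pow_two]
      _ = t * (t⁻¹ * a * (t⁻¹ * t⁻¹)) := by rw [hc, htt]; group
      _ = t * (t⁻¹ * a * t⁻¹ * t⁻¹) := by simp only [mul_assoc]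
      _ = _ := by rw [h7]; simp only [mul_assoc]
  · have h11 : a ^ 3 = a⁻¹ := by rw [hai, ← pow_succ]
    have htt : t⁻¹ * t⁻¹ = t := by rw [hti, ← pow_add, pow_succ, ht, one_mul]
    have htt' : t * t = t⁻¹ := by rw [hti, pow_two]
    rw [h11]
    calc t * (t * a * t⁻¹) * t⁻¹ = (t * t) * a * t⁻¹ * t⁻¹ := by simp only [mul_assoc]
      _ = _ := by rw [htt', h7]; simp only [mul_assoc]

theorem tS_pow : tS ^ 4 = 1 :=
  PresentedGroup.one_of_mem (x := FreeGroup.of 0 ^ 4) (by simp)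

theorem tT_pow : tT ^ 3 = 1 :=
  PresentedGroup.one_of_mem (x := (FreeGroup.of 0 * FreeGroup.of 1) ^ 3) (by simp)

theorem tS_inv_mul_tT_pow : (tS⁻¹ * tT) ^ 3 = tS ^ 2 := by
  have h1 : tS ^ 2 * (PresentedGroup.of 1 ^ 3)⁻¹ = 1 :=
    PresentedGroup.one_of_mem (x := FreeGroup.of 0 ^ 2 * (FreeGroup.of 1 ^ 3)⁻¹) (by simp)
  have h2 : tS⁻¹ * tT = PresentedGroup.of 1 := inv_mul_cancel_left _ _
  rw [h2]
  exact (mul_inv_eq_one.1 h1).symm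

theorem tetraRel_tPrime : TetraRel tS tT :=
  tetraRel_of_relations tS_pow tS_inv_mul_tT_pow tT_pow

noncomputable def tPrimeHom : Sigma216x3 →* TPrime := tetraHom tetraRel_tPrime tT_pow

theorem tPrimeHom_V : tPrimeHom gV = tS := tetraHom_V _ _
theorem tPrimeHom_D : tPrimeHom gD = tT := tetraHom_D _ _

/-- A homomorphism out of `T'` is given by the images of `s` and `t`. -/
theorem exists_tPrime_hom {H : Type*} [Group H] {a t : H} (ha : a ^ 4 = 1)
    (hb : (a⁻¹ * t) ^ 3 = a ^ 2) (ht : t ^ 3 = 1) : ∃ f : TPrime →* H, f tS = a ∧ f tT = t := by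
  -- The presentation uses `a` and `b`; here `b = a⁻¹ t` since `t = ab`.
  let v : Fin 2 → H := ![a, a⁻¹ * t]
  have h : ∀ r ∈ ({(FreeGroup.of 0) ^ 4, (FreeGroup.of 0) ^ 2 * ((FreeGroup.of 1) ^ 3)⁻¹,
      (FreeGroup.of 0 * FreeGroup.of 1) ^ 3} : Set (FreeGroup (Fin 2))),
      FreeGroup.lift v r = 1 := by
    rintro r (rfl | rfl | rfl)
    · simpa [v] using ha
    · simp only [map_mul, map_inv, map_pow, FreeGroup.lift_apply_of]
      exact mul_inv_eq_one.2 hb.symm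
    · simpa [v] using ht
  refine ⟨PresentedGroup.toGroup h, PresentedGroup.toGroup.of h, ?_⟩
  rw [tT, map_mul, PresentedGroup.toGroup.of, PresentedGroup.toGroup.of]
  exact mul_inv_cancel_left a t

theorem tPrimeHom_surjective : Function.Surjective tPrimeHom := by
  rw [← MonoidHom.range_eq_top, eq_top_iff, ← PresentedGroup.closure_range_of, Subgroup.closure_le]
  rintro _ ⟨i, rfl⟩
  have h0 : tPrimeHom gV = PresentedGroup.of 0 := tPrimeHom_V
  have h1 : tPrimeHom (gV⁻¹ * gD) = PresentedGroup.of 1 := by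
    rw [map_mul, map_inv, tPrimeHom_V, tPrimeHom_D]
    exact inv_mul_cancel_left _ _
  rcases Fin.exists_fin_two.1 ⟨i, rfl⟩ with rfl | rfl
  exacts [⟨_, h0⟩, ⟨_, h1⟩]

/-- The actions of `V` and `D` on the plane over the field with three elements. -/
def planeV : Equiv.Perm (Fin 3 × Fin 3) where
  toFun v := (-v.2, v.1)
  invFun v := (v.2, -v.1)
  left_inv := by decide
  right_inv := by decide

def planeD : Equiv.Perm (Fin 3 × Fin 3) where
  toFun v := (v.1 - v.2, v.2)
  invFun v := (v.1 + v.2, v.2)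
  left_inv := by decide
  right_inv := by decide

/-- The presentation alone does not show that `T'` is large enough. Its action on the plane over the
field with three elements does: the 24 reduced words act differently there. -/
theorem tPrimeHom_eq_one (x : GIdx) (h : tPrimeHom (gEquiv x) = 1) :
    x.2.2.1 = (0, 0) ∧ (x.2.2.2 : ℕ) % 3 = 0 := by
  obtain ⟨f, hf1, hf2⟩ := exists_tPrime_hom (a := planeV) (t := planeD) (by decide +kernel)
    (by decide +kernel) (by decide +kernel)
  have h1 := congrArg f h
  rw [map_one, tPrimeHom, tetraHom_gEquiv] at h1
  have h2 : f (nWord tS tT x.2.2) = nWord planeV planeD x.2.2 := by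
    simp only [nWord, qWord, map_mul, map_pow, map_inv, hf1, hf2]
  rw [h2] at h1
  have key : ∀ n : NIdx, nWord planeV planeD n = 1 → n.1 = (0, 0) ∧ (n.2 : ℕ) % 3 = 0 := by
    decide +kernel
  exact key _ h1

theorem Delta27_subgroupOf : Delta27.subgroupOf Sigma216x3 = tPrimeHom.ker := by
  have hC : suC ∈ Delta27 := Subgroup.subset_closure (by simp)
  have hE : suE ∈ Delta27 := Subgroup.subset_closure (by simp)
  refine subgroupOf_eq_ker _ ?_ fun x hx => ?_
  · rw [Delta27, Subgroup.closure_le]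
    rintro g (rfl | rfl)
    · exact ⟨gC, tetraHom_C _ _, rfl⟩
    · exact ⟨gE, tetraHom_E _ _, rfl⟩
  · obtain ⟨h1, h3⟩ := tPrimeHom_eq_one x hx
    refine mul_mem (mul_mem (pow_mem hC _) (pow_mem hE _)) (mul_mem ?_ (sud_pow_mem hC hE h3))
    rw [h1]
    simp [qWord]

/-! ### Conjugacy under `Σ(72×3)` -/

theorem mem_Sigma72x3_of_degHom {g : Sigma216x3} (h : degHom g = 1) : (g : SU3) ∈ Sigma72x3 := by
  have h1 : g ∈ Sigma72x3.subgroupOf Sigma216x3 := by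
    rw [Sigma72x3_subgroupOf]
    exact h
  exact h1

/-- Powers of any element of degree 1 represent the three cosets of `Σ(72×3)`. -/
theorem exists_eq_mul_pow (c : Sigma216x3) (hc : degHom c = Multiplicative.ofAdd 1)
    (g : Sigma216x3) : ∃ h ∈ Sigma72x3, ∃ m < 3, (g : SU3) = h * (c : SU3) ^ m := by
  refine ⟨(g * (c ^ (Multiplicative.toAdd (degHom g)).val)⁻¹ : Sigma216x3),
    mem_Sigma72x3_of_degHom ?_, (Multiplicative.toAdd (degHom g)).val, ZMod.val_lt _, ?_⟩
  · rw [map_mul, map_inv, map_pow, hc, ← ofAdd_nsmul, nsmul_one, ZMod.natCast_zmod_val]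
    exact mul_inv_cancel (degHom g)
  · rw [← SubmonoidClass.coe_pow, ← Subgroup.coe_mul, inv_mul_cancel_right]

/-- The coset representatives can be chosen in the centralizer of `x`, so they contribute no new
conjugates. -/
theorem conjOrbit_eq_of_commute {x : SU3} (c : Sigma216x3)
    (hc : degHom c = Multiplicative.ofAdd 1) (hx : Commute (c : SU3) x) :
    conjOrbit Sigma216x3 x = conjOrbit Sigma72x3 x := by
  apply Set.Subset.antisymm
  · rintro _ ⟨g, hg, rfl⟩
    obtain ⟨h, hh, m, -, hgm⟩ := exists_eq_mul_pow c hc ⟨g, hg⟩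
    refine ⟨h, hh, ?_⟩
    have h1 : g = h * (c : SU3) ^ m := hgm
    rw [h1, mul_assoc h, (hx.pow_left m).eq]
    group
  · rintro _ ⟨g, hg, rfl⟩
    exact ⟨g, Sigma72x3_le hg, rfl⟩

theorem conjOrbit_C : conjOrbit Sigma216x3 suC = conjOrbit Sigma72x3 suC := by
  refine conjOrbit_eq_of_commute gD degHom_D ?_
  change suD * suC = suC * suD
  rw [suD_eq, suC_eq, su_mul, su_mul]
  congr 1

theorem degHom_d : degHom ⟨sud, sud_mem⟩ = Multiplicative.ofAdd 1 := by
  have h : (⟨sud, sud_mem⟩ : Sigma216x3) = gEquiv idd := Subtype.ext sud_eq_su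
  rw [h, degHom_gEquiv]
  rfl

theorem conjOrbit_V_sq : conjOrbit Sigma216x3 (suV ^ 2) = conjOrbit Sigma72x3 (suV ^ 2) :=
  conjOrbit_eq_of_commute ⟨sud, sud_mem⟩ degHom_d tetraRel_su.d_V_sq

/-- With coset representatives `1, d, d²`, the class of `V` is the union of the `Σ(72×3)`-classes of
`V`, `d V d⁻¹` and `d² V d⁻²`; the last two are conjugate in `Σ(72×3)` to `X` and `ω² V X`. -/
theorem conjOrbit_V : conjOrbit Sigma216x3 suV = conjOrbit Sigma72x3 suV ∪
    conjOrbit Sigma72x3 suX ∪ conjOrbit Sigma72x3 (suZ ^ 2 * (suV * suX)) := by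
  have hC : suC ∈ Sigma72x3 := Subgroup.subset_closure (by simp)
  have hE : suE ∈ Sigma72x3 := Subgroup.subset_closure (by simp)
  have hV : suV ∈ Sigma72x3 := Subgroup.subset_closure (by simp)
  have h1 : sud * suV * sud⁻¹ = suC ^ 2 * suX * (suC ^ 2)⁻¹ := by
    rw [suX_eq, sud_eq_su, suV_eq, suC_eq, suD_eq]
    simp only [pow_two, su_mul, su_inv]
    congr 1
  -- The conjugating element `E V` lies in `Σ(72×3)`; the identity is a computation with exponents.
  have h2 : sud ^ 2 * suV * (sud ^ 2)⁻¹ =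
      suE * suV * (suZ ^ 2 * (suV * suX)) * (suE * suV)⁻¹ := by
    rw [suX_eq, sud_eq_su, suV_eq, suE_eq, suD_eq, suZ_eq_su]
    simp only [pow_two, su_mul, su_inv]
    congr 1
  have hC2 := pow_mem hC 2
  have hEV := mul_mem hE hV
  apply Set.Subset.antisymm
  · rintro _ ⟨g, hg, rfl⟩
    obtain ⟨h, hh, m, hm, hgm⟩ := exists_eq_mul_pow ⟨sud, sud_mem⟩ degHom_d ⟨g, hg⟩
    have h0 : g = h * sud ^ m := hgm
    rw [h0]
    have h3 : h * sud ^ m * suV * (h * sud ^ m)⁻¹ = h * (sud ^ m * suV * (sud ^ m)⁻¹) * h⁻¹ := by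
      group
    rw [h3]
    interval_cases m
    · left; left
      exact ⟨h, hh, by group⟩
    · left; right
      refine ⟨h * suC ^ 2, mul_mem hh hC2, ?_⟩
      rw [pow_one, h1]
      group
    · right
      refine ⟨h * (suE * suV), mul_mem hh hEV, ?_⟩
      rw [h2]
      group
  · rintro _ ((⟨g, hg, rfl⟩ | ⟨g, hg, rfl⟩) | ⟨g, hg, rfl⟩)
    · exact ⟨g, Sigma72x3_le hg, rfl⟩
    · refine ⟨g * ((suC ^ 2)⁻¹ * sud), mul_mem (Sigma72x3_le hg)
        (mul_mem (inv_mem (Sigma72x3_le hC2)) sud_mem), ?_⟩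
      have h3 : suX = (suC ^ 2)⁻¹ * (sud * suV * sud⁻¹) * suC ^ 2 := by rw [h1]; group
      rw [h3]
      group
    · refine ⟨g * ((suE * suV)⁻¹ * sud ^ 2), mul_mem (Sigma72x3_le hg)
        (mul_mem (inv_mem (Sigma72x3_le hEV)) (pow_mem sud_mem 2)), ?_⟩
      have h3 : suZ ^ 2 * (suV * suX) =
          (suE * suV)⁻¹ * (sud ^ 2 * suV * (sud ^ 2)⁻¹) * (suE * suV) := by rw [h2]; group
      rw [h3]
      group

/-! ### Constructions of matrix representations -/

section Constructions

variable {G : Type*} [Group G]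

/-- The product of a linear character and a matrix representation. -/
noncomputable def twist {n : ℕ} (c : G →* ℂ) (M : MatRep G n) : MatRep G n where
  toFun g := c g • M g
  map_one' := by rw [map_one, map_one, one_smul]
  map_mul' g h := by rw [map_mul, map_mul, Matrix.smul_mul, Matrix.mul_smul, smul_smul]

theorem character_twist {n : ℕ} (c : G →* ℂ) (M : MatRep G n) (g : G) :
    character (twist c M) g = c g * character M g :=
  Matrix.trace_smul _ _

theorem character_conjRep {n : ℕ} (M : MatRep G n) (g : G) :
    character (conjRep M) g = (starRingEnd ℂ) (character M g) :=
  (AddMonoidHom.map_trace (starRingEnd ℂ).toAddMonoidHom (M g)).symm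

open Kronecker in
/-- The tensor product of two matrix representations, with indices in a product type. -/
noncomputable def kron {m n : ℕ} (M : MatRep G m) (N : MatRep G n) :
    G →* Matrix (Fin m × Fin n) (Fin m × Fin n) ℂ where
  toFun g := M g ⊗ₖ N g
  map_one' := by rw [map_one, map_one, Matrix.one_kronecker_one]
  map_mul' g h := by rw [map_mul, map_mul, Matrix.mul_kronecker_mul]

theorem trace_kron {m n : ℕ} (M : MatRep G m) (N : MatRep G n) (g : G) :
    (kron M N g).trace = character M g * character N g :=
  Matrix.trace_kronecker _ _

/-- The tensor product of two matrix representations. -/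
noncomputable def kronRep {m n : ℕ} (M : MatRep G m) (N : MatRep G n) : MatRep G (m * n) where
  toFun g := Matrix.reindex finProdFinEquiv finProdFinEquiv (kron M N g)
  map_one' := by rw [map_one]; simp
  map_mul' g h := by rw [map_mul]; simp [Matrix.submatrix_mul_equiv]

theorem character_kronRep {m n : ℕ} (M : MatRep G m) (N : MatRep G n) (g : G) :
    character (kronRep M N) g = character M g * character N g := by
  rw [← trace_kron]
  exact Equiv.sum_comp finProdFinEquiv.symm fun x => kron M N g x x

/-- The restriction of a representation to the range of an invariant projection `B * A`, where
`A * B = 1`. -/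
noncomputable def compress {ι : Type*} [Fintype ι] [DecidableEq ι] {n : ℕ} (K : G →* Matrix ι ι ℂ)
    (A : Matrix (Fin n) ι ℂ) (B : Matrix ι (Fin n) ℂ) (hAB : A * B = 1)
    (hK : ∀ g, Commute (B * A) (K g)) : MatRep G n where
  toFun g := A * K g * B
  map_one' := by rw [map_one, Matrix.mul_one, hAB]
  map_mul' g h := by
    have h1 : B * A * K g = K g * (B * A) := hK g
    calc A * K (g * h) * B = A * (K g * K h) * B := by rw [map_mul]
      _ = (A * B) * A * (K g * K h) * B := by rw [hAB, Matrix.one_mul]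
      _ = A * (B * A * K g) * K h * B := by simp only [Matrix.mul_assoc]
      _ = _ := by rw [h1]; simp only [Matrix.mul_assoc]

theorem character_compress {ι : Type*} [Fintype ι] [DecidableEq ι] {n : ℕ} (K : G →* Matrix ι ι ℂ)
    (A : Matrix (Fin n) ι ℂ) (B : Matrix ι (Fin n) ℂ) (hAB : A * B = 1)
    (hK : ∀ g, Commute (B * A) (K g)) (g : G) :
    character (compress K A B hAB hK) g = (K g * (B * A)).trace := by
  change (A * K g * B).trace = _
  rw [Matrix.mul_assoc, Matrix.trace_mul_comm, Matrix.mul_assoc]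

/-! #### The symmetric square -/

/-- A basis of the symmetric tensors. -/
def symPair : Fin 6 → Fin 3 × Fin 3 := ![(0, 0), (1, 1), (2, 2), (0, 1), (0, 2), (1, 2)]

/-- Rational entries make the matrix identities decidable; they are transported to `ℂ` afterwards.
-/
def symIncl : Matrix (Fin 3 × Fin 3) (Fin 6) ℚ :=
  fun x p => if x = symPair p ∨ x.swap = symPair p then 1 else 0

/-- Averaging over the two orders; on a diagonal pair both halves apply and give 1. -/
def symProj : Matrix (Fin 6) (Fin 3 × Fin 3) ℚ :=
  fun p x => (if x = symPair p then 1 / 2 else 0) + (if x.swap = symPair p then 1 / 2 else 0)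

theorem symProj_mul_symIncl : symProj * symIncl = 1 := by decide +kernel

def symmetrizer : Matrix (Fin 3 × Fin 3) (Fin 3 × Fin 3) ℚ :=
  fun x y => (if x = y then 1 / 2 else 0) + (if x.swap = y then 1 / 2 else 0)

theorem symIncl_mul_symProj : symIncl * symProj = symmetrizer := by decide +kernel

theorem map_symmetrizer_apply (x y : Fin 3 × Fin 3) :
    symmetrizer.map (algebraMap ℚ ℂ) x y =
      (if y = x then 1 / 2 else 0) + (if y = x.swap then 1 / 2 else 0) := by
  simp only [Matrix.map_apply, symmetrizer, map_add, eq_comm (a := y)]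
  congr 1 <;> split_ifs <;> simp

theorem map_symmetrizer_mul (K : Matrix (Fin 3 × Fin 3) (Fin 3 × Fin 3) ℂ) (x y) :
    (symmetrizer.map (algebraMap ℚ ℂ) * K) x y = (K x y + K x.swap y) / 2 := by
  simp only [Matrix.mul_apply, map_symmetrizer_apply, add_mul, Finset.sum_add_distrib, ite_mul,
    zero_mul, Finset.sum_ite_eq', Finset.mem_univ, if_true]
  ring

theorem mul_map_symmetrizer (K : Matrix (Fin 3 × Fin 3) (Fin 3 × Fin 3) ℂ) (x y) :
    (K * symmetrizer.map (algebraMap ℚ ℂ)) x y = (K x y + K x y.swap) / 2 := by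
  have h : ∀ z : Fin 3 × Fin 3, y = z.swap ↔ y.swap = z := fun z => by
    rw [Prod.swap_eq_iff_eq_swap]
  simp only [Matrix.mul_apply, map_symmetrizer_apply, h, mul_add, Finset.sum_add_distrib, mul_ite,
    mul_zero, Finset.sum_ite_eq, Finset.mem_univ, if_true]
  ring

/-- The symmetric square of a matrix representation of dimension 3. -/
noncomputable def symRep (M : MatRep G 3) : MatRep G 6 :=
  compress (kron M M) (symProj.map (algebraMap ℚ ℂ)) (symIncl.map (algebraMap ℚ ℂ))
    (by rw [← Matrix.map_mul, symProj_mul_symIncl, Matrix.map_one _ (map_zero _) (map_one _)])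
    (fun g => by
      rw [← Matrix.map_mul, symIncl_mul_symProj]
      ext x y
      rw [map_symmetrizer_mul, mul_map_symmetrizer]
      simp [kron, Matrix.kroneckerMap_apply, mul_comm])

/-- The symmetrizer is half the identity plus half the swap, and the trace of `M ⊗ M` composed with
the swap is the trace of `M²`. -/
theorem character_symRep (M : MatRep G 3) (g : G) :
    character (symRep M) g = (character M g ^ 2 + character M (g ^ 2)) / 2 := by
  rw [symRep, character_compress, ← Matrix.map_mul, symIncl_mul_symProj]
  simp only [Matrix.trace, Matrix.diag, mul_map_symmetrizer]
  simp only [Matrix.trace, Matrix.diag, character, pow_two, map_mul, Matrix.mul_apply, kron,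
    MonoidHom.coe_mk, OneHom.coe_mk, Matrix.kroneckerMap_apply, Fintype.sum_prod_type, Fin.sum_univ_three, Prod.swap_prod_mk]
  ring

/-! #### The adjoint representation -/

/-- The basis of traceless matrices: the six off-diagonal units, `E₀₀ - E₁₁` and `E₁₁ - E₂₂`. -/
def tracelessIncl : Matrix (Fin 3 × Fin 3) (Fin 8) ℚ := fun x p =>
  (![fun x => if x = (0, 1) then 1 else 0, fun x => if x = (1, 0) then 1 else 0,
    fun x => if x = (0, 2) then 1 else 0, fun x => if x = (2, 0) then 1 else 0,
    fun x => if x = (1, 2) then 1 else 0, fun x => if x = (2, 1) then 1 else 0,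
    fun x => if x = (0, 0) then 1 else if x = (1, 1) then -1 else 0,
    fun x => if x = (1, 1) then 1 else if x = (2, 2) then -1 else 0] :
    Fin 8 → Fin 3 × Fin 3 → ℚ) p x

/-- Coordinates of the matrix after subtracting a third of its trace from the diagonal; the last
coordinate is minus the corrected entry `(2, 2)`. -/
def tracelessProj : Matrix (Fin 8) (Fin 3 × Fin 3) ℚ := fun p x =>
  (![fun x => if x = (0, 1) then 1 else 0, fun x => if x = (1, 0) then 1 else 0,
    fun x => if x = (0, 2) then 1 else 0, fun x => if x = (2, 0) then 1 else 0,
    fun x => if x = (1, 2) then 1 else 0, fun x => if x = (2, 1) then 1 else 0,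
    fun x => (if x = (0, 0) then 1 else 0) - (if x.1 = x.2 then 1 / 3 else 0),
    fun x => (if x.1 = x.2 then 1 / 3 else 0) - (if x = (2, 2) then 1 else 0)] :
    Fin 8 → Fin 3 × Fin 3 → ℚ) p x

def traceless : Matrix (Fin 3 × Fin 3) (Fin 3 × Fin 3) ℚ := fun x y =>
  (if x = y then 1 else 0) - (if x.1 = x.2 then 1 / 3 else 0) * (if y.1 = y.2 then 1 else 0)

theorem tracelessProj_mul_tracelessIncl : tracelessProj * tracelessIncl = 1 := by decide +kernel

theorem tracelessIncl_mul_tracelessProj : tracelessIncl * tracelessProj = traceless := by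
  decide +kernel

theorem map_traceless : traceless.map (algebraMap ℚ ℂ) =
    1 - (3⁻¹ : ℂ) • Matrix.vecMulVec (fun x => if x.1 = x.2 then 1 else 0)
      (fun x => if x.1 = x.2 then 1 else 0) := by
  ext x y
  simp only [Matrix.map_apply, traceless, map_sub, map_mul, Matrix.sub_apply, Matrix.one_apply,
    Matrix.smul_apply, Matrix.vecMulVec_apply, smul_eq_mul]
  split_ifs <;> simp

/-- The vector is the identity matrix, fixed by `X ↦ g X g*` for unitary `g`. Together with the
version for row vectors, this makes the projection onto traceless matrices commute with the action.
-/
theorem kron_conj_mulVec (M : MatRep G 3) (hM : ∀ g, M g ∈ Matrix.unitaryGroup (Fin 3) ℂ) (g : G) :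
    (kron M (conjRep M) g).mulVec (fun x => if x.1 = x.2 then 1 else 0) =
      fun x => if x.1 = x.2 then 1 else 0 := by
  ext ⟨i, j⟩
  have h := congrFun₂ (Matrix.mem_unitaryGroup_iff.1 (hM g)) i j
  simpa [Matrix.mul_apply, Matrix.one_apply, Matrix.mulVec, dotProduct, Fintype.sum_prod_type, kron,
    conjRep] using h

theorem kron_conj_vecMul (M : MatRep G 3) (hM : ∀ g, M g ∈ Matrix.unitaryGroup (Fin 3) ℂ) (g : G) :
    Matrix.vecMul (fun x => if x.1 = x.2 then 1 else 0) (kron M (conjRep M) g) =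
      fun x => if x.1 = x.2 then 1 else 0 := by
  ext ⟨i, j⟩
  have h := congrFun₂ (Matrix.mem_unitaryGroup_iff'.1 (hM g)) j i
  simpa [Matrix.mul_apply, Matrix.one_apply, Matrix.vecMul, dotProduct, Fintype.sum_prod_type, kron,
    conjRep, mul_comm, eq_comm] using h

/-- The representation on traceless matrices of a unitary representation of dimension 3. -/
noncomputable def adjRep (M : MatRep G 3) (hM : ∀ g, M g ∈ Matrix.unitaryGroup (Fin 3) ℂ) :
    MatRep G 8 :=
  compress (kron M (conjRep M)) (tracelessProj.map (algebraMap ℚ ℂ))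
    (tracelessIncl.map (algebraMap ℚ ℂ))
    (by rw [← Matrix.map_mul, tracelessProj_mul_tracelessIncl,
      Matrix.map_one _ (map_zero _) (map_one _)])
    (fun g => by
      rw [← Matrix.map_mul, tracelessIncl_mul_tracelessProj, map_traceless, Commute, SemiconjBy,
        Matrix.sub_mul, Matrix.mul_sub, Matrix.one_mul, Matrix.mul_one, Matrix.smul_mul,
        Matrix.mul_smul, Matrix.vecMulVec_mul, Matrix.mul_vecMulVec, kron_conj_mulVec M hM,
        kron_conj_vecMul M hM])

theorem character_adjRep (M : MatRep G 3) (hM : ∀ g, M g ∈ Matrix.unitaryGroup (Fin 3) ℂ) (g : G) :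
    character (adjRep M hM) g = character M g * (starRingEnd ℂ) (character M g) - 1 := by
  rw [adjRep, character_compress, ← Matrix.map_mul, tracelessIncl_mul_tracelessProj, map_traceless,
    Matrix.mul_sub, Matrix.mul_one, Matrix.mul_smul, Matrix.mul_vecMulVec, kron_conj_mulVec M hM,
    Matrix.trace_sub, trace_kron, character_conjRep, Matrix.trace_smul, Matrix.trace_vecMulVec]
  congr 1
  simp [dotProduct, Fintype.sum_prod_type]

end Constructions

/-! ### The irreps of `Σ(216×3)` -/

/-- The character of `ℤ₃` that maps the generator to `ω ^ p`. -/
noncomputable def zChar (p : Fin 3) : Multiplicative (ZMod 3) →* ℂ where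
  toFun x := ω ^ ((p : ℕ) * (Multiplicative.toAdd x).val)
  map_one' := by simp
  map_mul' x y := by
    rw [toAdd_mul, ZMod.val_add, pow_mul, pow_mul, pow_mul, ← pow_add]
    refine (pow_eq_pow_mod _ ?_).symm
    rw [← pow_mul, mul_comm, pow_mul, ω_pow, one_pow]

theorem zChar_ofAdd (p : Fin 3) (x : ZMod 3) :
    zChar p (Multiplicative.ofAdd x) = ω ^ ((p : ℕ) * x.val) := rfl

theorem zChar_zero (x : Multiplicative (ZMod 3)) : zChar 0 x = 1 := by simp [zChar]

/-- The pull-back of `zChar` to `Σ(216×3)`. -/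
noncomputable def degChar (p : Fin 3) : Sigma216x3 →* ℂ := (zChar p).comp degHom

theorem degChar_classRep (p : Fin 3) (k : Fin 24) :
    degChar p (classRep k) = ω ^ ((p : ℕ) * (classDeg k).val) := by
  rw [degChar, MonoidHom.comp_apply, degHom_classRep, zChar_ofAdd]

theorem twist_degChar_zero {n : ℕ} (M : MatRep Sigma216x3 n) : twist (degChar 0) M = M := by
  ext1 g
  exact (congrArg (· • M g) (zChar_zero _)).trans (one_smul _ _)

noncomputable def zRep (p : Fin 3) : MatRep (Multiplicative (ZMod 3)) 1 :=
  twist (zChar p) 1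

theorem zRep_apply (p : Fin 3) : zRep p (Multiplicative.ofAdd 1) = !![ω ^ (p : ℕ)] := by
  ext i j
  have h : zChar p (Multiplicative.ofAdd 1) = ω ^ (p : ℕ) := by
    rw [zChar_ofAdd, ZMod.val_one, mul_one]
  fin_cases i
  fin_cases j
  change (zChar p (Multiplicative.ofAdd 1) • (1 : Matrix (Fin 1) (Fin 1) ℂ)) 0 0 = _
  rw [h]
  simp

noncomputable def repOne (p : Fin 3) : MatRep Sigma216x3 1 := (zRep p).comp degHom

theorem repOne_eq (p : Fin 3) : repOne p = twist (degChar p) 1 := rfl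

/-! #### The two-dimensional irreps -/

/-- As `φ = (1 + i)/√2`, the square roots cancel and all entries lie in `ℚ(i)`. -/
theorem matUb_eq : matUb = !![(1 + Complex.I) / 2, (1 + Complex.I) / 2;
    -((1 - Complex.I) / 2), (1 - Complex.I) / 2] := by
  have h2 : (Real.sqrt 2 : ℂ) ^ 2 = 2 := by
    rw [← Complex.ofReal_pow, Real.sq_sqrt (by norm_num)]
    norm_num
  have h0 : (Real.sqrt 2 : ℂ) ≠ 0 := by
    intro h0
    rw [h0] at h2
    norm_num at h2
  have hphi : phi = Real.sqrt 2 * ((1 + Complex.I) / 2) := by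
    have h : (Complex.I * Real.pi / 4 : ℂ) = ((Real.pi / 4 : ℝ) : ℂ) * Complex.I := by
      push_cast
      ring
    rw [phi, h, Complex.exp_mul_I, ← Complex.ofReal_cos, ← Complex.ofReal_sin,
      Real.cos_pi_div_four, Real.sin_pi_div_four]
    push_cast
    ring
  have hc : (starRingEnd ℂ) phi = Real.sqrt 2 * ((1 - Complex.I) / 2) := by
    rw [hphi]
    simp only [map_mul, map_div₀, map_add, map_ofNat, Complex.conj_I, Complex.conj_ofReal, map_one]
    ring
  rw [matUb, hc, hphi]
  ext i j
  fin_cases i <;> fin_cases j <;> simp [h0]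

theorem matUt_eq : matUt = !![(-1 - Complex.I) / 2, (1 + Complex.I) / 2;
    (Complex.I - 1) / 2, (Complex.I - 1) / 2] := by
  have h := Complex.I_sq
  rw [matUt, matUa, matUb_eq]
  ext i j
  fin_cases i <;> fin_cases j <;> simp [Matrix.mul_apply, Fin.sum_univ_two] <;> grind

theorem matUa_sq : matUa * matUa = -1 := by
  have h := Complex.I_sq
  rw [matUa]
  ext i j
  fin_cases i <;> fin_cases j <;> simp [Matrix.mul_apply, Fin.sum_univ_two]

theorem matUt_sq : matUt * matUt = !![(Complex.I - 1) / 2, (-1 - Complex.I) / 2;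
    (1 - Complex.I) / 2, (-1 - Complex.I) / 2] := by
  have h := Complex.I_sq
  rw [matUt_eq]
  ext i j
  fin_cases i <;> fin_cases j <;> simp [Matrix.mul_apply, Fin.sum_univ_two] <;> grind

theorem matUt_cube : matUt * (matUt * matUt) = 1 := by
  have h := Complex.I_sq
  rw [matUt_sq, matUt_eq]
  ext i j
  fin_cases i <;> fin_cases j <;> simp [Matrix.mul_apply, Fin.sum_univ_two] <;> grind

theorem matUb_cube : matUb * (matUb * matUb) = -1 := by
  have h := Complex.I_sq
  rw [matUb_eq]
  ext i j
  fin_cases i <;> fin_cases j <;> simp [Matrix.mul_apply, Fin.sum_univ_two] <;> grind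

theorem ω_pow_cube (p : ℕ) : ω ^ p * (ω ^ p * ω ^ p) = 1 := by
  rw [← pow_add, ← pow_add, show p + (p + p) = 3 * p by ring, pow_mul, ω_pow, one_pow]

noncomputable def unitUa : (Matrix (Fin 2) (Fin 2) ℂ)ˣ where
  val := matUa
  inv := -matUa
  val_inv := by rw [Matrix.mul_neg, matUa_sq, neg_neg]
  inv_val := by rw [Matrix.neg_mul, matUa_sq, neg_neg]

noncomputable def unitUt (p : Fin 3) : (Matrix (Fin 2) (Fin 2) ℂ)ˣ where
  val := ω ^ (p : ℕ) • matUt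
  inv := (ω ^ (p : ℕ) * ω ^ (p : ℕ)) • (matUt * matUt)
  val_inv := by
    rw [Matrix.smul_mul, Matrix.mul_smul, smul_smul, matUt_cube, ω_pow_cube, one_smul]
  inv_val := by
    rw [Matrix.smul_mul, Matrix.mul_smul, smul_smul, mul_assoc, mul_assoc, ω_pow_cube, matUt_cube,
      one_smul]

theorem exists_tPrime_rep (p : Fin 3) :
    ∃ τ : MatRep TPrime 2, τ tS = matUa ∧ τ tT = ω ^ (p : ℕ) • matUt := by
  have hω := ω_pow_cube p
  obtain ⟨f, h1, h2⟩ := exists_tPrime_hom (a := unitUa) (t := unitUt p)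
    (by
      ext1
      change matUa ^ 4 = 1
      rw [show 4 = 2 * 2 from rfl, pow_mul, pow_two matUa, matUa_sq]
      simp)
    (by
      ext1
      change (-matUa * (ω ^ (p : ℕ) • matUt)) ^ 3 = matUa ^ 2
      have h : -matUa * (ω ^ (p : ℕ) • matUt) = ω ^ (p : ℕ) • matUb := by
        rw [matUt, Matrix.mul_smul, ← Matrix.mul_assoc, Matrix.neg_mul, matUa_sq, neg_neg,
          Matrix.one_mul]
      rw [h, smul_pow, pow_succ', pow_two, hω, one_smul, pow_succ', pow_two, matUb_cube, pow_two,
        matUa_sq])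
    (by
      ext1
      change (ω ^ (p : ℕ) • matUt) ^ 3 = 1
      rw [smul_pow, pow_succ', pow_two, hω, one_smul, pow_succ', pow_two, matUt_cube])
  exact ⟨(Units.coeHom _).comp f, congrArg Units.val h1, congrArg Units.val h2⟩

noncomputable def tRep (p : Fin 3) : MatRep TPrime 2 := (exists_tPrime_rep p).choose

theorem tRep_S (p : Fin 3) : tRep p tS = matUa := (exists_tPrime_rep p).choose_spec.1

theorem tRep_T (p : Fin 3) : tRep p tT = ω ^ (p : ℕ) • matUt := (exists_tPrime_rep p).choose_spec.2

noncomputable def repTwo (p : Fin 3) : MatRep Sigma216x3 2 := (tRep p).comp tPrimeHom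

theorem tPrimeHom_C : tPrimeHom gC = 1 := tetraHom_C _ _
theorem tPrimeHom_E : tPrimeHom gE = 1 := tetraHom_E _ _
theorem tPrimeHom_Z : tPrimeHom gZ = 1 := tetraHom_Z _ _

/-- Among the generators only `D` has nonzero degree, and there the twist is exactly the factor
`ω^p`. -/
theorem repTwo_eq (p : Fin 3) : repTwo p = twist (degChar p) (repTwo 0) := by
  apply hom_ext
  · simp [repTwo, twist, degChar, tPrimeHom_C, degHom_C]
  · simp [repTwo, twist, degChar, tPrimeHom_E, degHom_E]
  · simp [repTwo, twist, degChar, tPrimeHom_V, degHom_V, tRep_S]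
  · simp [repTwo, twist, degChar, tPrimeHom_D, degHom_D, tRep_T, zChar_ofAdd, ZMod.val_one]

theorem character_repTwo_zero (k : Fin 24) : character (repTwo 0) (classRep k) = rowTwo 0 k := by
  have hC : repTwo 0 gC = 1 := by simp [repTwo, tPrimeHom_C]
  have hE : repTwo 0 gE = 1 := by simp [repTwo, tPrimeHom_E]
  have hZ : repTwo 0 gZ = 1 := by simp [repTwo, tPrimeHom_Z]
  have hV : repTwo 0 gV = matUa := by simp [repTwo, tPrimeHom_V, tRep_S]
  have hD : repTwo 0 gD = matUt := by simp [repTwo, tPrimeHom_D, tRep_T]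
  have t1 : matUt.trace = -1 := by
    rw [matUt_eq, Matrix.trace_fin_two]; simp; ring
  have t2 : (matUt * matUt).trace = -1 := by
    rw [matUt_sq, Matrix.trace_fin_two]; simp; ring
  have t3 : matUa.trace = 0 := by
    rw [matUa, Matrix.trace_fin_two]; simp
  have t4 : (matUa * (matUt * matUt)).trace = 1 := by
    have h := Complex.I_sq
    rw [matUt_sq, matUa, Matrix.trace_fin_two]
    simp [Matrix.mul_apply, Fin.sum_univ_two]
    grind
  fin_cases k <;>
    simp [character, classRep, rowTwo, hC, hE, hZ, hV, hD, pow_two, matUa_sq, t1, t2, t3, t4]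

/-! #### The irrep `3⁽ᵃ⁾` -/

/-- The integral form of `R_a`; together with `unitRt`, the integral form of `R_a R_b`, it makes
relations and traces decidable. -/
def unitRa : (Matrix (Fin 3) (Fin 3) ℤ)ˣ where
  val := !![1, 0, 0; 0, -1, 0; 0, 0, -1]
  inv := !![1, 0, 0; 0, -1, 0; 0, 0, -1]
  val_inv := by decide +kernel
  inv_val := by decide +kernel

def unitRt : (Matrix (Fin 3) (Fin 3) ℤ)ˣ where
  val := !![0, 1, 0; 0, 0, -1; -1, 0, 0]
  inv := !![0, 0, -1; 1, 0, 0; 0, -1, 0]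
  val_inv := by decide +kernel
  inv_val := by decide +kernel

theorem tetraRel_unit : TetraRel unitRa unitRt where
  V_pow := by decide +kernel
  d_pow := by decide +kernel
  d_V_sq := by decide +kernel
  Y_V := by decide +kernel
  d_Y := by decide +kernel

noncomputable def intHom : Sigma216x3 →* (Matrix (Fin 3) (Fin 3) ℤ)ˣ :=
  tetraHom tetraRel_unit (by decide +kernel)

theorem intHom_gEquiv (x : GIdx) : intHom (gEquiv x) = nWord unitRa unitRt x.2.2 :=
  tetraHom_gEquiv _ _ x

/-- This lets the integral representation descend along `altHom`, so no representation of `A₄` has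
to be built from a presentation. -/
theorem altHom_ker_le : altHom.ker ≤ intHom.ker := by
  intro g hg
  obtain ⟨x, rfl⟩ := gEquiv.surjective g
  obtain ⟨h1, h2, h3⟩ := altHom_eq_one x hg
  rw [MonoidHom.mem_ker, intHom_gEquiv]
  have key : ∀ n : NIdx, n.1.2 = 0 → (n.1.1 : ℕ) % 2 = 0 → (n.2 : ℕ) % 3 = 0 →
      nWord unitRa unitRt n = 1 := by decide +kernel
  exact key _ h1 h2 h3

noncomputable def altRep : MatRep (alternatingGroup (Fin 4)) 3 :=
  (RingHom.toMonoidHom (Int.castRingHom ℂ).mapMatrix).comp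
    ((Units.coeHom _).comp (altHom.liftOfSurjective altHom_surjective ⟨intHom, altHom_ker_le⟩))

noncomputable def repThreeA : MatRep Sigma216x3 3 := altRep.comp altHom

theorem repThreeA_apply (g : Sigma216x3) :
    repThreeA g = (intHom g).1.map (Int.castRingHom ℂ) := by
  have h := DFunLike.congr_fun (MonoidHom.liftOfRightInverse_comp altHom _
    (Function.rightInverse_surjInv altHom_surjective) ⟨intHom, altHom_ker_le⟩) g
  exact congrArg (fun u : (Matrix (Fin 3) (Fin 3) ℤ)ˣ => u.1.map (Int.castRingHom ℂ)) h

theorem repThreeA_V : repThreeA gV = matRa := by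
  rw [repThreeA_apply, show intHom gV = unitRa from tetraHom_V _ _]
  ext i j
  fin_cases i <;> fin_cases j <;> simp [unitRa, matRa]

theorem repThreeA_D : repThreeA gD = matRa * matRb := by
  rw [repThreeA_apply, show intHom gD = unitRt from tetraHom_D _ _]
  ext i j
  fin_cases i <;> fin_cases j <;>
    simp [unitRt, matRa, matRb, matE, Matrix.mul_apply, Fin.sum_univ_three]

theorem character_repThreeA (k : Fin 24) : character repThreeA (classRep k) = rowThreeA k := by
  have h1 : ∀ k, (nWord unitRa unitRt (classIdx k).2.2).1.trace =
      (![3, 3, 3, 3, 3, 3, 3, -1, -1, -1, 0, 0, 0, 0, 0, 0, 0, 0, 0, 0, 0, 0, 0, 0] : Fin 24 → ℤ) k := by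
    decide +kernel
  have h2 : character repThreeA (classRep k) =
      (((nWord unitRa unitRt (classIdx k).2.2).1.trace : ℤ) : ℂ) := by
    rw [character, repThreeA_apply, classRep_eq, intHom_gEquiv]
    exact (AddMonoidHom.map_trace (Int.castAddHom ℂ) _).symm
  rw [h2, h1]
  fin_cases k <;> simp [rowThreeA]

/-! #### The irreps derived from the defining representation -/

theorem definingRep_mem (g : Sigma216x3) :
    definingRep g ∈ Matrix.specialUnitaryGroup (Fin 3) ℂ := g.1.2

theorem definingRep_mem_unitary (g : Sigma216x3) :
    definingRep g ∈ Matrix.unitaryGroup (Fin 3) ℂ :=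
  (Matrix.mem_specialUnitaryGroup_iff.1 (definingRep_mem g)).1

/-- For `A` in SU(3) the adjugate is `A*`, so the second elementary symmetric function of the
eigenvalues, the trace of the adjugate, is `conj (tr A)`. -/
theorem trace_mul_self {A : Matrix (Fin 3) (Fin 3) ℂ}
    (hA : A ∈ Matrix.specialUnitaryGroup (Fin 3) ℂ) :
    (A * A).trace = A.trace ^ 2 - 2 * (starRingEnd ℂ) A.trace := by
  obtain ⟨h1, h2⟩ := Matrix.mem_specialUnitaryGroup_iff.1 hA
  have h3 : A.adjugate = star A := by
    calc A.adjugate = star A * A * A.adjugate := by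
          rw [Matrix.mem_unitaryGroup_iff'.1 h1, Matrix.one_mul]
      _ = star A := by rw [Matrix.mul_assoc, Matrix.mul_adjugate, h2, one_smul, Matrix.mul_one]
  have h4 : (starRingEnd ℂ) A.trace = A.adjugate.trace := by
    rw [h3, Matrix.star_eq_conjTranspose, Matrix.trace_conjTranspose]
    rfl
  rw [h4, Matrix.adjugate_fin_three]
  simp [Matrix.trace, Matrix.mul_apply, Fin.sum_univ_three]
  ring

theorem character_definingRep_sq (g : Sigma216x3) : character definingRep (g ^ 2) =
    character definingRep g ^ 2 - 2 * (starRingEnd ℂ) (character definingRep g) := by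
  rw [character, pow_two, map_mul]
  exact trace_mul_self (definingRep_mem g)

noncomputable def repThree (p : Fin 3) : MatRep Sigma216x3 3 := twist (degChar p) definingRep

/-- The conjugate is taken because the symmetric square of the defining representation is to be
`(6⁽⁰⁾)*`. -/
noncomputable def repSix (p : Fin 3) : MatRep Sigma216x3 6 :=
  twist (degChar p) (conjRep (symRep definingRep))

noncomputable def repEight (p : Fin 3) : MatRep Sigma216x3 8 :=
  twist (degChar p) (adjRep definingRep definingRep_mem_unitary)

noncomputable def repNine : MatRep Sigma216x3 9 := kronRep definingRep repThreeA

theorem repThree_zero : repThree 0 = definingRep := twist_degChar_zero _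

theorem character_repOne (p : Fin 3) (g) : character (repOne p) g = degChar p g := by
  rw [repOne_eq, character_twist]
  simp [character]

theorem character_repTwo (p : Fin 3) (g) :
    character (repTwo p) g = degChar p g * character (repTwo 0) g := by
  rw [repTwo_eq, character_twist]

theorem character_repThree (p : Fin 3) (g) :
    character (repThree p) g = degChar p g * character definingRep g :=
  character_twist _ _ _

theorem character_repSix (p : Fin 3) (g) :
    character (repSix p) g = degChar p g *
      ((starRingEnd ℂ) (character definingRep g) ^ 2 - character definingRep g) := by
  rw [repSix, character_twist, character_conjRep, character_symRep, character_definingRep_sq]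
  simp only [map_div₀, map_add, map_sub, map_mul, map_pow, map_ofNat, Complex.conj_conj]
  ring

theorem character_repEight (p : Fin 3) (g) :
    character (repEight p) g = degChar p g *
      (character definingRep g * (starRingEnd ℂ) (character definingRep g) - 1) := by
  rw [repEight, character_twist, character_adjRep]

theorem character_repNine (g) :
    character repNine g = character definingRep g * character repThreeA g :=
  character_kronRep _ _ _

/-- The list of the irreps of `Σ(216×3)`. -/
noncomputable def rep : ∀ k : Irrep, MatRep Sigma216x3 k.dim
  | .one p => repOne p
  | .two p => repTwo p
  | .threeA => repThreeA
  | .three p => repThree p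
  | .threeBar p => conjRep (repThree p)
  | .six p => repSix p
  | .sixBar p => conjRep (repSix p)
  | .eight p => repEight p
  | .nine => repNine
  | .nineBar => conjRep repNine

/-! ### The character table of `Σ(216×3)` -/

theorem σ_def : σ = ρ * (1 + 2 * ω) := rfl

theorem σc_def : σc = ρc * (1 + 2 * ω ^ 2) := by
  rw [σc, σ, map_mul, map_add, map_mul, star_ω, map_one, map_ofNat, ρc]

theorem ρ_mul_ρc : ρ * ρc = 1 := by
  rw [ρc_eq]
  linear_combination ρ_pow

theorem ρ_sq : ρ ^ 2 = ω * ρc := by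
  rw [ρc_eq, ω_eq_ρ]
  linear_combination -ρ ^ 2 * ρ_pow

theorem ρc_sq : ρc ^ 2 = ω ^ 2 * ρ := by
  rw [ρc_eq, ω_eq_ρ]
  linear_combination ρ ^ 7 * ρ_pow

theorem conj_ρ : (starRingEnd ℂ) ρ = ρc := rfl

theorem conj_ρc : (starRingEnd ℂ) ρc = ρ := Complex.conj_conj _

theorem conj_σ : (starRingEnd ℂ) σ = σc := rfl

theorem conj_σc : (starRingEnd ℂ) σc = σ := Complex.conj_conj _

/-- The degrees of the classes as natural numbers. -/
def degVal : Fin 24 → ℕ := ![0, 0, 0, 0, 0, 0, 0, 0, 0, 0, 1, 2, 1, 1, 1, 2, 2, 2, 1, 1, 1, 2, 2, 2]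

theorem degChar_classRep_eq (p : Fin 3) (k : Fin 24) :
    degChar p (classRep k) = ω ^ ((p : ℕ) * degVal k) := by
  have h : ∀ k, (classDeg k).val = degVal k := by decide +kernel
  rw [degChar_classRep, h]

theorem rowOne_eq (p : Fin 3) (j : Fin 24) : rowOne p j = ω ^ ((p : ℕ) * degVal j) := by
  have h := ω_pow
  fin_cases p <;> fin_cases j <;> simp [rowOne, degVal] <;> grind

theorem rowTwo_eq (p : Fin 3) (j : Fin 24) :
    rowTwo p j = ω ^ ((p : ℕ) * degVal j) * rowTwo 0 j := by
  have h := ω_pow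
  fin_cases p <;> fin_cases j <;> simp [rowTwo, degVal] <;> grind

theorem rowThree_eq (p : Fin 3) (j : Fin 24) :
    rowThree p j = ω ^ ((p : ℕ) * degVal j) * rowThree 0 j := by
  have h := ω_pow
  fin_cases p <;> fin_cases j <;> simp [rowThree, degVal] <;> grind

theorem rowThreeBar_eq (p : Fin 3) (j : Fin 24) :
    rowThreeBar p j = (starRingEnd ℂ) (rowThree p j) := by
  have h := ω_pow
  fin_cases p <;> fin_cases j <;>
    simp [rowThree, rowThreeBar, star_ω, conj_ρ, conj_ρc, conj_σ, conj_σc, map_ofNat] <;> grind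

theorem rowSix_eq (p : Fin 3) (j : Fin 24) :
    rowSix p j = ω ^ ((p : ℕ) * degVal j) * rowSix 0 j := by
  have h := ω_pow
  fin_cases p <;> fin_cases j <;> simp [rowSix, degVal] <;> grind

theorem rowSix_zero (j : Fin 24) :
    rowSix 0 j = (starRingEnd ℂ) (rowThree 0 j) ^ 2 - rowThree 0 j := by
  have h := ω_pow
  have h1 := ω_sum
  have h2 := ρ_sq
  have h3 := ρc_sq
  have h4 := σ_def
  have h5 := σc_def
  fin_cases j <;>
    simp [rowThree, rowSix, star_ω, conj_ρ, conj_ρc, conj_σ, conj_σc, map_ofNat] <;> grind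

theorem rowSixBar_eq (p : Fin 3) (j : Fin 24) :
    rowSixBar p j = (starRingEnd ℂ) (rowSix p j) := by
  have h := ω_pow
  fin_cases p <;> fin_cases j <;>
    simp [rowSix, rowSixBar, star_ω, conj_ρ, conj_ρc, conj_σ, conj_σc, map_ofNat] <;> grind

theorem rowEight_eq (p : Fin 3) (j : Fin 24) :
    rowEight p j = ω ^ ((p : ℕ) * degVal j) * rowEight 0 j := by
  have h := ω_pow
  fin_cases p <;> fin_cases j <;> simp [rowEight, degVal] <;> grind

theorem rowEight_zero (j : Fin 24) :
    rowEight 0 j = rowThree 0 j * (starRingEnd ℂ) (rowThree 0 j) - 1 := by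
  have h := ω_pow
  have h1 := ω_sum
  have h2 := ρ_mul_ρc
  have h4 := σ_def
  have h5 := σc_def
  fin_cases j <;>
    simp [rowThree, rowEight, star_ω, conj_ρ, conj_ρc, conj_σ, conj_σc, map_ofNat] <;> grind

theorem rowNine_eq (j : Fin 24) : rowNine j = rowThree 0 j * rowThreeA j := by
  fin_cases j <;> simp [rowThree, rowThreeA, rowNine] <;> ring

theorem rowNineBar_eq (j : Fin 24) : rowNineBar j = (starRingEnd ℂ) (rowNine j) := by
  have h := ω_pow
  fin_cases j <;> simp [rowNine, rowNineBar, star_ω, map_ofNat] <;> grind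

/-- Each character is a polynomial in the defining character, its conjugate, the degree character
and the characters of the quotients. It remains to compare these expressions with the table. -/
theorem character_rep (k : Irrep) (j : Fin 24) :
    character (rep k) (classRep j) = charTable k j := by
  have h3 : ∀ p, character (repThree p) (classRep j) = rowThree p j := fun p => by
    rw [character_repThree, char_defining, degChar_classRep_eq, ← rowThree_eq]
  have h6 : ∀ p, character (repSix p) (classRep j) = rowSix p j := fun p => by
    rw [character_repSix, char_defining, degChar_classRep_eq, rowSix_eq, rowSix_zero]
  have h9 : character repNine (classRep j) = rowNine j := by
    rw [character_repNine, char_defining, character_repThreeA, rowNine_eq]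
  cases k with
  | one p => exact (character_repOne p _).trans (by rw [degChar_classRep_eq]; exact (rowOne_eq _ _).symm)
  | two p =>
    refine (character_repTwo p _).trans ?_
    rw [degChar_classRep_eq, character_repTwo_zero]
    exact (rowTwo_eq _ _).symm
  | threeA => exact character_repThreeA j
  | three p => exact h3 p
  | threeBar p =>
    exact (character_conjRep (repThree p) _).trans (by rw [h3]; exact (rowThreeBar_eq _ _).symm)
  | six p => exact h6 p
  | sixBar p =>
    exact (character_conjRep (repSix p) _).trans (by rw [h6]; exact (rowSixBar_eq _ _).symm)
  | eight p =>
    refine (character_repEight p _).trans ?_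
    rw [char_defining, degChar_classRep_eq, ← rowEight_zero]
    exact (rowEight_eq _ _).symm
  | nine => exact h9
  | nineBar => exact (character_conjRep repNine _).trans (by rw [h9]; exact (rowNineBar_eq _).symm)

/-! ### Irreducibility and completeness -/

/-- The class of the inverses of the elements of a class. -/
def invIdx : Fin 24 → Fin 24 :=
  ![0, 2, 1, 3, 4, 6, 5, 7, 9, 8, 11, 10, 16, 15, 17, 13, 12, 14, 21, 23, 22, 18, 20, 19]

theorem rowThree_invIdx (j : Fin 24) :
    rowThree 0 (invIdx j) = (starRingEnd ℂ) (rowThree 0 j) := by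
  have h := ω_pow
  fin_cases j <;>
    simp [rowThree, invIdx, star_ω, conj_ρ, conj_ρc, conj_σ, conj_σc, map_ofNat] <;> grind

theorem character_definingRep_inv (g : Sigma216x3) :
    character definingRep g⁻¹ = (starRingEnd ℂ) (character definingRep g) := by
  have h : definingRep g⁻¹ = (definingRep g).conjTranspose := rfl
  rw [character, h, Matrix.trace_conjTranspose]
  rfl

/-- The inverse has opposite degree and conjugate defining character, and these two invariants
identify its class. -/
theorem isConj_classRep_inv (j : Fin 24) : IsConj (classRep (invIdx j)) (classRep j)⁻¹ := by
  obtain ⟨k, hk⟩ := exists_isConj_classRep (classRep j)⁻¹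
  have h1 : classDeg k = -classDeg j := by
    have := isConj_iff_eq.1 (degHom.map_isConj hk)
    rw [map_inv, degHom_classRep, degHom_classRep] at this
    exact this
  have h2 : classDeg (invIdx j) = -classDeg j := by
    have key : ∀ j, classDeg (invIdx j) = -classDeg j := by decide +kernel
    exact key j
  have h3 := character_conj definingRep hk
  rw [character_definingRep_inv, char_defining, char_defining, ← rowThree_invIdx] at h3
  rwa [← eq_of_rowThree_eq (h1.trans h2.symm) h3]

theorem character_rep_inv (k : Irrep) (j : Fin 24) :
    character (rep k) (classRep j)⁻¹ = charTable k (invIdx j) := by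
  rw [← character_conj _ (isConj_classRep_inv j), character_rep]

/-- This sum and its analogues for the other rows compute the sum of `χ(g) χ(g⁻¹)` over the group,
class by class; the value 648 is the group order, hence norm 1. -/
theorem sum_rowOne (p : Fin 3) :
    ∑ j, (classSize j : ℂ) * (rowOne p j * rowOne p (invIdx j)) = 648 := by
  have h := ω_pow
  fin_cases p <;> simp [Fin.sum_univ_succ, rowOne, invIdx, classSize] <;> grind

theorem sum_rowTwo (p : Fin 3) :
    ∑ j, (classSize j : ℂ) * (rowTwo p j * rowTwo p (invIdx j)) = 648 := by
  have h := ω_pow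
  fin_cases p <;> simp [Fin.sum_univ_succ, rowTwo, invIdx, classSize] <;> grind

theorem sum_rowThree (p : Fin 3) :
    ∑ j, (classSize j : ℂ) * (rowThree p j * rowThree p (invIdx j)) = 648 := by
  have h := ω_pow
  have h1 := ω_sum
  have h2 := ρ_mul_ρc
  have h4 := σ_def
  have h5 := σc_def
  fin_cases p <;> simp [Fin.sum_univ_succ, rowThree, invIdx, classSize] <;> grind

theorem sum_rowThreeBar (p : Fin 3) :
    ∑ j, (classSize j : ℂ) * (rowThreeBar p j * rowThreeBar p (invIdx j)) = 648 := by
  have h := ω_pow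
  have h1 := ω_sum
  have h2 := ρ_mul_ρc
  have h4 := σ_def
  have h5 := σc_def
  fin_cases p <;> simp [Fin.sum_univ_succ, rowThreeBar, invIdx, classSize] <;> grind

theorem sum_rowSix (p : Fin 3) :
    ∑ j, (classSize j : ℂ) * (rowSix p j * rowSix p (invIdx j)) = 648 := by
  have h := ω_pow
  have h1 := ω_sum
  have h2 := ρ_mul_ρc
  have h4 := σ_def
  have h5 := σc_def
  fin_cases p <;> simp [Fin.sum_univ_succ, rowSix, invIdx, classSize] <;> grind

theorem sum_rowSixBar (p : Fin 3) :
    ∑ j, (classSize j : ℂ) * (rowSixBar p j * rowSixBar p (invIdx j)) = 648 := by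
  have h := ω_pow
  have h1 := ω_sum
  have h2 := ρ_mul_ρc
  have h4 := σ_def
  have h5 := σc_def
  fin_cases p <;> simp [Fin.sum_univ_succ, rowSixBar, invIdx, classSize] <;> grind

theorem sum_rowEight (p : Fin 3) :
    ∑ j, (classSize j : ℂ) * (rowEight p j * rowEight p (invIdx j)) = 648 := by
  have h := ω_pow
  fin_cases p <;> simp [Fin.sum_univ_succ, rowEight, invIdx, classSize] <;> grind

theorem sum_rowThreeA :
    ∑ j, (classSize j : ℂ) * (rowThreeA j * rowThreeA (invIdx j)) = 648 := by
  have h := ω_pow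
  simp [Fin.sum_univ_succ, rowThreeA, invIdx, classSize]
  grind

theorem sum_rowNine :
    ∑ j, (classSize j : ℂ) * (rowNine j * rowNine (invIdx j)) = 648 := by
  have h := ω_pow
  simp [Fin.sum_univ_succ, rowNine, invIdx, classSize]
  grind

theorem sum_rowNineBar :
    ∑ j, (classSize j : ℂ) * (rowNineBar j * rowNineBar (invIdx j)) = 648 := by
  have h := ω_pow
  simp [Fin.sum_univ_succ, rowNineBar, invIdx, classSize]
  grind

theorem sum_charTable (k : Irrep) :
    ∑ j, (classSize j : ℂ) * (charTable k j * charTable k (invIdx j)) = 648 := by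
  cases k with
  | one p => exact sum_rowOne p
  | two p => exact sum_rowTwo p
  | threeA => exact sum_rowThreeA
  | three p => exact sum_rowThree p
  | threeBar p => exact sum_rowThreeBar p
  | six p => exact sum_rowSix p
  | sixBar p => exact sum_rowSixBar p
  | eight p => exact sum_rowEight p
  | nine => exact sum_rowNine
  | nineBar => exact sum_rowNineBar

theorem isIrreducible_rep (k : Irrep) : (toRep (rep k)).IsIrreducible := by
  refine isIrreducible_of_sum_char _ ?_
  simp only [char_toRep]
  rw [sum_eq_sum_classSize (fun g => character (rep k) g * character (rep k) g⁻¹), card_Sigma216x3]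
  · simp only [character_rep, character_rep_inv]
    exact (sum_charTable k).trans (by norm_num)
  · intro g h hgh
    have h1 : IsConj g⁻¹ h⁻¹ := by
      obtain ⟨c, rfl⟩ := isConj_iff.1 hgh
      exact isConj_iff.2 ⟨c, by group⟩
    change _ * _ = _ * _
    rw [character_conj _ hgh, character_conj _ h1]

theorem ω_pow_fin_injective {p q : Fin 3} (h : ω ^ (p : ℕ) = ω ^ (q : ℕ)) : p = q := by
  have h1 := orderOf_eq_prime ω_pow ω_ne
  refine Fin.ext (pow_injOn_Iio_orderOf ?_ ?_ h) <;> rw [h1] <;> exact Fin.isLt _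

theorem eq_of_ω_pow_mul_eq {p q : Fin 3} {z : ℂ} (hz : z ≠ 0)
    (h : ω ^ ((p : ℕ) * degVal 12) * z = ω ^ ((q : ℕ) * degVal 12) * z) : p = q := by
  refine ω_pow_fin_injective ?_
  have := mul_right_cancel₀ hz h
  rwa [show degVal 12 = 1 from rfl, mul_one, mul_one] at this

theorem σc_ne_zero : σc ≠ 0 := by
  intro h
  -- Since `ρ` has modulus 1, this is the square of the modulus of `1 + 2ω`.
  have h1 : σc * σ = 3 := by
    have h2 := ρ_mul_ρc
    have h3 := ω_pow
    have h4 := ω_sum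
    rw [σ_def, σc_def]
    grind
  rw [h, zero_mul] at h1
  norm_num at h1

theorem ω_ne_zero : ω ≠ 0 := Complex.exp_ne_zero _

theorem rowTwo_injective {p q : Fin 3} (h : rowTwo p 12 = rowTwo q 12) : p = q := by
  rw [rowTwo_eq, rowTwo_eq q] at h
  exact eq_of_ω_pow_mul_eq (by simp [rowTwo]) h

theorem rowThree_injective {p q : Fin 3} (h : rowThree p 12 = rowThree q 12) : p = q := by
  rw [rowThree_eq, rowThree_eq q] at h
  exact eq_of_ω_pow_mul_eq (by simp [rowThree, ω_ne_zero, σc_ne_zero]) h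

theorem rowSix_injective {p q : Fin 3} (h : rowSix p 12 = rowSix q 12) : p = q := by
  rw [rowSix_eq, rowSix_eq q] at h
  exact eq_of_ω_pow_mul_eq (by simp [rowSix, ω_ne_zero, σc_ne_zero]) h

theorem rowEight_injective {p q : Fin 3} (h : rowEight p 12 = rowEight q 12) : p = q := by
  rw [rowEight_eq, rowEight_eq q] at h
  exact eq_of_ω_pow_mul_eq (by simp [rowEight]) h

/-- The value of each irreducible character on `ω𝟙`, as `a + b ω`. -/
def zVal : Irrep → ℤ × ℤ
  | .one _ => (1, 0)
  | .two _ => (2, 0)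
  | .threeA => (3, 0)
  | .three _ => (0, 3)
  | .threeBar _ => (-3, -3)
  | .six _ => (0, 6)
  | .sixBar _ => (-6, -6)
  | .eight _ => (8, 0)
  | .nine => (0, 9)
  | .nineBar => (-9, -9)

theorem charTable_one (k : Irrep) : charTable k 1 = (zVal k).1 + (zVal k).2 * ω := by
  have h := ω_sum
  cases k with
  | one p => fin_cases p <;> simp [charTable, zVal, rowOne]
  | two p => fin_cases p <;> simp [charTable, zVal, rowTwo]
  | threeA => simp [charTable, zVal, rowThreeA]
  | three p => fin_cases p <;> simp [charTable, zVal, rowThree]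
  | threeBar p => fin_cases p <;> simp [charTable, zVal, rowThreeBar] <;> grind
  | six p => fin_cases p <;> simp [charTable, zVal, rowSix]
  | sixBar p => fin_cases p <;> simp [charTable, zVal, rowSixBar] <;> grind
  | eight p => fin_cases p <;> simp [charTable, zVal, rowEight]
  | nine => simp [charTable, zVal, rowNine]
  | nineBar => simp [charTable, zVal, rowNineBar]; grind

/-- The value on `ω𝟙` separates the ten families; within a family the value on `D` carries the
factor `ω^p`, or its conjugate, which recovers `p`. -/
theorem eq_of_charTable_eq {k l : Irrep} (h1 : charTable k 1 = charTable l 1)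
    (h2 : charTable k 12 = charTable l 12) : k = l := by
  rw [charTable_one, charTable_one] at h1
  have h3 := int_add_mul_ω_injective h1
  have hc := (starRingEnd ℂ).injective
  cases k <;> cases l <;> first
    | (exfalso; revert h3; simp [zVal]; done)
    | skip
  · simp only [charTable, rowOne_eq] at h2
    exact congrArg _ (eq_of_ω_pow_mul_eq one_ne_zero (congrArg (· * 1) h2))
  · exact congrArg _ (rowTwo_injective h2)
  · rfl
  · exact congrArg _ (rowThree_injective h2)
  · simp only [charTable, rowThreeBar_eq] at h2
    exact congrArg _ (rowThree_injective (hc h2))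
  · exact congrArg _ (rowSix_injective h2)
  · simp only [charTable, rowSixBar_eq] at h2
    exact congrArg _ (rowSix_injective (hc h2))
  · exact congrArg _ (rowEight_injective h2)
  · rfl
  · rfl

theorem eq_of_equiv {k l : Irrep} (h : Nonempty ((toRep (rep k)).Equiv (toRep (rep l)))) :
    k = l := by
  obtain ⟨e⟩ := h
  have h1 : ∀ j, charTable k j = charTable l j := fun j => by
    rw [← character_rep, ← character_rep, ← char_toRep, ← char_toRep, Representation.char_iso e]
  exact eq_of_charTable_eq (h1 1) (h1 12)

/-- An enumeration of the irreps. -/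
def irrepOf : Fin 24 → Irrep :=
  ![.one 0, .one 1, .one 2, .two 0, .two 1, .two 2, .threeA, .three 0, .three 1, .three 2,
    .threeBar 0, .threeBar 1, .threeBar 2, .six 0, .six 1, .six 2, .sixBar 0, .sixBar 1, .sixBar 2,
    .eight 0, .eight 1, .eight 2, .nine, .nineBar]

def irrepIdx : Irrep → Fin 24
  | .one p => ![0, 1, 2] p
  | .two p => ![3, 4, 5] p
  | .threeA => 6
  | .three p => ![7, 8, 9] p
  | .threeBar p => ![10, 11, 12] p
  | .six p => ![13, 14, 15] p
  | .sixBar p => ![16, 17, 18] p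
  | .eight p => ![19, 20, 21] p
  | .nine => 22
  | .nineBar => 23

def irrepEquiv : Fin 24 ≃ Irrep where
  toFun := irrepOf
  invFun := irrepIdx
  left_inv := by intro k; fin_cases k <;> rfl
  right_inv := by
    intro k
    cases k <;> first | rfl | (rename_i p; fin_cases p <;> rfl)

instance : Fintype Irrep := Fintype.ofEquiv _ irrepEquiv

theorem card_Irrep : Nat.card Irrep = 24 := by rw [← Nat.card_congr irrepEquiv, Nat.card_fin]

theorem card_dim : Nat.card {k : Irrep // k.dim = 1} = 3 ∧ Nat.card {k : Irrep // k.dim = 2} = 3 ∧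
    Nat.card {k : Irrep // k.dim = 3} = 7 ∧ Nat.card {k : Irrep // k.dim = 6} = 6 ∧
    Nat.card {k : Irrep // k.dim = 8} = 3 ∧ Nat.card {k : Irrep // k.dim = 9} = 2 := by
  simp only [Nat.card_eq_fintype_card]
  decide +kernel

/-- Orthogonality with the column of the identity: the weighted sum is the regular character, as
required by `exists_equiv_of_sum_smul_char`. -/
theorem sum_dim_mul_charTable (j : Fin 24) :
    ∑ k : Irrep, (k.dim : ℂ) * charTable k j = if j = 0 then 648 else 0 := by
  have h1 := ω_sum
  rw [← irrepEquiv.sum_comp]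
  simp only [Fin.sum_univ_succ, irrepEquiv, irrepOf, Equiv.coe_fn_mk]
  fin_cases j <;> simp [charTable, Irrep.dim, rowOne, rowTwo, rowThreeA, rowThree, rowThreeBar,
    rowSix, rowSixBar, rowEight, rowNine, rowNineBar] <;> grind

theorem classRep_zero : classRep 0 = 1 := rfl

theorem isIrrepList_rep : IsIrrepList.{u} rep := by
  classical
  refine ⟨isIrreducible_rep, fun i j => eq_of_equiv, fun W _ _ _ τ hτ => ?_⟩
  have := isIrreducible_rep
  refine exists_equiv_of_sum_smul_char rep (fun k => (k.dim : ℂ)) (fun g => ?_) τ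
  obtain ⟨j, hj⟩ := exists_isConj_classRep g
  have h1 : (g = 1) = (j = 0) := by
    refine propext ⟨fun h => ?_, fun h => ?_⟩
    · rw [h] at hj
      exact classRep_injective (ConjClasses.mk_eq_mk_iff_isConj.2 hj)
    · rw [h, classRep_zero, isConj_one_right] at hj
      exact hj
  have h2 : ∀ k, (toRep (rep k)).character g = charTable k j := fun k => by
    rw [char_toRep, ← character_conj _ hj, character_rep]
  simp only [h1, h2, card_Sigma216x3]
  rw [sum_dim_mul_charTable]
  norm_num

/-! ### Tensor products -/

theorem char_tprod {G : Type*} [Group G] {m n : ℕ} (M : MatRep G m) (N : MatRep G n) (g : G) :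
    ((toRep M).tprod (toRep N)).character g = character M g * character N g := by
  rw [Representation.char_tensor, Pi.mul_apply, char_toRep, char_toRep]

theorem nonempty_equiv_tprod {m n : ℕ} (k : Irrep) (M : MatRep Sigma216x3 m)
    (N : MatRep Sigma216x3 n) (h : ∀ g, character (rep k) g = character M g * character N g) :
    Nonempty ((toRep (rep k)).Equiv ((toRep M).tprod (toRep N))) := by
  have := isIrreducible_rep k
  obtain ⟨e⟩ := nonempty_equiv_of_char_eq ((toRep M).tprod (toRep N)) (toRep (rep k))
    (funext fun g => by rw [char_tprod, char_toRep, h])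
  exact ⟨e.symm⟩

theorem nonempty_tprod_equiv_prod {m n : ℕ} {k l : Irrep} (hkl : k ≠ l) (M : MatRep Sigma216x3 m)
    (N : MatRep Sigma216x3 n)
    (h : ∀ g, character M g * character N g = character (rep k) g + character (rep l) g) :
    Nonempty (((toRep M).tprod (toRep N)).Equiv ((toRep (rep k)).prod (toRep (rep l)))) := by
  have := isIrreducible_rep k
  have := isIrreducible_rep l
  refine nonempty_equiv_prod_of_char_eq _ _ _ (fun he => hkl (eq_of_equiv he)) (funext fun g => ?_)
  rw [char_tprod, Pi.add_apply, char_toRep, char_toRep, h]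

theorem degChar_zero (g : Sigma216x3) : degChar 0 g = 1 := zChar_zero _

theorem three_equiv (p : Fin 3) : Nonempty ((toRep (rep (.three p))).Equiv
    ((toRep (rep (.one p))).tprod (toRep (rep (.three 0))))) :=
  nonempty_equiv_tprod _ _ _ fun g => by
    change character (repThree p) g = character (repOne p) g * character (repThree 0) g
    rw [character_repThree, character_repOne, character_repThree, degChar_zero, one_mul]

theorem six_equiv (p : Fin 3) : Nonempty ((toRep (rep (.six p))).Equiv
    ((toRep (rep (.one p))).tprod (toRep (rep (.six 0))))) :=
  nonempty_equiv_tprod _ _ _ fun g => by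
    change character (repSix p) g = character (repOne p) g * character (repSix 0) g
    rw [character_repSix, character_repOne, character_repSix, degChar_zero, one_mul]

theorem eight_equiv (p : Fin 3) : Nonempty ((toRep (rep (.eight p))).Equiv
    ((toRep (rep (.one p))).tprod (toRep (rep (.eight 0))))) :=
  nonempty_equiv_tprod _ _ _ fun g => by
    change character (repEight p) g = character (repOne p) g * character (repEight 0) g
    rw [character_repEight, character_repOne, character_repEight, degChar_zero, one_mul]

theorem nine_equiv : Nonempty ((toRep (rep .nine)).Equiv
    ((toRep (rep (.three 0))).tprod (toRep (rep .threeA)))) :=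
  nonempty_equiv_tprod _ _ _ fun g => by
    change character repNine g = character (repThree 0) g * character repThreeA g
    rw [character_repNine, character_repThree, degChar_zero, one_mul]

/-- The representation is integral, so its character is real. -/
theorem conj_character_repThreeA (g : Sigma216x3) :
    (starRingEnd ℂ) (character repThreeA g) = character repThreeA g := by
  have h : character repThreeA g = (((intHom g).1.trace : ℤ) : ℂ) := by
    rw [character, repThreeA_apply]
    exact (AddMonoidHom.map_trace (Int.castAddHom ℂ) _).symm
  rw [h, map_intCast]

theorem nineBar_equiv : Nonempty ((toRep (rep .nineBar)).Equiv
    ((toRep (rep (.threeBar 0))).tprod (toRep (rep .threeA)))) :=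
  nonempty_equiv_tprod _ _ _ fun g => by
    change character (conjRep repNine) g =
      character (conjRep (repThree 0)) g * character repThreeA g
    rw [character_conjRep, character_conjRep, character_repNine, character_repThree, degChar_zero,
      one_mul, map_mul, conj_character_repThreeA]

/-- On characters this is `χ² = conj χ + (χ² - conj χ)`, the splitting into antisymmetric and
symmetric parts. -/
theorem three_tprod_three : Nonempty (((toRep (rep (.three 0))).tprod (toRep (rep (.three 0)))).Equiv
    ((toRep (rep (.threeBar 0))).prod (toRep (rep (.sixBar 0))))) :=
  nonempty_tprod_equiv_prod (by simp) _ _ fun g => by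
    change character (repThree 0) g * character (repThree 0) g =
      character (conjRep (repThree 0)) g + character (conjRep (repSix 0)) g
    rw [character_conjRep, character_conjRep, character_repSix, character_repThree, degChar_zero,
      one_mul, one_mul, map_sub, map_pow, Complex.conj_conj]
    ring

theorem three_tprod_threeBar :
    Nonempty (((toRep (rep (.three 0))).tprod (toRep (rep (.threeBar 0)))).Equiv
      ((toRep (rep (.one 0))).prod (toRep (rep (.eight 0))))) :=
  nonempty_tprod_equiv_prod (by simp) _ _ fun g => by
    change character (repThree 0) g * character (conjRep (repThree 0)) g =
      character (repOne 0) g + character (repEight 0) g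
    rw [character_conjRep, character_repOne, character_repEight, character_repThree, degChar_zero,
      one_mul]
    ring

/-! ### The group `Σ(216)` -/

theorem Z3_subgroupOf : Z3.subgroupOf Sigma216x3 = Subgroup.zpowers gZ := by
  ext g
  rw [Subgroup.mem_subgroupOf, Z3, ← Subgroup.zpowers_eq_closure, Subgroup.mem_zpowers_iff,
    Subgroup.mem_zpowers_iff]
  exact exists_congr fun n => (Subtype.ext_iff (a1 := gZ ^ n) (a2 := g)).symm

theorem orderOf_gZ : orderOf gZ = 3 := orderOf_classRep 1

theorem card_Z3_subgroupOf : Nat.card (Z3.subgroupOf Sigma216x3) = 3 := by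
  rw [Z3_subgroupOf, Nat.card_zpowers, orderOf_gZ]

theorem card_Sigma216 : Nat.card Sigma216 = 216 := by
  have h := Subgroup.card_eq_card_quotient_mul_card_subgroup (Z3.subgroupOf Sigma216x3)
  rw [card_Sigma216x3, card_Z3_subgroupOf] at h
  change 648 = Nat.card Sigma216 * 3 at h
  omega

/-- The projection from `Σ(216×3)` to `Σ(216)`. -/
noncomputable abbrev proj : Sigma216x3 →* Sigma216 := QuotientGroup.mk' _

theorem proj_surjective : Function.Surjective proj := QuotientGroup.mk'_surjective _

theorem proj_gZ : proj gZ = 1 := by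
  rw [QuotientGroup.mk'_apply, QuotientGroup.eq_one_iff, Z3_subgroupOf]
  exact Subgroup.mem_zpowers gZ

/-- Triviality in the quotient becomes membership in a list of three exponents, hence decidable. -/
theorem proj_gEquiv_eq_one (x : GIdx) :
    proj (gEquiv x) = 1 ↔ x ∈ [gOne, iZ, gMul iZ iZ] := by
  classical
  have h : ({gEquiv gOne, gEquiv iZ, gEquiv (gMul iZ iZ)} : Set Sigma216x3) =
      (Subgroup.zpowers gZ : Set Sigma216x3) := by
    ext g
    rw [SetLike.mem_coe, mem_zpowers_iff_mem_range_orderOf, orderOf_gZ, gEquiv_one, ← gEquiv_mul,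
      ← gZ_eq]
    simp [Finset.range_add_one, pow_two]
    tauto
  rw [QuotientGroup.mk'_apply, QuotientGroup.eq_one_iff, Z3_subgroupOf, ← SetLike.mem_coe, ← h]
  simp

open Classical in
noncomputable instance : Fintype Sigma216 := Fintype.ofSurjective proj proj_surjective

/-- All fibres of the projection are cosets of a kernel of order 3. -/
theorem sum_proj (f : Sigma216 → ℂ) : ∑ g, f (proj g) = 3 * ∑ x, f x := by
  classical
  have h : ∀ x : Sigma216, (Finset.univ.filter fun g => proj g = x).card = 3 := by
    intro x
    have hk : Nat.card proj.ker = 3 := by rw [QuotientGroup.ker_mk', card_Z3_subgroupOf]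
    refine Eq.trans ?_ hk
    obtain ⟨g, rfl⟩ := proj_surjective x
    rw [Nat.card_eq_fintype_card, Fintype.card_subtype]
    refine Finset.card_bij (fun y _ => g⁻¹ * y) ?_ ?_ ?_
    · intro y hy
      refine Finset.mem_filter.2 ⟨Finset.mem_univ _, ?_⟩
      rw [MonoidHom.mem_ker, map_mul, map_inv, (Finset.mem_filter.1 hy).2, inv_mul_cancel]
    · intro a _ b _ hab
      exact mul_left_cancel hab
    · intro b hb
      refine ⟨g * b, ?_, inv_mul_cancel_left g b⟩
      refine Finset.mem_filter.2 ⟨Finset.mem_univ _, ?_⟩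
      rw [map_mul, MonoidHom.mem_ker.1 (Finset.mem_filter.1 hb).2, mul_one]
  rw [← Finset.sum_fiberwise Finset.univ proj, Finset.mul_sum]
  refine Finset.sum_congr rfl fun x _ => ?_
  rw [Finset.sum_congr rfl (g := fun _ => f x), Finset.sum_const, h x, nsmul_eq_mul]
  · norm_num
  · intro g hg
    rw [(Finset.mem_filter.1 hg).2]

/-- The class of `Σ(216×3)` whose representative is the given representative of a class of
`Σ(216)`. -/
def liftIdx : Fin 10 → Fin 24 := ![0, 3, 4, 7, 10, 11, 12, 15, 18, 21]

theorem classRep216_eq (k : Fin 10) : classRep216 k = proj (classRep (liftIdx k)) := by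
  fin_cases k <;> rfl

theorem proj_classRep (k : Fin 24) : proj (classRep k) = classRep216 (collapse k) := by
  obtain ⟨i, hi⟩ := classRep_eq_mul k
  have h : ∀ k, classBase k = liftIdx (collapse k) := by decide +kernel
  rw [hi, map_mul, map_pow, proj_gZ, one_pow, one_mul, classRep216_eq, h]

theorem orderOf_classRep216 (k : Fin 10) : orderOf (classRep216 k) = classOrder216 k := by
  have h0 : ∀ k : Fin 10, 0 < classOrder216 k := by decide +kernel
  have h1 : ∀ k : Fin 10, gPow (classIdx (liftIdx k)) (classOrder216 k) ∈
      [gOne, iZ, gMul iZ iZ] := by decide +kernel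
  have h2 : ∀ k : Fin 10, ∀ m < classOrder216 k, 0 < m →
      decide (gPow (classIdx (liftIdx k)) m ∈ [gOne, iZ, gMul iZ iZ]) = false := by decide +kernel
  have h3 : ∀ m, classRep216 k ^ m = 1 ↔
      gPow (classIdx (liftIdx k)) m ∈ [gOne, iZ, gMul iZ iZ] := fun m => by
    rw [classRep216_eq, ← map_pow, classRep_eq, gEquiv_pow, proj_gEquiv_eq_one]
  rw [orderOf_eq_iff (h0 k)]
  exact ⟨(h3 _).2 (h1 k), fun m hm hm0 h => of_decide_eq_false (h2 k m hm hm0) ((h3 m).1 h)⟩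

/-! #### The representations of `Σ(216)` -/

theorem definingRep_gZ : definingRep gZ = ω • (1 : Matrix (Fin 3) (Fin 3) ℂ) := by
  change matZ = _
  rw [matZ]
  ext i j
  fin_cases i <;> fin_cases j <;> simp

/-- On `3 ⊗ 3*` the scalar `ω` acts by `ω · ω² = 1`. -/
theorem adjRep_gZ : adjRep definingRep definingRep_mem_unitary gZ = 1 := by
  have h : kron definingRep (conjRep definingRep) gZ = 1 := by
    have h1 : conjRep definingRep gZ = ω ^ 2 • (1 : Matrix (Fin 3) (Fin 3) ℂ) := by
      change (definingRep gZ).map _ = _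
      rw [definingRep_gZ]
      ext i j
      by_cases hij : i = j <;> simp [hij, star_ω]
    change Matrix.kroneckerMap _ (definingRep gZ) (conjRep definingRep gZ) = 1
    rw [definingRep_gZ, h1, Matrix.smul_kronecker, Matrix.kronecker_smul, smul_smul,
      Matrix.one_kronecker_one, ← pow_succ', ω_pow, one_smul]
  simp only [adjRep, compress, MonoidHom.coe_mk, OneHom.coe_mk, h]
  rw [Matrix.mul_one, ← Matrix.map_mul, tracelessProj_mul_tracelessIncl,
    Matrix.map_one _ (map_zero _) (map_one _)]

theorem rep_irrep216_gZ (k : Fin 10) : rep (irrep216 k) gZ = 1 := by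
  have h1 : ∀ p, repOne p gZ = 1 := fun p => by simp [repOne, degHom_Z]
  have h2 : ∀ p, repTwo p gZ = 1 := fun p => by simp [repTwo, tPrimeHom_Z]
  have h3 : repThreeA gZ = 1 := by
    rw [repThreeA_apply, show intHom gZ = 1 from tetraHom_Z _ _]
    simp
  have h8 : ∀ p, repEight p gZ = 1 := fun p => by
    change degChar p gZ • adjRep definingRep definingRep_mem_unitary gZ = 1
    rw [adjRep_gZ, degChar, MonoidHom.comp_apply, degHom_Z, map_one, one_smul]
  fin_cases k
  exacts [h1 0, h1 1, h1 2, h2 0, h2 1, h2 2, h3, h8 0, h8 1, h8 2]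

noncomputable def rep216 (k : Fin 10) : MatRep Sigma216 (irrep216 k).dim :=
  QuotientGroup.lift _ (rep (irrep216 k)) (by
    rw [Z3_subgroupOf, Subgroup.zpowers_le]
    exact rep_irrep216_gZ k)

theorem character_rep216_proj (k : Fin 10) (g : Sigma216x3) :
    character (rep216 k) (proj g) = character (rep (irrep216 k)) g := rfl

theorem charTable216_eq (k j : Fin 10) : charTable216 k j = charTable (irrep216 k) (liftIdx j) := by
  fin_cases k <;> fin_cases j <;> rfl

theorem character_rep216 (k j : Fin 10) :
    character (rep216 k) (classRep216 j) = charTable216 k j := by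
  rw [classRep216_eq, character_rep216_proj, character_rep, charTable216_eq]

theorem classRep216_injective :
    Function.Injective fun k : Fin 10 => ConjClasses.mk (classRep216 k) := by
  intro k l hkl
  have hc : IsConj (classRep216 k) (classRep216 l) := ConjClasses.mk_eq_mk_iff_isConj.1 hkl
  have h : ∀ i, charTable216 i k = charTable216 i l := fun i => by
    rw [← character_rep216, ← character_rep216, character_conj _ hc]
  -- The characters of `2⁽⁰⁾` and `8⁽⁰⁾`; with the exponents `d` of `1⁽¹⁾` they separate the ten
  -- columns.
  let v : Fin 10 → ℤ × ℤ := ![(2, 8), (2, -1), (-2, 0), (0, 0), (-1, -1), (-1, -1), (-1, 2), (-1, 2),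
    (1, 0), (1, 0)]
  let d : Fin 10 → Fin 3 := ![0, 0, 0, 0, 1, 2, 1, 2, 1, 2]
  have h1 : ∀ i, charTable216 1 i = ω ^ (d i : ℕ) := fun i => by
    fin_cases i <;> simp [charTable216, d]
  have h3 : ∀ i, charTable216 3 i = ((v i).1 : ℂ) := fun i => by
    fin_cases i <;> simp [charTable216, v]
  have h7 : ∀ i, charTable216 7 i = ((v i).2 : ℂ) := fun i => by
    fin_cases i <;> simp [charTable216, v]
  have e1 : d k = d l := ω_pow_fin_injective (by rw [← h1, ← h1, h])
  have e2 : (v k).1 = (v l).1 := by exact_mod_cast (h3 k).symm.trans ((h 3).trans (h3 l))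
  have e3 : (v k).2 = (v l).2 := by exact_mod_cast (h7 k).symm.trans ((h 7).trans (h7 l))
  have key : ∀ k l, d k = d l → v k = v l → k = l := by decide +kernel
  exact key k l e1 (Prod.ext e2 e3)

theorem classRep216_surjective :
    Function.Surjective fun k : Fin 10 => ConjClasses.mk (classRep216 k) := by
  intro c
  obtain ⟨x, rfl⟩ := ConjClasses.exists_rep c
  obtain ⟨g, rfl⟩ := proj_surjective x
  obtain ⟨k, hk⟩ := exists_isConj_classRep g
  refine ⟨collapse k, ConjClasses.mk_eq_mk_iff_isConj.2 ?_⟩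
  rw [← proj_classRep]
  exact proj.map_isConj hk

/-- The preimage of a class is the union of the classes collapsing to it and has three times as many
elements; `sum_proj` is applied to the indicator function. -/
theorem card_carrier_classRep216 (k : Fin 10) :
    Nat.card (ConjClasses.mk (classRep216 k)).carrier = classSize216 k := by
  classical
  have h1 : ∀ j, ConjClasses.mk (proj (classRep j)) = ConjClasses.mk (classRep216 k) ↔
      collapse j = k := fun j => by
    rw [proj_classRep]
    exact classRep216_injective.eq_iff
  have h2 := sum_proj fun x => if ConjClasses.mk x = ConjClasses.mk (classRep216 k) then 1 else 0
  rw [sum_eq_sum_classSize (fun g => if ConjClasses.mk (proj g) = ConjClasses.mk (classRep216 k)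
    then 1 else 0)] at h2
  · simp only [h1, Finset.sum_boole, mul_ite, mul_one, mul_zero] at h2
    have h3 : ∀ k, ∑ j, (if collapse j = k then classSize j else 0) = 3 * classSize216 k := by
      decide +kernel
    have h4 : 3 * classSize216 k = 3 * (Finset.univ.filter fun x : Sigma216 =>
        ConjClasses.mk x = ConjClasses.mk (classRep216 k)).card := by
      rw [← h3]
      exact_mod_cast h2
    rw [Nat.card_eq_fintype_card, Fintype.card_subtype, ← Nat.eq_of_mul_eq_mul_left three_pos h4.symm]
    simp only [ConjClasses.mem_carrier_iff_mk_eq]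
  · intro g h hgh
    change (if _ then _ else _) = (if _ then _ else _)
    rw [ConjClasses.mk_eq_mk_iff_isConj.2 (proj.map_isConj hgh)]

/-- The norm sum over `Σ(216×3)` is three times that over the quotient, so the norm criterion
descends. -/
theorem isIrreducible_rep216 (k : Fin 10) : (toRep (rep216 k)).IsIrreducible := by
  refine isIrreducible_of_sum_char _ ?_
  have := isIrreducible_rep (irrep216 k)
  have h1 := sum_char_irreducible (toRep (rep (irrep216 k)))
  simp only [char_toRep] at h1
  have h2 := sum_proj fun x => character (rep216 k) x * character (rep216 k) x⁻¹
  simp only [← map_inv, character_rep216_proj] at h2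
  rw [h1, card_Sigma216x3] at h2
  simp only [char_toRep]
  rw [card_Sigma216]
  push_cast at h2 ⊢
  linear_combination -h2 / 3

theorem sum_dim_mul_charTable216 (j : Fin 10) :
    ∑ k, ((irrep216 k).dim : ℂ) * charTable216 k j = if j = 0 then 216 else 0 := by
  have h1 := ω_sum
  fin_cases j <;> simp [Fin.sum_univ_succ, charTable216, irrep216, Irrep.dim] <;> grind

theorem isIrrepList_rep216 : IsIrrepList.{u} rep216 := by
  classical
  refine ⟨isIrreducible_rep216, fun i j ⟨e⟩ => ?_, fun W _ _ _ τ hτ => ?_⟩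
  · have h1 : ∀ l, charTable (irrep216 i) l = charTable (irrep216 j) l := fun l => by
      rw [← character_rep, ← character_rep, ← character_rep216_proj, ← character_rep216_proj,
        ← char_toRep, ← char_toRep, Representation.char_iso e]
    -- Equivalent representations of the quotient have equal pulled-back characters; columns 1 and
    -- 12 belong to `ω𝟙` and `D`.
    have h2 := congrArg irrepIdx (eq_of_charTable_eq (h1 1) (h1 12))
    have key : ∀ i j, irrepIdx (irrep216 i) = irrepIdx (irrep216 j) → i = j := by decide +kernel
    exact key i j h2
  · have := isIrreducible_rep216
    refine exists_equiv_of_sum_smul_char rep216 (fun k => ((irrep216 k).dim : ℂ)) (fun x => ?_) τ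
    obtain ⟨j, hj⟩ := classRep216_surjective (ConjClasses.mk x)
    have hj' : IsConj (classRep216 j) x := ConjClasses.mk_eq_mk_iff_isConj.1 hj
    have h0 : classRep216 0 = 1 := rfl
    have h1 : (x = 1) = (j = 0) := by
      refine propext ⟨fun h => ?_, fun h => ?_⟩
      · rw [h, ← h0] at hj
        exact classRep216_injective hj
      · rw [h, h0, isConj_one_right] at hj'
        exact hj'
    have h2 : ∀ k, (toRep (rep216 k)).character x = charTable216 k j := fun k => by
      rw [char_toRep, ← character_conj _ hj', character_rep216]
    simp only [h1, h2, card_Sigma216]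
    rw [sum_dim_mul_charTable216]
    norm_num

end Hessian

/-! ### The theorem on `Σ(216×3)` and `Σ(216)`. -/

theorem mainTheorem3 :
    -- the conjugacy classes of `Σ(216×3)`
    (Nat.card Sigma216x3 = 648 ∧
      Function.Bijective (fun k : Fin 24 => ConjClasses.mk (classRep k)) ∧
      (∀ k, Nat.card (ConjClasses.mk (classRep k)).carrier = classSize k) ∧
      (∀ k, orderOf (classRep k) = classOrder k) ∧
      conjOrbit Sigma216x3 suC = conjOrbit Sigma72x3 suC ∧
      conjOrbit Sigma216x3 (suV ^ 2) = conjOrbit Sigma72x3 (suV ^ 2) ∧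
      conjOrbit Sigma216x3 suV = conjOrbit Sigma72x3 suV ∪ conjOrbit Sigma72x3 suX ∪
        conjOrbit Sigma72x3 (suZ ^ 2 * (suV * suX))) ∧
    -- the conjugacy classes of `Σ(216)`
    (Nat.card Sigma216 = 216 ∧
      Function.Bijective (fun k : Fin 10 => ConjClasses.mk (classRep216 k)) ∧
      (∀ k, Nat.card (ConjClasses.mk (classRep216 k)).carrier = classSize216 k) ∧
      (∀ k, orderOf (classRep216 k) = classOrder216 k) ∧
      (∀ k : Fin 24, ConjClasses.mk (QuotientGroup.mk (classRep k) : Sigma216) =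
        ConjClasses.mk (classRep216 (collapse k)))) ∧
    -- the number of irreps of each dimension
    (Nat.card Irrep = 24 ∧
      Nat.card {k : Irrep // k.dim = 1} = 3 ∧ Nat.card {k : Irrep // k.dim = 2} = 3 ∧
      Nat.card {k : Irrep // k.dim = 3} = 7 ∧ Nat.card {k : Irrep // k.dim = 6} = 6 ∧
      Nat.card {k : Irrep // k.dim = 8} = 3 ∧ Nat.card {k : Irrep // k.dim = 9} = 2) ∧
    ∃ R : ∀ k : Irrep, MatRep Sigma216x3 k.dim,
      -- the irreps of `Σ(216×3)` and their characters
      IsIrrepList.{u} R ∧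
      (∀ (k : Irrep) (j : Fin 24), character (R k) (classRep j) = charTable k j) ∧
      -- `1⁽ᵖ⁾` comes from `Σ(216×3)/Σ(72×3) ≅ ℤ₃`
      (Sigma72x3 ≤ Sigma216x3 ∧
        ∃ (_ : (Sigma72x3.subgroupOf Sigma216x3).Normal)
          (f : Sigma216x3 ⧸ Sigma72x3.subgroupOf Sigma216x3 ≃* Multiplicative (ZMod 3)),
          f (QuotientGroup.mk gD) = Multiplicative.ofAdd 1 ∧
          ∀ p : Fin 3, ∃ τ : MatRep (Multiplicative (ZMod 3)) 1,
            τ (Multiplicative.ofAdd 1) = !![ω ^ (p : ℕ)] ∧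
            ∀ g : Sigma216x3, (R (.one p) : MatRep Sigma216x3 1) g = τ (f (QuotientGroup.mk g))) ∧
      -- `2⁽ᵖ⁾` comes from `Σ(216×3)/Δ(27) ≅ T'`
      (Delta27 ≤ Sigma216x3 ∧
        ∃ (_ : (Delta27.subgroupOf Sigma216x3).Normal)
          (f : Sigma216x3 ⧸ Delta27.subgroupOf Sigma216x3 ≃* TPrime),
          f (QuotientGroup.mk gV) = tS ∧ f (QuotientGroup.mk gD) = tT ∧
          ∀ p : Fin 3, ∃ τ : MatRep TPrime 2,
            τ tS = matUa ∧ τ tT = ω ^ (p : ℕ) • matUt ∧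
            ∀ g : Sigma216x3, (R (.two p) : MatRep Sigma216x3 2) g = τ (f (QuotientGroup.mk g))) ∧
      -- `3⁽ᵃ⁾` comes from `Σ(216×3)/Δ(54) ≅ A₄`
      (Delta54 ≤ Sigma216x3 ∧
        ∃ (_ : (Delta54.subgroupOf Sigma216x3).Normal)
          (f : Sigma216x3 ⧸ Delta54.subgroupOf Sigma216x3 ≃* alternatingGroup (Fin 4)),
          ∃ τ : MatRep (alternatingGroup (Fin 4)) 3,
            τ (f (QuotientGroup.mk gV)) = matRa ∧ τ (f (QuotientGroup.mk gD)) = matRa * matRb ∧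
            ∀ g : Sigma216x3, (R .threeA : MatRep Sigma216x3 3) g = τ (f (QuotientGroup.mk g))) ∧
      -- the other irreps come from tensor products of the defining irrep
      ((R (.three 0) : MatRep Sigma216x3 3) = definingRep ∧
        (∀ p, Nonempty ((toRep (R (.three p))).Equiv
          ((toRep (R (.one p))).tprod (toRep (R (.three 0)))))) ∧
        (∀ p, (R (.threeBar p) : MatRep Sigma216x3 3) = conjRep (R (.three p))) ∧
        Nonempty (((toRep (R (.three 0))).tprod (toRep (R (.three 0)))).Equiv
          ((toRep (R (.threeBar 0))).prod (toRep (R (.sixBar 0))))) ∧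
        (∀ p, Nonempty ((toRep (R (.six p))).Equiv
          ((toRep (R (.one p))).tprod (toRep (R (.six 0)))))) ∧
        (∀ p, (R (.sixBar p) : MatRep Sigma216x3 6) = conjRep (R (.six p))) ∧
        Nonempty (((toRep (R (.three 0))).tprod (toRep (R (.threeBar 0)))).Equiv
          ((toRep (R (.one 0))).prod (toRep (R (.eight 0))))) ∧
        (∀ p, Nonempty ((toRep (R (.eight p))).Equiv
          ((toRep (R (.one p))).tprod (toRep (R (.eight 0)))))) ∧
        Nonempty ((toRep (R .nine)).Equiv ((toRep (R (.three 0))).tprod (toRep (R .threeA)))) ∧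
        (R .nineBar : MatRep Sigma216x3 9) = conjRep (R .nine) ∧
        Nonempty ((toRep (R .nineBar)).Equiv
          ((toRep (R (.threeBar 0))).tprod (toRep (R .threeA))))) ∧
      -- the irreps of `Σ(216)` and their characters
      ∃ S : ∀ k : Fin 10, MatRep Sigma216 (irrep216 k).dim,
        (∀ k, ∀ g : Sigma216x3, R (irrep216 k) g = S k (QuotientGroup.mk g)) ∧
        IsIrrepList.{u} S ∧
        ∀ k j : Fin 10, character (S k) (classRep216 j) = charTable216 k j := by
  refine ⟨⟨card_Sigma216x3, ⟨classRep_injective, classRep_surjective⟩, card_carrier_classRep,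
      orderOf_classRep, conjOrbit_C, conjOrbit_V_sq, conjOrbit_V⟩,
    ⟨card_Sigma216, ⟨classRep216_injective, classRep216_surjective⟩, card_carrier_classRep216,
      orderOf_classRep216, fun k => congrArg ConjClasses.mk (proj_classRep k)⟩,
    ⟨card_Irrep, card_dim⟩, rep, isIrrepList_rep, character_rep, ⟨Sigma72x3_le, ?_⟩,
    ⟨Delta27_le, ?_⟩, ⟨Delta54_le, ?_⟩,
    ⟨repThree_zero, three_equiv, fun _ => rfl, three_tprod_three, six_equiv, fun _ => rfl,
      three_tprod_threeBar, eight_equiv, nine_equiv, rfl, nineBar_equiv⟩,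
    rep216, fun _ _ => rfl, isIrrepList_rep216, character_rep216⟩
  · obtain ⟨hn, f, hf⟩ := exists_quotient_equiv degHom degHom_surjective Sigma72x3_subgroupOf
    refine ⟨hn, f, (hf gD).trans degHom_D, fun p => ⟨zRep p, zRep_apply p, fun g => ?_⟩⟩
    rw [hf]
    rfl
  · obtain ⟨hn, f, hf⟩ := exists_quotient_equiv tPrimeHom tPrimeHom_surjective Delta27_subgroupOf
    refine ⟨hn, f, (hf gV).trans tPrimeHom_V, (hf gD).trans tPrimeHom_D,
      fun p => ⟨tRep p, tRep_S p, tRep_T p, fun g => ?_⟩⟩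
    rw [hf]
    rfl
  · obtain ⟨hn, f, hf⟩ := exists_quotient_equiv altHom altHom_surjective Delta54_subgroupOf
    refine ⟨hn, f, altRep, ?_, ?_, fun g => ?_⟩
    · rw [hf]
      exact repThreeA_V
    · rw [hf]
      exact repThreeA_D
    · rw [hf]
      rfl
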